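/- Let $K$ be a field of characteristic $0$ (for example $\mathbb R$ or $\mathbb C$). For a generalized Cartan matrix $A$, the Kac--Moody algebra of $A$ means here the Lie algebra over $K$ generated by $e_i,f_i,h_i$ with the Chevalley--Serre relations, where $[h_i,e_j]=A_{ij}e_j$. Its root space for $\mu=\sum_i\mu_i\alpha_i\ne0$ is the span of the bracket monomials in the generators of degree $\mu$, where $e_i$, $f_i$, $h_i$ have the degrees $\alpha_i$, $-\alpha_i$, $0$; the monomials of degree $0$ span the Cartan subalgebra. A node $s$ generates a grading of the algebra: the subspace of degree $k$ is the sum of these spaces over those $\mu$ with $\mu_s=-k$ (so $e_s$ has degree $-1$). A graded involution is an automorphism $\tau$ with $\tau^2=1$ that maps degree $k$ to degree $-k$ for all $k$. Let $\mathfrak h$ be the Kac--Moody algebra of a Cartan matrix $A$ of finite type, let $d_i>0$ be rational numbers such that $(d_iA_{ij})$ is symmetric and positive definite, and let $s$ be a node of the Dynkin diagram of $\mathfrak h$ (the black node). Let $n\ge 2$, and let $\mathfrak g$ be the Kac--Moody algebra whose Dynkin diagram is obtained from that of $\mathfrak h$ by attaching a chain of $n-1$ new nodes $1,2,\dots,n-1$,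 with single lines $1-2-\cdots-(n-1)-s$. Give $\mathfrak h$ and $\mathfrak g$ the gradings generated by $s$, let $\mathfrak h\to\mathfrak g$ be the homomorphism that sends generators to generators with the same name, and let $\tau$ be a graded involution of $\mathfrak h$. (i) There is a unique bilinear form $(\cdot,\cdot)$ on $\mathfrak h_{-1}$ associated to $\tau$, that is, one with $(e_\mu,\tau(f_\nu))=\delta_{\mu\nu}$ for root vectors $e_\mu\in\mathfrak h_{-1}$ of the root $\mu$ and $f_\nu\in\mathfrak h_1$ of the root $-\nu$, where the root vectors are normalized by $[e_\mu,f_\mu]=\sum_i\mu_i\,(d_i/d_s)\,h_i$. (Equivalently, without the normalization: $(x,\tau(y))=0$ for root vectors $x\in\mathfrak h_{-1}$ and $y\in\mathfrak h_1$ of roots $\mu$ and $-\nu$ with $\mu\neq\nu$, and $[x,y]=(x,\tau(y))\sum_i\mu_i(d_i/d_s)h_i$ if $\mu=\nu$.) (ii) There is a unique graded involution of $\mathfrak g$, again denoted $\tau$, that extends the one of $\mathfrak h$ and satisfies $\tau(e_i)=-f_i$ for $i=1,\dots,n-1$. (iii) For $x\in\mathfrak h_{-1}$ let $x^a\in(\mathfrak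 h_{-1})^n$ denote the element with $x$ in position $a$ and $0$ elsewhere. The vector space $(\mathfrak h_{-1})^n$ with the trilinear product given by $$(x^a y^b z^c)=\delta^{ab}[[x,\tau(y)],z]^c-\delta^{ab}(x,y)\,z^c+\delta^{bc}(x,y)\,z^a\qquad(a,b,c=1,\dots,n;\ x,y,z\in\mathfrak h_{-1})$$ is isomorphic, as a triple system, to $\mathfrak g_{-1}$ with the triple product $(uvw)=[[u,\tau(v)],w]$. -/

import Mathlib

/-! Kac-Moody algebras are Mathlib's `Matrix.ToLieAlgebra K A`: generators `H i, E i, F i` with the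
Chevalley-Serre relations, where `⁅H i, E j⁆ = A i j • E j`. -/

namespace KacMoody

noncomputable section

open CartanMatrix

section Generators

variable (K : Type*) [Field K] {B : Type*} [DecidableEq B] (A : Matrix B B ℤ)

/-- The quotient map from the free Lie algebra on the symbols `H i, E i, F i`. -/
def proj : FreeLieAlgebra K (Generators B) →ₗ⁅K⁆ A.ToLieAlgebra K :=
  { (LieSubmodule.Quotient.mk' (Relations.toIdeal K A) :
      FreeLieAlgebra K (Generators B) →ₗ[K]
        FreeLieAlgebra K (Generators B) ⧸ Relations.toIdeal K A) with
    map_lie' := fun {x y} => LieSubmodule.Quotient.mk_bracket (I := Relations.toIdeal K A) x y }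

/-- The simple root vector `e_i`. -/
def e (i : B) : A.ToLieAlgebra K := proj K A (FreeLieAlgebra.of K (Generators.E i))

/-- The simple root vector `f_i` for the negative of the simple root. -/
def f (i : B) : A.ToLieAlgebra K := proj K A (FreeLieAlgebra.of K (Generators.F i))

/-- The simple coroot `h_i = ⁅e_i, f_i⁆`. -/
def h (i : B) : A.ToLieAlgebra K := proj K A (FreeLieAlgebra.of K (Generators.H i))

end Generators

section Lift

variable {K : Type*} [Field K] {B : Type*} [DecidableEq B] {A : Matrix B B ℤ}

theorem proj_eq_zero {x : FreeLieAlgebra K (Generators B)} (hx : x ∈ Relations.toSet K A) :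
    proj K A x = 0 :=
  (Submodule.Quotient.mk_eq_zero _).2 (LieSubmodule.subset_lieSpan hx)

theorem h_lie_h (i j : B) : ⁅h K A i, h K A j⁆ = 0 := by
  have := proj_eq_zero (K := K) (A := A) (x := Relations.HH K (i, j))
    (by simp only [Relations.toSet, Set.mem_union, Set.mem_range_self, true_or])
  simpa [Relations.HH, h] using this

theorem e_lie_f_same (i : B) : ⁅e K A i, f K A i⁆ = h K A i := by
  have := proj_eq_zero (K := K) (A := A) (x := Relations.EF K (i, i))
    (by simp only [Relations.toSet, Set.mem_union, Set.mem_range_self, true_or, or_true])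
  simpa [Relations.EF, h, e, f, sub_eq_zero] using this

theorem e_lie_f_ne {i j : B} (hij : i ≠ j) : ⁅e K A i, f K A j⁆ = 0 := by
  have := proj_eq_zero (K := K) (A := A) (x := Relations.EF K (i, j))
    (by simp only [Relations.toSet, Set.mem_union, Set.mem_range_self, true_or, or_true])
  simpa [Relations.EF, e, f, hij] using this

theorem h_lie_e (i j : B) : ⁅h K A i, e K A j⁆ = A i j • e K A j := by
  have := proj_eq_zero (K := K) (A := A) (x := Relations.HE K A (i, j))
    (by simp only [Relations.toSet, Set.mem_union, Set.mem_range_self, true_or, or_true])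
  simpa [Relations.HE, h, e, sub_eq_zero] using this

theorem h_lie_f (i j : B) : ⁅h K A i, f K A j⁆ = -(A i j • f K A j) := by
  have := proj_eq_zero (K := K) (A := A) (x := Relations.HF K A (i, j))
    (by simp only [Relations.toSet, Set.mem_union, Set.mem_range_self, true_or, or_true])
  simpa [Relations.HF, h, f, add_eq_zero_iff_eq_neg] using this

theorem map_ad_pow {L M : Type*} [LieRing L] [LieAlgebra K L] [LieRing M] [LieAlgebra K M]
    (g : L →ₗ⁅K⁆ M) (x y : L) (n : ℕ) :
    g (((LieAlgebra.ad K L x) ^ n) y) = ((LieAlgebra.ad K M (g x)) ^ n) (g y) := by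
  induction n with
  | zero => simp
  | succ n ih => rw [pow_succ', pow_succ']; simp [ih]

theorem serre_e (i j : B) :
    ((LieAlgebra.ad K (A.ToLieAlgebra K) (e K A i)) ^ (-A i j).toNat) ⁅e K A i, e K A j⁆ = 0 := by
  have := proj_eq_zero (K := K) (A := A) (x := Relations.adE K A (i, j))
    (by simp only [Relations.toSet, Set.mem_union, Set.mem_range_self, true_or, or_true])
  simpa [Relations.adE, map_ad_pow, e] using this

theorem serre_f (i j : B) :
    ((LieAlgebra.ad K (A.ToLieAlgebra K) (f K A i)) ^ (-A i j).toNat) ⁅f K A i, f K A j⁆ = 0 := by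
  have := proj_eq_zero (K := K) (A := A) (x := Relations.adF K A (i, j))
    (by simp only [Relations.toSet, Set.mem_union, Set.mem_range_self, or_true])
  simpa [Relations.adF, map_ad_pow, f] using this

/-- A homomorphism out of the free Lie algebra that kills the Chevalley-Serre relations
descends to the Kac-Moody algebra. -/
def lift {M : Type*} [LieRing M] [LieAlgebra K M]
    (g : FreeLieAlgebra K (Generators B) →ₗ⁅K⁆ M)
    (hg : ∀ x ∈ Relations.toSet K A, g x = 0) : A.ToLieAlgebra K →ₗ⁅K⁆ M :=
  have hker : Relations.toIdeal K A ≤ g.ker :=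
    LieSubmodule.lieSpan_le.2 fun x hx => LieHom.mem_ker.2 (hg x hx)
  { (Submodule.liftQ (Relations.toIdeal K A).toSubmodule (g : _ →ₗ[K] M)
        (fun _ hx => LinearMap.mem_ker.2 (LieHom.mem_ker.1 (hker hx))) :
      FreeLieAlgebra K (Generators B) ⧸ (Relations.toIdeal K A).toSubmodule →ₗ[K] M) with
    map_lie' := by
      intro x y
      obtain ⟨x, rfl⟩ := Submodule.Quotient.mk_surjective _ x
      obtain ⟨y, rfl⟩ := Submodule.Quotient.mk_surjective _ y
      exact LieHom.map_lie g x y }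

theorem lift_proj {M : Type*} [LieRing M] [LieAlgebra K M]
    (g : FreeLieAlgebra K (Generators B) →ₗ⁅K⁆ M)
    (hg : ∀ x ∈ Relations.toSet K A, g x = 0) (x : FreeLieAlgebra K (Generators B)) :
    lift g hg (proj K A x) = g x := rfl

end Lift

/-- `A` is a (not necessarily indecomposable) Cartan matrix of finite type with symmetrizer `d`:
`d i > 0`, and `(d i * A i j)` is symmetric and positive definite. Up to an overall factor on each
component, `d i` is half the squared length of the simple root `α_i`. -/
structure IsFiniteType {B : Type*} [Fintype B] (A : Matrix B B ℤ) (d : B → ℚ) : Prop where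
  diag : ∀ i, A i i = 2
  offDiag : ∀ i j, i ≠ j → A i j ≤ 0
  pos : ∀ i, 0 < d i
  symm : ∀ i j, d i * A i j = d j * A j i
  posDef : ∀ v : B → ℚ, v ≠ 0 → 0 < ∑ i, ∑ j, d i * A i j * v i * v j

section Extension

variable {B : Type*} [DecidableEq B]

/-- The Cartan matrix obtained from `A` by attaching to the node `b` a chain of `m` nodes
`0 — 1 — ⋯ — (m-1) — b` by single lines. -/
def extend (A : Matrix B B ℤ) (b : B) (m : ℕ) : Matrix (Fin m ⊕ B) (Fin m ⊕ B) ℤ :=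
  Matrix.of fun
    | .inl i, .inl j =>
        if i = j then 2 else if i.val + 1 = j.val ∨ j.val + 1 = i.val then -1 else 0
    | .inl i, .inr j => if i.val + 1 = m ∧ j = b then -1 else 0
    | .inr i, .inl j => if j.val + 1 = m ∧ i = b then -1 else 0
    | .inr i, .inr j => A i j

variable (K : Type*) [Field K]

/-- The homomorphism from the Kac-Moody algebra of `A` to that of the extended matrix which sends
the generators to the generators with the same name. -/
def incl (A : Matrix B B ℤ) (b : B) (m : ℕ) :
    A.ToLieAlgebra K →ₗ⁅K⁆ (extend A b m).ToLieAlgebra K :=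
  lift (FreeLieAlgebra.lift K fun
      | .H i => h K (extend A b m) (.inr i)
      | .E i => e K (extend A b m) (.inr i)
      | .F i => f K (extend A b m) (.inr i)) (by
    have hA : ∀ i j, extend A b m (.inr i) (.inr j) = A i j := fun _ _ => rfl
    rintro x (((((⟨⟨i, j⟩, rfl⟩ | ⟨⟨i, j⟩, rfl⟩) | ⟨⟨i, j⟩, rfl⟩) | ⟨⟨i, j⟩, rfl⟩) |
      ⟨⟨i, j⟩, rfl⟩) | ⟨⟨i, j⟩, rfl⟩)
    · simp [Relations.HH, h_lie_h]
    · by_cases hij : i = j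
      · subst hij; simp [Relations.EF, e_lie_f_same]
      · simp [Relations.EF, hij, e_lie_f_ne]
    · simp [Relations.HE, h_lie_e, hA]
    · simp [Relations.HF, h_lie_f, hA]
    · simpa [Relations.adE, map_ad_pow, hA] using
        serre_e (K := K) (A := extend A b m) (.inr i) (.inr j)
    · simpa [Relations.adF, map_ad_pow, hA] using
        serre_f (K := K) (A := extend A b m) (.inr i) (.inr j))

@[simp] theorem incl_e (A : Matrix B B ℤ) (b : B) (m : ℕ) (i : B) :
    incl K A b m (e K A i) = e K (extend A b m) (.inr i) := by
  simp [incl, e, lift_proj]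

@[simp] theorem incl_f (A : Matrix B B ℤ) (b : B) (m : ℕ) (i : B) :
    incl K A b m (f K A i) = f K (extend A b m) (.inr i) := by
  simp [incl, f, lift_proj]

@[simp] theorem incl_h (A : Matrix B B ℤ) (b : B) (m : ℕ) (i : B) :
    incl K A b m (h K A i) = h K (extend A b m) (.inr i) := by
  simp [incl, h, lift_proj]

end Extension

section Grading

variable (K : Type*) [Field K] {B : Type*} [DecidableEq B] (A : Matrix B B ℤ)

/-- Bracket monomials in the generators, with their degree in the root lattice; the element
`μ : B → ℤ` of the root lattice stands for `∑ i, μ i • α_i`. -/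
inductive IsMonomial : (B → ℤ) → A.ToLieAlgebra K → Prop
  | e (i : B) : IsMonomial (Pi.single i 1) (e K A i)
  | f (i : B) : IsMonomial (-Pi.single i 1) (f K A i)
  | h (i : B) : IsMonomial 0 (h K A i)
  | lie {μ ν : B → ℤ} {x y : A.ToLieAlgebra K} :
      IsMonomial μ x → IsMonomial ν y → IsMonomial (μ + ν) ⁅x, y⁆

/-- The root space of `μ ≠ 0` (it is zero if `μ` is not a root), and the span of the `h i`
for `μ = 0`. -/
def rootSpace (μ : B → ℤ) : Submodule K (A.ToLieAlgebra K) :=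
  Submodule.span K {x | IsMonomial K A μ x}

/-- The subspace of degree `k` in the grading generated by the node `b`: the sum of the root
spaces of those `μ` that have the coefficient `-k` for `α_b`. -/
def grade (b : B) (k : ℤ) : Submodule K (A.ToLieAlgebra K) :=
  ⨆ (μ : B → ℤ) (_ : μ b = -k), rootSpace K A μ

variable {K A}

theorem lie_mem_rootSpace {μ ν : B → ℤ} {x y : A.ToLieAlgebra K}
    (hx : x ∈ rootSpace K A μ) (hy : y ∈ rootSpace K A ν) : ⁅x, y⁆ ∈ rootSpace K A (μ + ν) := by
  induction hx using Submodule.span_induction with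
  | mem x hx =>
    induction hy using Submodule.span_induction with
    | mem y hy => exact Submodule.subset_span (IsMonomial.lie hx hy)
    | zero => simp
    | add y z _ _ hy hz => rw [lie_add]; exact add_mem hy hz
    | smul c y _ hy => rw [lie_smul]; exact Submodule.smul_mem _ c hy
  | zero => simp
  | add x z _ _ hx hz => rw [add_lie]; exact add_mem hx hz
  | smul c x _ hx => rw [smul_lie]; exact Submodule.smul_mem _ c hx

theorem lie_mem_grade {b : B} {k l : ℤ} {x y : A.ToLieAlgebra K}
    (hx : x ∈ grade K A b k) (hy : y ∈ grade K A b l) : ⁅x, y⁆ ∈ grade K A b (k + l) := by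
  have key : ∀ μ : B → ℤ, μ b = -k → ∀ x ∈ rootSpace K A μ,
      ⁅x, y⁆ ∈ grade K A b (k + l) := by
    intro μ hμ x hx
    have : grade K A b l ≤
        (grade K A b (k + l)).comap (LieAlgebra.ad K (A.ToLieAlgebra K) x) := by
      refine iSup₂_le fun ν hν z hz => ?_
      have hmem := lie_mem_rootSpace hx hz
      exact (le_iSup₂_of_le (μ + ν) (by simp [hμ, hν]; ring) le_rfl :
        rootSpace K A (μ + ν) ≤ grade K A b (k + l)) hmem
    exact this hy
  have : grade K A b k ≤ (grade K A b (k + l)).comap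
      (LieAlgebra.ad K (A.ToLieAlgebra K) y) := by
    refine iSup₂_le fun μ hμ z hz => ?_
    have hmem := key μ hμ z hz
    rw [← lie_skew] at hmem
    exact (Submodule.neg_mem_iff (grade K A b (k + l))).1 hmem
  have hmem : ⁅y, x⁆ ∈ grade K A b (k + l) := this hx
  rw [← lie_skew]
  exact neg_mem hmem

end Grading

section Involution

/-- A graded involution of the Kac-Moody algebra of `A`, for the grading generated by the
node `b`. -/
structure GradedInvolution (K : Type*) [Field K] {B : Type*} [DecidableEq B]
    (A : Matrix B B ℤ) (b : B) where
  toHom : A.ToLieAlgebra K →ₗ⁅K⁆ A.ToLieAlgebra K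
  involutive : ∀ x, toHom (toHom x) = x
  graded : ∀ k, ∀ x ∈ grade K A b k, toHom x ∈ grade K A b (-k)

variable {K : Type*} [Field K] {B : Type*} [DecidableEq B] {A : Matrix B B ℤ} {b : B}

/-- The restriction of a graded involution to a map from degree `1` to degree `-1`. -/
def GradedInvolution.oneToNegOne (τ : GradedInvolution K A b) (y : grade K A b 1) :
    grade K A b (-1) :=
  ⟨τ.toHom y, τ.graded 1 y y.2⟩

/-- The triple product `(xyz) = [[x, τ(y)], z]` on the subspace of degree `-1`. -/
def GradedInvolution.triple (τ : GradedInvolution K A b) (x y z : grade K A b (-1)) :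
    grade K A b (-1) :=
  ⟨⁅⁅(x : A.ToLieAlgebra K), τ.toHom y⁆, (z : A.ToLieAlgebra K)⁆, by
    simpa using lie_mem_grade (lie_mem_grade x.2 (τ.graded (-1) y y.2)) z.2⟩

/-- The element of the Cartan subalgebra that corresponds to `μ` under the invariant form for
which `(e_b | f_b) = 1`. If all roots in the component of `b` have the same length and `μ` is one
of them, this is the coroot of `μ`. -/
def dualElement (K : Type*) [Field K] {B : Type*} [DecidableEq B] [Fintype B]
    (A : Matrix B B ℤ) (d : B → ℚ) (b : B) (μ : B → ℤ) : A.ToLieAlgebra K :=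
  ∑ i, (((μ i : ℚ) * (d i / d b) : ℚ) : K) • h K A i

/-- `β` is the bilinear form on the subspace of degree `-1` associated to `τ`:
`(e_μ, τ(f_ν)) = δ_{μν}` for root vectors `e_μ` of the root `μ` in degree `-1` and `f_ν` of the
root `-ν` in degree `1`, normalized by `⁅e_μ, f_μ⁆ = dualElement μ` (that is, `(e_μ | f_μ) = 1`
for the invariant form with `(e_b | f_b) = 1`). For root vectors `x`, `y` of opposite roots that
are not normalized, `⁅x, y⁆` is a multiple of `dualElement μ`, and `(x, τ(y))` is the factor. -/
def IsAssociatedForm [Fintype B] (d : B → ℚ) (τ : GradedInvolution K A b)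
    (β : LinearMap.BilinForm K (grade K A b (-1))) : Prop :=
  ∀ (μ ν : B → ℤ) (x : grade K A b (-1)) (y : grade K A b 1),
    (x : A.ToLieAlgebra K) ∈ rootSpace K A μ → (y : A.ToLieAlgebra K) ∈ rootSpace K A (-ν) →
      (μ = ν → ⁅(x : A.ToLieAlgebra K), (y : A.ToLieAlgebra K)⁆ =
        β x (τ.oneToNegOne y) • dualElement K A d b μ) ∧
      (μ ≠ ν → β x (τ.oneToNegOne y) = 0)

/-- `σ` is an extension of `τ` from the Kac-Moody algebra of `A` to the one of the extended matrix
with `σ(e_i) = -f_i` for the simple root vectors `e_i` of the attached nodes. -/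
def IsExtension {m : ℕ} (τ : GradedInvolution K A b)
    (σ : GradedInvolution K (extend A b m) (.inr b)) : Prop :=
  (∀ x, σ.toHom (incl K A b m x) = incl K A b m (τ.toHom x)) ∧
  ∀ i : Fin m, σ.toHom (e K (extend A b m) (.inl i)) = -f K (extend A b m) (.inl i)

/-- The triple product on `n` copies of the subspace of degree `-1`. With `x^a = Pi.single a x`,
it is the trilinear one such that
`(x^a y^c z^g) = δ^{ac} [[x, τ(y)], z]^g - δ^{ac} (x, y) z^g + δ^{cg} (x, y) z^a`. -/
def powTriple {n : ℕ} (τ : GradedInvolution K A b)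
    (β : LinearMap.BilinForm K (grade K A b (-1)))
    (u v w : Fin n → grade K A b (-1)) : Fin n → grade K A b (-1) :=
  ∑ a : Fin n, ∑ c : Fin n, ∑ g : Fin n,
    ((if a = c then Pi.single g (τ.triple (u a) (v c) (w g)) else 0)
      - (if a = c then Pi.single g (β (u a) (v c) • w g) else 0)
      + (if c = g then Pi.single a (β (u a) (v c) • w g) else 0))

end Involution

end

end KacMoody

/-! Let V be the part of 𝔥 in degree -1. The attached nodes generate a copy of 𝔰𝔩_n in 𝔤, and the
degree -1 part of 𝔤 is V ⊗ K^n. Concretely, `copy 0` is the inclusion of V, and `copy (a + 1)` is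
obtained from `copy a` by bracketing with the next simple root vector of the chain, starting next to
the black node. Each such vector moves one copy to the next and kills the others
(`chainE_lie_copy`), and the corresponding `f` moves it back (`chainF_lie_copy`).

The degree 0 part of 𝔥 acts by scalars on the vector `f` of the attached node adjacent to b, hence
by a character χ with χ(h_b) = 1 that vanishes on brackets. On the vector `e` of that node it acts
by -χ. So u of degree 0 acts on every copy but the zeroth by [u, ·] - χ(u). From this, induction
along the chain in the first and the second argument yields `IsCharacter.lie_lie_copy`, which is the
asserted trilinear formula with χ([x, y]) in place of the form.

It remains to see that χ([x, τ(z)]) is the associated form. For different roots, the bracket of root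
vectors has nonzero weight in degree 0, so it is a sum of brackets and χ kills it. For opposite
roots, the bracket is a multiple of `dualElement`, on which χ is 1. This proportionality needs an
invariant form on 𝔥. It is the trace form of the 𝔥-submodule generated in the extended algebra by
the vector `f` of the adjacent node, a highest weight vector of fundamental weight. The module is
finite-dimensional because its weights are no longer than the highest one and the root form is
positive definite.

The extension of τ is prescribed on generators. The delicate Chevalley-Serre relations are those
between the images of h_b, e_b and the adjacent node (`GradedInvolution.lie_endF`): with respect to
the 𝔰𝔩₂-triple τ(e_b), τ(h_b), τ(f_b) the vector `f` is a lowest weight vector on which τ(e_b) is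
nilpotent, so its weight is -k with k natural, and τ² = 1 forces k² = 1.

Two facts on nonvanishing are needed, since the algebras are given by generators and relations. The
coroots are linearly independent because highest weight modules of every weight exist; these are
built on functions on words. The map 𝔥 → 𝔤 is injective on V because a root vector of least height
in the kernel would be a lowest weight vector for every simple 𝔰𝔩₂, against positive definiteness.
-/

namespace KacMoody

noncomputable section

open CartanMatrix LieModule

/-! ### Representations of 𝔰𝔩₂ -/

section SlTwo

variable {K L M : Type*} [Field K] [LieRing L] [LieAlgebra K L]
  [AddCommGroup M] [Module K M] [LieRingModule L M] [LieModule K L M]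

theorem lie_h_pow {x y : L} {k : K} (hxy : ⁅x, y⁆ = k • y) {v : M} {a : K} (hv : ⁅x, v⁆ = a • v)
    (n : ℕ) : ⁅x, (toEnd K L M y ^ n) v⁆ = (a + n * k) • (toEnd K L M y ^ n) v := by
  induction n with
  | zero => simpa using hv
  | succ n ih =>
    rw [pow_succ', Module.End.mul_apply, toEnd_apply_apply, leibniz_lie, hxy, ih, smul_lie,
      lie_smul, ← add_smul]
    congr 1
    push_cast
    ring

/-- All 𝔰𝔩₂ arguments below are read off from the zeros of the coefficient (n + 1)(a + n). -/
theorem lie_pow_succ {h e f : L} (hef : ⁅e, f⁆ = h) (hhe : ⁅h, e⁆ = (2 : K) • e) {v : M} {a : K}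
    (hv : ⁅h, v⁆ = a • v) (n : ℕ) :
    ⁅f, (toEnd K L M e ^ (n + 1)) v⁆ =
      (toEnd K L M e ^ (n + 1)) ⁅f, v⁆ - ((n + 1) * (a + n)) • (toEnd K L M e ^ n) v := by
  have hfe : ∀ u : M, ⁅f, ⁅e, u⁆⁆ = ⁅e, ⁅f, u⁆⁆ - ⁅h, u⁆ := by
    intro u
    rw [← hef, lie_lie]
    abel
  induction n with
  | zero => simp [hfe, hv]
  | succ n ih =>
    rw [pow_succ', Module.End.mul_apply, toEnd_apply_apply, hfe, ih, lie_h_pow hhe hv, lie_sub,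
      lie_smul, ← toEnd_apply_apply K L M e, ← toEnd_apply_apply K L M e, ← Module.End.mul_apply,
      ← Module.End.mul_apply, ← pow_succ', ← pow_succ', sub_sub, ← add_smul]
    congr 2
    push_cast
    ring

variable [CharZero K]

/-- A vector of weight `-k` on which `f` is nilpotent is not killed by `e ^ k`. -/
theorem pow_ne_zero_of_weight {h e f : L} (hef : ⁅e, f⁆ = h) (hhe : ⁅h, e⁆ = (2 : K) • e)
    (hhf : ⁅h, f⁆ = (-2 : K) • f) (N : ℕ) :
    ∀ (k : ℕ) (v : M), ⁅h, v⁆ = (-(k : K)) • v → (toEnd K L M f ^ N) v = 0 → v ≠ 0 →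
      (toEnd K L M e ^ k) v ≠ 0 := by
  -- For a lowest weight vector of weight -k the coefficient is (n + 1)(n - k), which is nonzero for
  -- n < k in characteristic 0.
  have base : ∀ (k : ℕ) (v : M), ⁅h, v⁆ = (-(k : K)) • v → ⁅f, v⁆ = 0 → v ≠ 0 →
      ∀ n ≤ k, (toEnd K L M e ^ n) v ≠ 0 := by
    intro k v hv hf h0 n
    induction n with
    | zero => simpa using h0
    | succ n ih =>
      intro hn h1
      have := lie_pow_succ hef hhe hv n
      rw [h1, hf, lie_zero, map_zero, zero_sub, eq_comm, neg_eq_zero, smul_eq_zero] at this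
      rcases this with this | this
      · rw [mul_eq_zero] at this
        rcases this with this | this
        · exact Nat.cast_add_one_ne_zero n this
        · have h2 : (n : K) = k := by linear_combination this
          have := Nat.cast_injective h2
          omega
      · exact ih (by omega) this
  induction N with
  | zero => intro k v _ h1 h0; simp at h1; exact absurd h1 h0
  | succ N ih =>
    intro k v hv hf h0 hk
    by_cases hfv : ⁅f, v⁆ = 0
    · exact base k v hv hfv h0 k le_rfl hk
    -- The vector [f, v] has weight -(k + 2) and is killed by a smaller power of f. If e^k killed v,
    -- the commutation formula would make e^(k+2) kill [f, v].
    · refine ih (k + 2) ⁅f, v⁆ ?_ ?_ hfv ?_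
      · rw [leibniz_lie, hhf, hv, smul_lie, lie_smul, ← add_smul]
        congr 1
        push_cast
        ring
      · rw [pow_succ, Module.End.mul_apply] at hf
        exact hf
      · have := lie_pow_succ hef hhe hv (k + 1)
        have h1 : (toEnd K L M e ^ (k + 1)) v = 0 := by
          rw [pow_succ', Module.End.mul_apply, hk, map_zero]
        have h2 : (toEnd K L M e ^ (k + 1 + 1)) v = 0 := by
          rw [pow_succ', Module.End.mul_apply, h1, map_zero]
        rw [h1, h2, lie_zero, smul_zero, sub_zero] at this
        exact this.symm

/-- The weight of a lowest weight vector on which `e` is nilpotent. -/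
theorem exists_weight_eq {h e f : L} (hef : ⁅e, f⁆ = h) (hhe : ⁅h, e⁆ = (2 : K) • e)
    {v : M} {a : K} (hv : ⁅h, v⁆ = a • v) (hf : ⁅f, v⁆ = 0) (h0 : v ≠ 0) {N : ℕ}
    (hN : (toEnd K L M e ^ N) v = 0) :
    ∃ k : ℕ, a = -(k : K) ∧ (toEnd K L M e ^ (k + 1)) v = 0 := by
  -- Take n with e^n v ≠ 0 = e^(n+1) v; then the coefficient (n + 1)(a + n) must vanish.
  obtain ⟨n, hn₁, hn₂⟩ := Nat.exists_not_and_succ_of_not_zero_of_exists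
    (p := fun n => (toEnd K L M e ^ n) v = 0) (by simpa using h0) ⟨N, hN⟩
  refine ⟨n, ?_, hn₂⟩
  have := lie_pow_succ hef hhe hv n
  rw [hn₂, hf, lie_zero, map_zero, zero_sub, eq_comm, neg_eq_zero, smul_eq_zero,
    or_iff_left hn₁, mul_eq_zero, or_iff_right (Nat.cast_add_one_ne_zero n)] at this
  linear_combination this

end SlTwo

/-! ### Chevalley-Serre families and the Chevalley involution -/

section Chevalley

variable {K : Type*} [Field K] {B : Type*} [DecidableEq B]

/-- A family of elements of a Lie algebra which satisfies the Chevalley relations of `A`. -/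
structure IsChevalley (A : Matrix B B ℤ) {L : Type*} [LieRing L] (H E F : B → L) : Prop where
  hh : ∀ i j, ⁅H i, H j⁆ = 0
  ef_same : ∀ i, ⁅E i, F i⁆ = H i
  ef_ne : ∀ i j, i ≠ j → ⁅E i, F j⁆ = 0
  he : ∀ i j, ⁅H i, E j⁆ = A i j • E j
  hf : ∀ i j, ⁅H i, F j⁆ = -(A i j • F j)

variable {A : Matrix B B ℤ} {L : Type*} [LieRing L] [LieAlgebra K L] {H E F : B → L}

omit [DecidableEq B] in
theorem IsChevalley.symm (hc : IsChevalley A H E F) : IsChevalley A (fun i => -H i) F E where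
  hh i j := by simp [hc.hh]
  ef_same i := by rw [← hc.ef_same i, lie_skew]
  ef_ne i j hij := by rw [← lie_skew, hc.ef_ne j i hij.symm, neg_zero]
  he i j := by simp [hc.hf]
  hf i j := by simp [hc.he]

/-- The Serre relations for the family `E`. -/
def SerreRel (K : Type*) [Field K] [LieAlgebra K L] (A : Matrix B B ℤ) (E : B → L) : Prop :=
  ∀ i j, i ≠ j → (LieAlgebra.ad K L (E i) ^ (-A i j).toNat) ⁅E i, E j⁆ = 0

/-- The conditions on a generalized Cartan matrix. -/
structure IsGCM (A : Matrix B B ℤ) : Prop where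
  diag : ∀ i, A i i = 2
  offDiag : ∀ i j, i ≠ j → A i j ≤ 0
  zero : ∀ i j, A i j = 0 → A j i = 0

theorem ad_pow_lie_eq (x y : L) (n : ℕ) :
    (LieAlgebra.ad K L x ^ n) ⁅x, y⁆ = (toEnd K L L x ^ (n + 1)) y := by
  rw [pow_succ]
  rfl

theorem lie_pow_of_lie_eq_zero {x y z : L} (hxz : ⁅z, x⁆ = 0) (n : ℕ) :
    ⁅z, (toEnd K L L x ^ n) y⁆ = (toEnd K L L x ^ n) ⁅z, y⁆ := by
  induction n with
  | zero => simp
  | succ n ih =>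
    rw [pow_succ', Module.End.mul_apply, toEnd_apply_apply, leibniz_lie, hxz, zero_lie, ih]
    simp

/-- For k = i the coefficient (N + 1)(A i j + N) vanishes at N = -A i j. For k = j the bracket of F
j and E j is -H j, and two brackets with E i kill it; when N = 0 there is only one, but then A j i =
0 too. Other F k commute with both letters. -/
theorem IsChevalley.lie_serre (hc : IsChevalley A H E F) (hA : IsGCM A) {i j : B} (hij : i ≠ j)
    (k : B) : ⁅F k, (LieAlgebra.ad K L (E i) ^ (-A i j).toNat) ⁅E i, E j⁆⁆ = 0 := by
  have hN : ((-A i j).toNat : ℤ) = -A i j := Int.toNat_of_nonneg (by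
    have := hA.offDiag i j hij
    omega)
  rw [ad_pow_lie_eq]
  set N := (-A i j).toNat with hNdef
  have hfe : ∀ k l, k ≠ l → ⁅F k, E l⁆ = 0 := fun k l hkl => by
    rw [← lie_skew, hc.ef_ne l k hkl.symm, neg_zero]
  by_cases hki : k = i
  · subst hki
    have hA2 : ((A k k : ℤ) : K) = 2 := by rw [hA.diag]; norm_num
    rw [lie_pow_succ (K := K) (a := ((A k j : ℤ) : K)) (hc.ef_same k)
      (by rw [hc.he, ← Int.cast_smul_eq_zsmul K, hA2])
      (by rw [hc.he, ← Int.cast_smul_eq_zsmul K]), hfe k j hij, map_zero]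
    have : ((N : ℤ) : K) = ((-A k j : ℤ) : K) := by rw [hN]
    push_cast at this
    rw [this]
    simp
  · rw [lie_pow_of_lie_eq_zero (hfe k i hki)]
    by_cases hkj : k = j
    · subst hkj
      rw [← lie_skew, hc.ef_same, pow_succ, Module.End.mul_apply, toEnd_apply_apply, lie_neg,
        lie_skew, hc.he]
      rcases Nat.eq_zero_or_pos N with h0 | h0
      · have : A i k = 0 := by omega
        rw [hA.zero _ _ this]
        simp
      · obtain ⟨m, hm⟩ := Nat.exists_eq_succ_of_ne_zero h0.ne'
        rw [hm, Nat.succ_eq_add_one, pow_succ, Module.End.mul_apply, toEnd_apply_apply,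
          lie_smul, lie_self, smul_zero, map_zero]
    · rw [hfe k j hkj, map_zero]

/-- The homomorphism given by a family which satisfies the Chevalley-Serre relations. -/
def liftChevalley (hc : IsChevalley A H E F) (hE : SerreRel K A E)
    (hF : SerreRel K A F) : A.ToLieAlgebra K →ₗ⁅K⁆ L :=
  lift (FreeLieAlgebra.lift K fun
      | .H i => H i
      | .E i => E i
      | .F i => F i) (by
    rintro x (((((⟨⟨i, j⟩, rfl⟩ | ⟨⟨i, j⟩, rfl⟩) | ⟨⟨i, j⟩, rfl⟩) | ⟨⟨i, j⟩, rfl⟩) |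
      ⟨⟨i, j⟩, rfl⟩) | ⟨⟨i, j⟩, rfl⟩)
    · simp [Relations.HH, hc.hh]
    · by_cases hij : i = j
      · subst hij; simp [Relations.EF, hc.ef_same]
      · simp [Relations.EF, hij, hc.ef_ne]
    · simp [Relations.HE, hc.he]
    · simp [Relations.HF, hc.hf]
    · by_cases hij : i = j
      · subst hij; simp [Relations.adE]
      · simpa [Relations.adE, map_ad_pow] using hE i j hij
    · by_cases hij : i = j
      · subst hij; simp [Relations.adF]
      · simpa [Relations.adF, map_ad_pow] using hF i j hij)

section

variable (hc : IsChevalley A H E F) (hE : SerreRel K A E) (hF : SerreRel K A F)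

@[simp] theorem liftChevalley_h (i : B) : liftChevalley hc hE hF (h K A i) = H i := by
  simp [liftChevalley, h, lift_proj]

@[simp] theorem liftChevalley_e (i : B) : liftChevalley hc hE hF (e K A i) = E i := by
  simp [liftChevalley, e, lift_proj]

@[simp] theorem liftChevalley_f (i : B) : liftChevalley hc hE hF (f K A i) = F i := by
  simp [liftChevalley, f, lift_proj]

end

variable (K A) in
theorem isChevalley : IsChevalley A (h K A) (e K A) (f K A) where
  hh := h_lie_h
  ef_same := e_lie_f_same
  ef_ne _ _ := e_lie_f_ne
  he := h_lie_e
  hf := h_lie_f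

variable (K A) in
theorem proj_surjective : Function.Surjective (proj K A) :=
  Submodule.Quotient.mk_surjective _

theorem hom_ext {g₁ g₂ : A.ToLieAlgebra K →ₗ⁅K⁆ L} (he : ∀ i, g₁ (e K A i) = g₂ (e K A i))
    (hf : ∀ i, g₁ (f K A i) = g₂ (f K A i)) : g₁ = g₂ := by
  have : g₁.comp (proj K A) = g₂.comp (proj K A) := by
    apply FreeLieAlgebra.hom_ext
    rintro (i | i | i)
    · change g₁ (h K A i) = g₂ (h K A i)
      rw [← e_lie_f_same, LieHom.map_lie, LieHom.map_lie, he, hf]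
    · exact he i
    · exact hf i
  ext x
  obtain ⟨x, rfl⟩ := proj_surjective K A x
  exact LieHom.congr_fun this x

theorem lieSubalgebra_eq_top {S : LieSubalgebra K (A.ToLieAlgebra K)} (he : ∀ i, e K A i ∈ S)
    (hf : ∀ i, f K A i ∈ S) (x : A.ToLieAlgebra K) : x ∈ S := by
  let g : FreeLieAlgebra K (Generators B) →ₗ⁅K⁆ S := FreeLieAlgebra.lift K fun
    | .H i => ⟨h K A i, by rw [← e_lie_f_same]; exact S.lie_mem (he i) (hf i)⟩
    | .E i => ⟨e K A i, he i⟩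
    | .F i => ⟨f K A i, hf i⟩
  have : S.incl.comp g = proj K A := by
    apply FreeLieAlgebra.hom_ext
    rintro (i | i | i) <;> simp [g, h, e, f]
  obtain ⟨x, rfl⟩ := proj_surjective K A x
  rw [← this]
  exact (g x).2

omit [DecidableEq B] in
theorem SerreRel.neg (hE : SerreRel K A E) : SerreRel K A fun i => -E i := by
  intro i j hij
  have h1 : ∀ n : ℕ, ∀ y : L, (LieAlgebra.ad K L (-E i) ^ n) y =
      (-1 : K) ^ n • (LieAlgebra.ad K L (E i) ^ n) y := by
    intro n y
    induction n with
    | zero => simp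
    | succ n ih =>
      rw [pow_succ', Module.End.mul_apply, ih, pow_succ' (LieAlgebra.ad K L (E i)),
        Module.End.mul_apply, map_neg, LinearMap.neg_apply, map_smul, pow_succ', neg_one_mul,
        neg_smul]
  rw [h1, neg_lie, lie_neg, neg_neg, hE i j hij, smul_zero]

variable (K A) in
theorem serreRel_e : SerreRel K A (e K A) := fun i j _ => serre_e i j

variable (K A) in
theorem serreRel_f : SerreRel K A (f K A) := fun i j _ => serre_f i j

variable (K A) in
/-- The Chevalley involution. -/
def chevalleyInvolution :
    A.ToLieAlgebra K →ₗ⁅K⁆ A.ToLieAlgebra K :=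
  liftChevalley (H := fun i => -h K A i) (E := fun i => -f K A i) (F := fun i => -e K A i)
    { hh := fun i j => by simp [h_lie_h]
      ef_same := fun i => by rw [neg_lie, lie_neg, neg_neg, ← lie_skew, e_lie_f_same]
      ef_ne := fun i j hij => by rw [neg_lie, lie_neg, neg_neg, ← lie_skew, e_lie_f_ne hij.symm,
        neg_zero]
      he := fun i j => by simp [h_lie_f]
      hf := fun i j => by simp [h_lie_e] }
    (serreRel_f K A).neg (serreRel_e K A).neg

@[simp] theorem chevalleyInvolution_h (i : B) :
    chevalleyInvolution K A (h K A i) = -h K A i :=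
  liftChevalley_h _ _ _ i

@[simp] theorem chevalleyInvolution_e (i : B) :
    chevalleyInvolution K A (e K A i) = -f K A i :=
  liftChevalley_e _ _ _ i

@[simp] theorem chevalleyInvolution_f (i : B) :
    chevalleyInvolution K A (f K A i) = -e K A i :=
  liftChevalley_f _ _ _ i

@[simp] theorem chevalleyInvolution_apply_apply (x : A.ToLieAlgebra K) :
    chevalleyInvolution K A (chevalleyInvolution K A x) = x := by
  have : (chevalleyInvolution K A).comp (chevalleyInvolution K A) = LieHom.id :=
    hom_ext (by simp) (by simp)
  exact LieHom.congr_fun this x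

end Chevalley

/-! ### Highest weight modules on functions on words, and independence of the coroots -/

section WordModule

variable {K : Type*} [Field K] {B : Type*} [DecidableEq B]

attribute [local instance] LieRing.ofAssociativeRing

variable (K) in
/-- The shift operator on functions on words. -/
def wordE (i : B) : (List B → K) →ₗ[K] (List B → K) where
  toFun φ w := φ (i :: w)
  map_add' _ _ := rfl
  map_smul' _ _ := rfl

/-- The eigenvalue of the Cartan generator `h_i` at a word. -/
def wordWeight (A : Matrix B B ℤ) (l : B → K) (i : B) : List B → K
  | [] => l i
  | j :: w => wordWeight A l i w - A i j

/-- The diagonal operator on functions on words. -/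
def wordH (A : Matrix B B ℤ) (l : B → K) (i : B) : (List B → K) →ₗ[K] (List B → K) where
  toFun φ w := wordWeight A l i w * φ w
  map_add' _ _ := by ext; simp [mul_add]
  map_smul' _ _ := by ext; simp [mul_left_comm]

/-- The values of the operator `wordF`. -/
def wordFApply (A : Matrix B B ℤ) (l : B → K) (i : B) : List B → (List B → K) →ₗ[K] K
  | [] => 0
  | j :: w => wordFApply A l i w ∘ₗ wordE K j +
      if i = j then LinearMap.proj w ∘ₗ wordH A l i else 0

/-- The operator on functions on words with `[E j, F i] = δ_ij H i` which vanishes at the empty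
word. -/
def wordF (A : Matrix B B ℤ) (l : B → K) (i : B) : (List B → K) →ₗ[K] (List B → K) :=
  LinearMap.pi (wordFApply A l i)

variable (A : Matrix B B ℤ) (l : B → K)

omit [DecidableEq B] in
@[simp] theorem wordE_apply (i : B) (φ : List B → K) (w : List B) : wordE K i φ w = φ (i :: w) :=
  rfl

omit [DecidableEq B] in
@[simp] theorem wordH_apply (i : B) (φ : List B → K) (w : List B) :
    wordH A l i φ w = wordWeight A l i w * φ w := rfl

@[simp] theorem wordF_nil (i : B) (φ : List B → K) : wordF A l i φ [] = 0 := rfl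

@[simp] theorem wordF_cons (i j : B) (φ : List B → K) (w : List B) :
    wordF A l i φ (j :: w) = wordF A l i (wordE K j φ) w + if i = j then wordH A l i φ w else 0 := by
  by_cases h : i = j <;> simp [wordF, wordFApply, h]

/-- A function on words is determined by its value at the empty word and by its shifts. So `wordF`
is forced by its brackets with the shifts and by vanishing at the empty word, and its weight
relation is verified letter by letter. -/
theorem isChevalley_word : IsChevalley A (wordH A l) (wordE K) (wordF A l) where
  hh i j := by
    ext φ w
    simp [LieRing.of_associative_ring_bracket, mul_left_comm]
  ef_same i := by
    ext φ w
    simp [LieRing.of_associative_ring_bracket]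
  ef_ne i j hij := by
    ext φ w
    simp [LieRing.of_associative_ring_bracket, hij.symm]
  he i j := by
    ext φ w
    simp [LieRing.of_associative_ring_bracket, wordWeight]
    ring
  hf i j := by
    have hE : ∀ k φ, wordE K k (wordH A l i φ) =
        wordH A l i (wordE K k φ) - (A i k : K) • wordE K k φ := by
      intro k φ
      ext w
      simp [wordWeight]
      ring
    suffices ∀ w φ, wordH A l i (wordF A l j φ) w - wordF A l j (wordH A l i φ) w =
        -((A i j : K) * wordF A l j φ w) by
      refine LinearMap.ext fun φ => funext fun w => ?_
      simpa [LieRing.of_associative_ring_bracket] using this w φ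
    intro w
    induction w with
    | nil => simp
    | cons k w ih =>
      intro φ
      have := ih (wordE K k φ)
      simp only [wordH_apply, wordF_cons, wordWeight, hE, map_sub, map_smul, Pi.sub_apply,
        Pi.smul_apply, smul_eq_mul] at this ⊢
      by_cases hjk : j = k
      · subst hjk
        simp only [if_true]
        linear_combination this
      · simp only [hjk, if_false]
        linear_combination this

variable {A}

/-- The Serre element commutes with all shifts, and its values vanish at the empty word. Evaluation
at any word is evaluation at the empty word after shifting, so the element is zero. -/
theorem serreRel_wordF (hA : IsGCM A) : SerreRel K A (wordF A l) := by
  intro i j hij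
  set θ := (LieAlgebra.ad K (Module.End K (List B → K)) (wordF A l i) ^ (-A i j).toNat)
    ⁅wordF A l i, wordF A l j⁆ with hθ
  have hcomm : ∀ k, ⁅wordE K k, θ⁆ = 0 := (isChevalley_word A l).symm.lie_serre hA hij
  have hnil : ∀ φ, θ φ [] = 0 := by
    have : ∀ n φ, ((LieAlgebra.ad K (Module.End K (List B → K)) (wordF A l i) ^ n)
        ⁅wordF A l i, wordF A l j⁆) φ [] = 0 := by
      intro n
      induction n with
      | zero => simp [LieRing.of_associative_ring_bracket]
      | succ n ih =>
        intro φ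
        rw [pow_succ', Module.End.mul_apply, LieAlgebra.ad_apply,
          LieRing.of_associative_ring_bracket]
        simp [ih]
    exact this _
  suffices ∀ w φ, θ φ w = 0 from LinearMap.ext fun φ => funext fun w => this w φ
  intro w
  induction w with
  | nil => exact hnil
  | cons k w ih =>
    intro φ
    have := LinearMap.congr_fun (hcomm k) φ
    rw [LieRing.of_associative_ring_bracket] at this
    have := congrFun this w
    simpa [ih, sub_eq_zero] using this

/-- The delta function at the empty word. -/
def vacuum (K : Type*) [Field K] (B : Type*) [DecidableEq B] : List B → K := Pi.single [] 1

variable (A) in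
/-- The irreducible highest weight module: the span of the vectors which are obtained from the
vacuum by lowering. -/
def wordModule : Submodule K (List B → K) :=
  Submodule.span K (Set.range fun w : List B => w.foldr (fun i φ => wordF A l i φ) (vacuum K B))

theorem foldr_mem_wordModule (w : List B) :
    w.foldr (fun i φ => wordF A l i φ) (vacuum K B) ∈ wordModule A l :=
  Submodule.subset_span ⟨w, rfl⟩

theorem wordF_mem (i : B) {φ : List B → K} (hφ : φ ∈ wordModule A l) :
    wordF A l i φ ∈ wordModule A l := by
  have : wordModule A l ≤ (wordModule A l).comap (wordF A l i) :=
    Submodule.span_le.2 (by rintro _ ⟨w, rfl⟩; exact foldr_mem_wordModule l (i :: w))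
  exact this hφ

theorem wordH_vacuum (i : B) : wordH A l i (vacuum K B) = l i • vacuum K B := by
  ext w
  cases w <;> simp [vacuum, wordWeight]

theorem wordE_vacuum (i : B) : wordE K i (vacuum K B) = 0 := by
  ext w
  simp [vacuum]

theorem wordH_mem (i : B) {φ : List B → K} (hφ : φ ∈ wordModule A l) :
    wordH A l i φ ∈ wordModule A l := by
  have : wordModule A l ≤ (wordModule A l).comap (wordH A l i) := by
    refine Submodule.span_le.2 ?_
    rintro _ ⟨w, rfl⟩
    suffices ∃ c : K, wordH A l i (w.foldr (fun i φ => wordF A l i φ) (vacuum K B)) =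
        c • w.foldr (fun i φ => wordF A l i φ) (vacuum K B) by
      obtain ⟨c, hc⟩ := this
      change wordH A l i _ ∈ wordModule A l
      rw [hc]
      exact Submodule.smul_mem _ _ (foldr_mem_wordModule l w)
    induction w with
    | nil => exact ⟨l i, wordH_vacuum l i⟩
    | cons j w ih =>
      obtain ⟨c, hc⟩ := ih
      refine ⟨c - A i j, ?_⟩
      have := LinearMap.congr_fun ((isChevalley_word A l).hf i j)
        (w.foldr (fun i φ => wordF A l i φ) (vacuum K B))
      rw [LieRing.of_associative_ring_bracket] at this
      simp only [LinearMap.sub_apply, Module.End.mul_apply, hc, map_smul, LinearMap.neg_apply,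
        LinearMap.smul_apply, ← Int.cast_smul_eq_zsmul K] at this
      rw [List.foldr_cons, sub_smul, sub_eq_add_neg, ← this]
      abel
  exact this hφ

theorem wordE_mem (i : B) {φ : List B → K} (hφ : φ ∈ wordModule A l) :
    wordE K i φ ∈ wordModule A l := by
  have : wordModule A l ≤ (wordModule A l).comap (wordE K i) := by
    refine Submodule.span_le.2 ?_
    rintro _ ⟨w, rfl⟩
    change wordE K i (w.foldr (fun i φ => wordF A l i φ) (vacuum K B)) ∈ wordModule A l
    induction w with
    | nil =>
      rw [List.foldr_nil, wordE_vacuum]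
      exact zero_mem _
    | cons j w ih =>
      have h1 : ∀ φ, wordE K i (wordF A l j φ) =
          wordF A l j (wordE K i φ) + if j = i then wordH A l j φ else 0 := by
        intro φ
        ext w
        by_cases hji : j = i <;> simp [hji]
      rw [List.foldr_cons, h1]
      refine add_mem (wordF_mem l j ih) ?_
      split_ifs
      · exact wordH_mem l j (foldr_mem_wordModule l w)
      · exact zero_mem _
  exact this hφ

/-- The shifts satisfy no relations on all functions, whence the passage to the span of the lowered
vacuum: there the Serre element vanishes because it commutes with the lowering operators and kills
the vacuum. -/
theorem serre_wordE_apply (hA : IsGCM A) {i j : B} (hij : i ≠ j) {φ : List B → K}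
    (hφ : φ ∈ wordModule A l) :
    ((LieAlgebra.ad K (Module.End K (List B → K)) (wordE K i) ^ (-A i j).toNat)
      ⁅wordE K i, wordE K j⁆) φ = 0 := by
  set θ := (LieAlgebra.ad K (Module.End K (List B → K)) (wordE K i) ^ (-A i j).toNat)
    ⁅wordE K i, wordE K j⁆ with hθ
  have hcomm : ∀ k, ⁅wordF A l k, θ⁆ = 0 := (isChevalley_word A l).lie_serre hA hij
  have hvac : θ (vacuum K B) = 0 := by
    have : ∀ n, ((LieAlgebra.ad K (Module.End K (List B → K)) (wordE K i) ^ n)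
        ⁅wordE K i, wordE K j⁆) (vacuum K B) = 0 := by
      intro n
      induction n with
      | zero => simp [LieRing.of_associative_ring_bracket, wordE_vacuum]
      | succ n ih =>
        rw [pow_succ', Module.End.mul_apply, LieAlgebra.ad_apply,
          LieRing.of_associative_ring_bracket]
        simp [ih, wordE_vacuum]
    exact this _
  have : wordModule A l ≤ LinearMap.ker θ := by
    refine Submodule.span_le.2 ?_
    rintro _ ⟨w, rfl⟩
    change θ (w.foldr (fun i φ => wordF A l i φ) (vacuum K B)) = 0
    induction w with
    | nil => exact hvac
    | cons k w ih =>
      have := LinearMap.congr_fun (hcomm k) (w.foldr (fun i φ => wordF A l i φ) (vacuum K B))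
      rw [LieRing.of_associative_ring_bracket] at this
      simp only [LinearMap.sub_apply, Module.End.mul_apply, ih, map_zero, zero_sub,
        LinearMap.zero_apply, neg_eq_zero] at this
      exact this
  exact this hφ

theorem ad_pow_restrict {V : Type*} [AddCommGroup V] [Module K V] {p : Submodule K V}
    {S T : Module.End K V} {S' T' : Module.End K p} (hS : ∀ x, ((S' x : p) : V) = S x)
    (hT : ∀ x, ((T' x : p) : V) = T x) (n : ℕ) (x : p) :
    ((((LieAlgebra.ad K (Module.End K p) S' ^ n) T') x : p) : V) =
      ((LieAlgebra.ad K (Module.End K V) S ^ n) T) x := by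
  induction n generalizing x with
  | zero => exact hT x
  | succ n ih =>
    rw [pow_succ', Module.End.mul_apply, pow_succ', Module.End.mul_apply]
    simp [LieRing.of_associative_ring_bracket, ih, hS]

/-- The representation of the Kac-Moody algebra on the irreducible highest weight module. -/
def wordRep (hA : IsGCM A) (l : B → K) :
    A.ToLieAlgebra K →ₗ⁅K⁆ Module.End K (wordModule A l) :=
  liftChevalley (A := A) (H := fun i => (wordH A l i).restrict fun _ => wordH_mem l i)
    (E := fun i => (wordE K i).restrict fun _ => wordE_mem l i)
    (F := fun i => (wordF A l i).restrict fun _ => wordF_mem l i)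
    { hh := fun i j => LinearMap.ext fun x => Subtype.ext <| by
        simpa [LieRing.of_associative_ring_bracket] using
          LinearMap.congr_fun ((isChevalley_word A l).hh i j) (x : List B → K)
      ef_same := fun i => LinearMap.ext fun x => Subtype.ext <| by
        simpa [LieRing.of_associative_ring_bracket] using
          LinearMap.congr_fun ((isChevalley_word A l).ef_same i) (x : List B → K)
      ef_ne := fun i j hij => LinearMap.ext fun x => Subtype.ext <| by
        simpa [LieRing.of_associative_ring_bracket] using
          LinearMap.congr_fun ((isChevalley_word A l).ef_ne i j hij) (x : List B → K)
      he := fun i j => LinearMap.ext fun x => Subtype.ext <| by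
        simpa [LieRing.of_associative_ring_bracket] using
          LinearMap.congr_fun ((isChevalley_word A l).he i j) (x : List B → K)
      hf := fun i j => LinearMap.ext fun x => Subtype.ext <| by
        simpa [LieRing.of_associative_ring_bracket] using
          LinearMap.congr_fun ((isChevalley_word A l).hf i j) (x : List B → K) }
    (fun i j hij => LinearMap.ext fun x => Subtype.ext <| by
      rw [ad_pow_restrict (S := wordE K i) (T := ⁅wordE K i, wordE K j⁆) (fun _ => rfl)
        (fun _ => rfl), serre_wordE_apply l hA hij x.2]
      rfl)
    (fun i j hij => LinearMap.ext fun x => Subtype.ext <| by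
      rw [ad_pow_restrict (S := wordF A l i) (T := ⁅wordF A l i, wordF A l j⁆) (fun _ => rfl)
        (fun _ => rfl), serreRel_wordF l hA i j hij]
      rfl)

/-- In the module whose highest weight is the indicator of i, a combination of the coroots acts on
the vacuum by its i-th coefficient. -/
theorem h_linearIndependent [Fintype B] (hA : IsGCM A) {c : B → K}
    (hc : ∑ i, c i • h K A i = 0) (i : B) : c i = 0 := by
  let l : B → K := Pi.single i 1
  let v : wordModule A l := ⟨vacuum K B, foldr_mem_wordModule l []⟩
  have h1 : ∀ j, wordRep hA l (h K A j) v = l j • v := fun j => by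
    have h2 : wordRep hA l (h K A j) = (wordH A l j).restrict fun _ => wordH_mem l j :=
      liftChevalley_h _ _ _ j
    rw [h2]
    exact Subtype.ext (wordH_vacuum l j)
  have h2 : v ≠ 0 := fun h0 => by
    have := congrFun (congrArg Subtype.val h0) []
    simp [v, vacuum] at this
  have h3 := LinearMap.congr_fun (congrArg (wordRep hA l) hc) v
  rw [map_sum, LinearMap.sum_apply] at h3
  simp only [map_smul, LinearMap.smul_apply, h1, smul_smul, ← Finset.sum_smul, map_zero,
    LinearMap.zero_apply, smul_eq_zero, h2, or_false] at h3
  simpa [l, Pi.single_apply] using h3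

theorem h_ne_zero [Fintype B] (hA : IsGCM A) (i : B) : h K A i ≠ 0 := fun h0 => by
  have := h_linearIndependent (K := K) hA (c := Pi.single i 1) (by simp [Pi.single_apply, h0]) i
  simp at this

theorem e_ne_zero [Fintype B] (hA : IsGCM A) (i : B) : e K A i ≠ 0 := fun h0 => by
  apply h_ne_zero (K := K) hA i
  rw [← e_lie_f_same, h0, zero_lie]

theorem f_ne_zero [Fintype B] (hA : IsGCM A) (i : B) : f K A i ≠ 0 := fun h0 => by
  apply h_ne_zero (K := K) hA i
  rw [← e_lie_f_same, h0, lie_zero]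

end WordModule

/-! ### The triangular decomposition and spanning sets of the graded pieces -/

section Triangular

variable {K : Type*} [Field K] {B : Type*} [DecidableEq B]

/-- The right-nested bracket of the letters of a word. -/
def nested {L : Type*} [LieRing L] (x : B → L) : List B → L
  | [] => 0
  | [i] => x i
  | i :: j :: w => ⁅x i, nested x (j :: w)⁆

/-- The degree of a word in the root lattice. -/
def wt (w : List B) : B → ℤ := fun i => w.count i

@[simp] theorem wt_nil : wt ([] : List B) = 0 := rfl

theorem wt_cons (i : B) (w : List B) : wt (i :: w) = Pi.single i 1 + wt w := by
  ext j
  by_cases h : i = j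
  · subst h; simp [wt, add_comm]
  · simp [wt, h, Ne.symm h]

theorem wt_nonneg (w : List B) (i : B) : 0 ≤ wt w i := by simp [wt]

section

variable {L : Type*} [LieRing L] [LieAlgebra K L] {A : Matrix B B ℤ} {H E F : B → L}

omit [DecidableEq B] in
theorem nested_singleton (x : B → L) (i : B) : nested x [i] = x i := rfl

omit [DecidableEq B] in
theorem nested_cons (x : B → L) (i : B) {w : List B} (hw : w ≠ []) :
    nested x (i :: w) = ⁅x i, nested x w⁆ := by
  cases w with
  | nil => exact absurd rfl hw
  | cons j w => rfl

/-- The span of the nested brackets of degree `μ`, together with `C` in degree `0`. -/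
def wordSpan (C : Submodule K L) (x : B → L) (μ : B → ℤ) : Submodule K L :=
  Submodule.span K {y | ∃ w, w ≠ [] ∧ wt w = μ ∧ y = nested x w} ⊔
    Submodule.span K {y | μ = 0 ∧ y ∈ C}

theorem nested_mem_wordSpan (C : Submodule K L) (x : B → L) {w : List B} (hw : w ≠ []) :
    nested x w ∈ wordSpan C x (wt w) :=
  Submodule.mem_sup_left (Submodule.subset_span ⟨w, hw, rfl, rfl⟩)

theorem mem_wordSpan_zero {C : Submodule K L} (x : B → L) {y : L} (hy : y ∈ C) :
    y ∈ wordSpan C x 0 :=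
  Submodule.mem_sup_right (Submodule.subset_span ⟨rfl, hy⟩)

theorem wordSpan_le {C : Submodule K L} {x : B → L} {μ : B → ℤ} {N : Submodule K L}
    (h1 : ∀ w, w ≠ [] → wt w = μ → nested x w ∈ N) (h2 : μ = 0 → C ≤ N) :
    wordSpan C x μ ≤ N := by
  refine sup_le (Submodule.span_le.2 ?_) (Submodule.span_le.2 ?_)
  · rintro _ ⟨w, hw, hμ, rfl⟩
    exact h1 w hw hμ
  · rintro y ⟨hμ, hy⟩
    exact h2 hμ hy

variable {C : Submodule K L}

theorem lie_mem_wordSpan {x : B → L} (hC : ∀ c ∈ C, ∀ j, ∃ k : K, ⁅x j, c⁆ = k • x j) {μ : B → ℤ}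
    {y : L} (hy : y ∈ wordSpan C x μ) (j : B) : ⁅x j, y⁆ ∈ wordSpan C x (Pi.single j 1 + μ) := by
  have : wordSpan C x μ ≤
      (wordSpan C x (Pi.single j 1 + μ)).comap (LieAlgebra.ad K L (x j)) := by
    refine wordSpan_le (fun w hw hμ => ?_) (fun hμ c hc => ?_)
    · rw [Submodule.mem_comap, LieAlgebra.ad_apply, ← nested_cons x j hw, ← hμ, ← wt_cons]
      exact nested_mem_wordSpan C x (by simp)
    · obtain ⟨k, hk⟩ := hC c hc j
      rw [Submodule.mem_comap, LieAlgebra.ad_apply, hk, hμ, ← wt_nil, ← wt_cons]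
      exact Submodule.smul_mem _ _ (nested_mem_wordSpan C x (w := [j]) (by simp))
  exact this hy

omit [DecidableEq B] in
theorem IsChevalley.exists_lie_nested (hc : IsChevalley A H E F) (i : B) (w : List B) :
    ∃ k : K, ⁅H i, nested F w⁆ = k • nested F w := by
  induction w with
  | nil => exact ⟨0, by simp [nested]⟩
  | cons j w ih =>
    by_cases hw : w = []
    · subst hw
      exact ⟨-(A i j : K), by
        rw [nested_singleton, hc.hf, neg_smul, Int.cast_smul_eq_zsmul]⟩
    · obtain ⟨k, hk⟩ := ih
      refine ⟨-(A i j : K) + k, ?_⟩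
      rw [nested_cons F j hw, leibniz_lie, hc.hf, hk, ← Int.cast_smul_eq_zsmul K, lie_smul, neg_lie,
        smul_lie, add_smul, neg_smul]

theorem IsChevalley.lie_nested_mem (hc : IsChevalley A H E F) (hH : ∀ i, H i ∈ C)
    (hC : ∀ c ∈ C, ∀ j, ∃ k : K, ⁅F j, c⁆ = k • F j) (i : B) {w : List B} (hw : w ≠ []) :
    ⁅E i, nested F w⁆ ∈ wordSpan C F (wt w - Pi.single i 1) := by
  induction w with
  | nil => exact absurd rfl hw
  | cons j w ih =>
    by_cases hw' : w = []
    · subst hw'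
      rw [nested_singleton]
      by_cases hij : i = j
      · subst hij
        rw [hc.ef_same, wt_cons]
        simpa using mem_wordSpan_zero F (hH i)
      · rw [hc.ef_ne i j hij]
        exact zero_mem _
    · rw [nested_cons F j hw', leibniz_lie]
      refine add_mem ?_ ?_
      · by_cases hij : i = j
        · subst hij
          obtain ⟨k, hk⟩ := hc.exists_lie_nested (K := K) i w
          rw [hc.ef_same, hk, wt_cons, add_sub_cancel_left]
          exact Submodule.smul_mem _ _ (nested_mem_wordSpan C F hw')
        · rw [hc.ef_ne i j hij, zero_lie]
          exact zero_mem _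
      · rw [wt_cons, add_sub_assoc]
        exact lie_mem_wordSpan hC (ih hw') j

theorem IsChevalley.lie_mem_sup (hc : IsChevalley A H E F) (hH : ∀ i, H i ∈ C)
    (hCF : ∀ c ∈ C, ∀ j, ∃ k : K, ⁅F j, c⁆ = k • F j)
    (hCE : ∀ c ∈ C, ∀ j, ∃ k : K, ⁅E j, c⁆ = k • E j) (i : B) {μ : B → ℤ} {x : L}
    (hx : x ∈ wordSpan C E μ ⊔ wordSpan C F (-μ)) :
    ⁅E i, x⁆ ∈ wordSpan C E (Pi.single i 1 + μ) ⊔ wordSpan C F (-(Pi.single i 1 + μ)) := by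
  have : wordSpan C E μ ⊔ wordSpan C F (-μ) ≤
      (wordSpan C E (Pi.single i 1 + μ) ⊔ wordSpan C F (-(Pi.single i 1 + μ))).comap
        (LieAlgebra.ad K L (E i)) := by
    refine sup_le (fun y hy => Submodule.mem_sup_left (lie_mem_wordSpan hCE hy i)) ?_
    refine wordSpan_le (fun w hw hμ => ?_) (fun hμ c hc => ?_)
    · refine Submodule.mem_sup_right ?_
      have := hc.lie_nested_mem hH hCF i hw
      rwa [hμ, ← neg_add', add_comm] at this
    · refine Submodule.mem_sup_left (lie_mem_wordSpan hCE ?_ i)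
      rw [neg_eq_zero.1 hμ]
      exact mem_wordSpan_zero E hc
  exact this hx

end

variable {A : Matrix B B ℤ}

variable (K A) in
/-- The span of the generators `h i`. -/
def cartan : Submodule K (A.ToLieAlgebra K) := Submodule.span K (Set.range (h K A))

theorem h_mem_cartan (i : B) : h K A i ∈ cartan K A := Submodule.subset_span ⟨i, rfl⟩

theorem lie_e_of_mem_cartan {c : A.ToLieAlgebra K} (hc : c ∈ cartan K A) (j : B) :
    ∃ k : K, ⁅e K A j, c⁆ = k • e K A j := by
  induction hc using Submodule.span_induction with
  | mem x hx =>
    obtain ⟨i, rfl⟩ := hx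
    exact ⟨-(A i j : K), by
      rw [← lie_skew, h_lie_e, neg_smul, Int.cast_smul_eq_zsmul]⟩
  | zero => exact ⟨0, by simp⟩
  | add x y _ _ hx hy =>
    obtain ⟨k, hk⟩ := hx
    obtain ⟨l, hl⟩ := hy
    exact ⟨k + l, by rw [lie_add, hk, hl, add_smul]⟩
  | smul a x _ hx =>
    obtain ⟨k, hk⟩ := hx
    exact ⟨a * k, by rw [lie_smul, hk, mul_smul]⟩

theorem lie_f_of_mem_cartan {c : A.ToLieAlgebra K} (hc : c ∈ cartan K A) (j : B) :
    ∃ k : K, ⁅f K A j, c⁆ = k • f K A j := by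
  induction hc using Submodule.span_induction with
  | mem x hx =>
    obtain ⟨i, rfl⟩ := hx
    exact ⟨(A i j : K), by
      rw [← lie_skew, h_lie_f, neg_neg, Int.cast_smul_eq_zsmul]⟩
  | zero => exact ⟨0, by simp⟩
  | add x y _ _ hx hy =>
    obtain ⟨k, hk⟩ := hx
    obtain ⟨l, hl⟩ := hy
    exact ⟨k + l, by rw [lie_add, hk, hl, add_smul]⟩
  | smul a x _ hx =>
    obtain ⟨k, hk⟩ := hx
    exact ⟨a * k, by rw [lie_smul, hk, mul_smul]⟩

/-- The triangular decomposition. -/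
theorem rootSpace_le (μ : B → ℤ) :
    rootSpace K A μ ≤
      wordSpan (cartan K A) (e K A) μ ⊔ wordSpan (cartan K A) (f K A) (-μ) := by
  let T : (B → ℤ) → Submodule K (A.ToLieAlgebra K) := fun μ =>
    wordSpan (cartan K A) (e K A) μ ⊔ wordSpan (cartan K A) (f K A) (-μ)
  have hE : ∀ i μ x, x ∈ T μ → ⁅e K A i, x⁆ ∈ T (Pi.single i 1 + μ) := fun i μ x hx =>
    (isChevalley K A).lie_mem_sup h_mem_cartan (fun _ => lie_f_of_mem_cartan)
      (fun _ => lie_e_of_mem_cartan) i hx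
  have hF : ∀ i μ x, x ∈ T μ → ⁅f K A i, x⁆ ∈ T (-Pi.single i 1 + μ) := fun i μ x hx => by
    have := (isChevalley K A).symm.lie_mem_sup (C := cartan K A)
      (fun i => neg_mem (h_mem_cartan i)) (fun _ => lie_e_of_mem_cartan)
      (fun _ => lie_f_of_mem_cartan) i (μ := -μ) (x := x) (by
        rw [neg_neg, sup_comm]; exact hx)
    simp only [T]
    rw [sup_comm]
    simpa [add_comm] using this
  -- By the Jacobi identity, the stability of T under the generators passes to all monomials. A
  -- bracket then lies in T as soon as its second factor does.
  have key : ∀ μ x, IsMonomial K A μ x → ∀ ν y, y ∈ T ν → ⁅x, y⁆ ∈ T (μ + ν) := by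
    intro μ x hx
    induction hx with
    | e i => exact hE i
    | f i => exact hF i
    | h i =>
      intro ν y hy
      rw [← e_lie_f_same, lie_lie]
      refine sub_mem ?_ ?_
      · simpa using hE i _ _ (hF i _ _ hy)
      · simpa using hF i _ _ (hE i _ _ hy)
    | lie _ _ hx hy =>
      intro ξ z hz
      rw [lie_lie]
      refine sub_mem ?_ ?_
      · simpa [add_assoc] using hx _ _ (hy _ _ hz)
      · simpa [add_assoc, add_left_comm] using hy _ _ (hx _ _ hz)
  refine Submodule.span_le.2 fun x hx => ?_
  change x ∈ T μ
  change IsMonomial K A μ x at hx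
  induction hx with
  | e i =>
    refine Submodule.mem_sup_left ?_
    simpa [wt_cons, nested_singleton] using nested_mem_wordSpan (cartan K A) (e K A) (w := [i]) (by simp)
  | f i =>
    refine Submodule.mem_sup_right ?_
    simpa [wt_cons, nested_singleton] using nested_mem_wordSpan (cartan K A) (f K A) (w := [i]) (by simp)
  | h i => exact Submodule.mem_sup_left (mem_wordSpan_zero _ (h_mem_cartan i))
  | lie hx _ _ hy => exact key _ _ hx _ _ hy

/-- A subspace which contains the nested brackets of the degrees in question contains the root
space of a degree with a positive coefficient. -/
theorem rootSpace_le_of_pos {μ : B → ℤ} {b : B} (hμ : 0 < μ b)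
    {N : Submodule K (A.ToLieAlgebra K)}
    (hN : ∀ w, w ≠ [] → wt w = μ → nested (e K A) w ∈ N) : rootSpace K A μ ≤ N := by
  refine (rootSpace_le μ).trans (sup_le (wordSpan_le hN fun h0 => ?_)
    (wordSpan_le (fun w _ hw => ?_) fun h0 => ?_))
  · rw [h0] at hμ; exact absurd hμ (by simp)
  · have := wt_nonneg w b
    rw [hw, Pi.neg_apply] at this
    omega
  · rw [neg_eq_zero.1 h0] at hμ; exact absurd hμ (by simp)

theorem rootSpace_le_of_neg {μ : B → ℤ} {b : B} (hμ : μ b < 0)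
    {N : Submodule K (A.ToLieAlgebra K)}
    (hN : ∀ w, w ≠ [] → wt w = -μ → nested (f K A) w ∈ N) : rootSpace K A μ ≤ N := by
  refine (rootSpace_le μ).trans (sup_le (wordSpan_le (fun w _ hw => ?_) fun h0 => ?_)
    (wordSpan_le hN fun h0 => ?_))
  · have := wt_nonneg w b
    rw [hw] at this
    omega
  · rw [h0] at hμ; exact absurd hμ (by simp)
  · rw [neg_eq_zero.1 h0] at hμ; exact absurd hμ (by simp)

theorem rootSpace_zero_le : rootSpace K A 0 ≤ cartan K A := by
  have h1 : ∀ w : List B, w ≠ [] → wt w ≠ 0 := by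
    intro w hw h0
    obtain ⟨i, w, rfl⟩ := List.exists_cons_of_ne_nil hw
    have := congrFun h0 i
    have h2 := wt_nonneg w i
    simp [wt_cons] at this
    omega
  refine (rootSpace_le 0).trans (sup_le (wordSpan_le (fun w hw h0 => ?_) fun _ => le_rfl)
    (wordSpan_le (fun w hw h0 => ?_) fun _ => le_rfl))
  · exact absurd h0 (h1 w hw)
  · exact absurd (h0.trans neg_zero) (h1 w hw)

theorem grade_le {b : B} {k : ℤ} {N : Submodule K (A.ToLieAlgebra K)}
    (hN : ∀ μ : B → ℤ, μ b = -k → rootSpace K A μ ≤ N) : grade K A b k ≤ N :=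
  iSup₂_le hN

theorem mem_grade {b : B} {k : ℤ} {μ : B → ℤ} (hμ : μ b = -k) {x : A.ToLieAlgebra K}
    (hx : x ∈ rootSpace K A μ) : x ∈ grade K A b k :=
  (le_iSup₂_of_le μ hμ le_rfl : rootSpace K A μ ≤ grade K A b k) hx

theorem e_mem_rootSpace (i : B) : e K A i ∈ rootSpace K A (Pi.single i 1) :=
  Submodule.subset_span (IsMonomial.e i)

theorem f_mem_rootSpace (i : B) : f K A i ∈ rootSpace K A (-Pi.single i 1) :=
  Submodule.subset_span (IsMonomial.f i)

theorem h_mem_rootSpace (i : B) : h K A i ∈ rootSpace K A 0 :=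
  Submodule.subset_span (IsMonomial.h i)

theorem e_mem_grade (b : B) : e K A b ∈ grade K A b (-1) :=
  mem_grade (by simp) (e_mem_rootSpace b)

theorem f_mem_grade (b : B) : f K A b ∈ grade K A b 1 :=
  mem_grade (by simp) (f_mem_rootSpace b)

theorem h_mem_grade (b i : B) : h K A i ∈ grade K A b 0 :=
  mem_grade (by simp) (h_mem_rootSpace i)

theorem e_mem_grade_zero {b i : B} (hi : i ≠ b) : e K A i ∈ grade K A b 0 :=
  mem_grade (by simp [hi]) (e_mem_rootSpace i)

theorem f_mem_grade_zero {b i : B} (hi : i ≠ b) : f K A i ∈ grade K A b 0 :=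
  mem_grade (by simp [hi]) (f_mem_rootSpace i)

/-- A nested bracket which involves `x b` exactly once lies in every subspace that contains `x b`
and is stable under bracketing with the other `x j`. -/
theorem nested_mem_of_wt_eq_one {L : Type*} [LieRing L] [LieAlgebra K L] {x : B → L} {b : B}
    {N : Submodule K L} (hb : x b ∈ N) (hN : ∀ j ≠ b, ∀ y ∈ N, ⁅x j, y⁆ ∈ N) (w : List B)
    (hw : wt w b = 1) : nested x w ∈ N := by
  have h0 : ∀ w : List B, wt w b = 0 → ∀ y ∈ N, ⁅nested x w, y⁆ ∈ N := by
    intro w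
    induction w with
    | nil => intro _ y _; simp [nested]
    | cons i w ih =>
      intro h0 y hy
      have h1 := wt_nonneg w b
      rw [wt_cons] at h0
      by_cases hib : i = b
      · subst hib; simp at h0; omega
      · have h2 : wt w b = 0 := by simpa [Pi.single_apply, Ne.symm hib] using h0
        by_cases hw : w = []
        · subst hw; exact hN i hib y hy
        · rw [nested_cons x i hw, lie_lie]
          exact sub_mem (hN i hib _ (ih h2 y hy)) (ih h2 _ (hN i hib y hy))
  induction w with
  | nil => simp at hw
  | cons i w ih =>
    rw [wt_cons] at hw
    by_cases hib : i = b
    · subst hib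
      by_cases hw' : w = []
      · subst hw'; exact hb
      · rw [nested_cons x i hw', ← lie_skew]
        exact neg_mem (h0 w (by simpa using hw) _ hb)
    · have h2 : wt w b = 1 := by simpa [Pi.single_apply, Ne.symm hib] using hw
      have hw' : w ≠ [] := by rintro rfl; simp at h2
      rw [nested_cons x i hw']
      exact hN i hib _ (ih h2)

/-- An induction principle for degree -1: by the triangular decomposition only nested brackets of
the `e j` occur, with `e b` exactly once. -/
theorem grade_neg_one_le {b : B} {N : Submodule K (A.ToLieAlgebra K)} (hb : e K A b ∈ N)
    (hN : ∀ j ≠ b, ∀ y ∈ N, ⁅e K A j, y⁆ ∈ N) : grade K A b (-1) ≤ N :=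
  grade_le fun μ hμ => rootSpace_le_of_pos (b := b) (by omega) fun w _ hw =>
    nested_mem_of_wt_eq_one hb hN w (by rw [hw, hμ]; norm_num)

theorem grade_one_le {b : B} {N : Submodule K (A.ToLieAlgebra K)} (hb : f K A b ∈ N)
    (hN : ∀ j ≠ b, ∀ y ∈ N, ⁅f K A j, y⁆ ∈ N) : grade K A b 1 ≤ N :=
  grade_le fun μ hμ => rootSpace_le_of_neg (b := b) (by omega) fun w _ hw =>
    nested_mem_of_wt_eq_one hb hN w (by rw [hw, Pi.neg_apply, hμ]; norm_num)

/-- The subspace of degree `0` is spanned by the `h i` and the nested brackets which do not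
involve the node `b`. -/
theorem rootSpace_le_of_eq_zero {μ : B → ℤ} {b : B} (hμ : μ b = 0) (h0 : μ ≠ 0)
    {N : Submodule K (A.ToLieAlgebra K)}
    (he : ∀ w, w ≠ [] → wt w b = 0 → nested (e K A) w ∈ N)
    (hf : ∀ w, w ≠ [] → wt w b = 0 → nested (f K A) w ∈ N) : rootSpace K A μ ≤ N := by
  refine (rootSpace_le μ).trans (sup_le (wordSpan_le (fun w hw hwμ => he w hw (by rw [hwμ, hμ]))
    fun h => absurd h h0) (wordSpan_le (fun w hw hwμ => hf w hw (by
      rw [hwμ, Pi.neg_apply, hμ, neg_zero])) fun h => absurd (neg_eq_zero.1 h) h0))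

theorem nested_mem_of_wt_eq_zero {L : Type*} [LieRing L] [LieAlgebra K L] {x : B → L} {b : B}
    {N : Submodule K L} (hN : ∀ j ≠ b, x j ∈ N) (hl : ∀ j ≠ b, ∀ y ∈ N, ⁅x j, y⁆ ∈ N)
    (w : List B) (hw : wt w b = 0) : nested x w ∈ N := by
  induction w with
  | nil => exact zero_mem _
  | cons i w ih =>
    have h1 := wt_nonneg w b
    rw [wt_cons] at hw
    by_cases hib : i = b
    · subst hib; simp at hw; omega
    · have h2 : wt w b = 0 := by simpa [Pi.single_apply, Ne.symm hib] using hw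
      by_cases hw' : w = []
      · subst hw'; exact hN i hib
      · rw [nested_cons x i hw']
        exact hl i hib _ (ih h2)

theorem lie_h_of_mem_rootSpace [Fintype B] (i : B) {μ : B → ℤ} {x : A.ToLieAlgebra K}
    (hx : x ∈ rootSpace K A μ) : ⁅h K A i, x⁆ = ((∑ j, A i j * μ j : ℤ) : K) • x := by
  induction hx using Submodule.span_induction with
  | mem x hx =>
    change IsMonomial K A μ x at hx
    induction hx with
    | e j => rw [h_lie_e]; simp [Pi.single_apply, Int.cast_smul_eq_zsmul]
    | f j => rw [h_lie_f]; simp [Pi.single_apply, Int.cast_smul_eq_zsmul]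
    | h j => simp [h_lie_h]
    | lie _ _ hx hy =>
      rw [leibniz_lie, hx, hy, smul_lie, lie_smul, ← add_smul]
      congr 1
      simp [mul_add, Finset.sum_add_distrib]
  | zero => simp
  | add x y _ _ hx hy => rw [lie_add, hx, hy, smul_add]
  | smul c x _ hx => rw [lie_smul, hx, smul_comm]

end Triangular

/-! ### Invertibility of Cartan matrices of finite type -/

section FiniteType

variable {B : Type*} [Fintype B] [DecidableEq B] {A : Matrix B B ℤ} {d : B → ℚ}

omit [DecidableEq B] in
theorem IsFiniteType.isGCM (hA : IsFiniteType A d) : IsGCM A where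
  diag := hA.diag
  offDiag := hA.offDiag
  zero i j hij := by
    have h1 := hA.symm i j
    have h2 := (hA.pos j).ne'
    rw [hij] at h1
    simpa [h2] using h1.symm

theorem IsFiniteType.det_ne_zero (hA : IsFiniteType A d) : A.det ≠ 0 := by
  intro h0
  have h1 : (A.map ((↑) : ℤ → ℚ)).det = 0 := by
    rw [← Int.cast_det, h0, Int.cast_zero]
  obtain ⟨v, hv, hAv⟩ := Matrix.exists_mulVec_eq_zero_iff.2 h1
  have h2 := hA.posDef v hv
  have h3 : ∑ i, ∑ j, d i * A i j * v i * v j = 0 := by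
    refine Finset.sum_eq_zero fun i _ => ?_
    have h4 := congrFun hAv i
    simp only [Matrix.mulVec, dotProduct, Matrix.map_apply, Pi.zero_apply] at h4
    calc ∑ j, d i * A i j * v i * v j = d i * v i * ∑ j, A i j * v j := by
          rw [Finset.mul_sum]
          exact Finset.sum_congr rfl fun j _ => by ring
      _ = 0 := by rw [h4, mul_zero]
  linarith

section

variable {K : Type*} [Field K] [CharZero K]

theorem IsFiniteType.det_map_ne_zero (hA : IsFiniteType A d) :
    (A.map ((↑) : ℤ → K)).det ≠ 0 := by
  rw [← Int.cast_det]
  exact Int.cast_ne_zero.2 hA.det_ne_zero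

theorem IsFiniteType.eq_zero_of_mulVec (hA : IsFiniteType A d) {x : B → K}
    (hx : ∀ i, ∑ j, (A i j : K) * x j = 0) (j : B) : x j = 0 := by
  by_contra hj
  refine hA.det_map_ne_zero (K := K) (Matrix.exists_mulVec_eq_zero_iff.1 ⟨x, ?_, ?_⟩)
  · exact fun h => hj (congrFun h j)
  · ext i
    exact hx i

theorem IsFiniteType.eq_zero_of_vecMul (hA : IsFiniteType A d) {x : B → K}
    (hx : ∀ j, ∑ i, (A i j : K) * x i = 0) (i : B) : x i = 0 := by
  by_contra hi
  refine hA.det_map_ne_zero (K := K) (Matrix.exists_vecMul_eq_zero_iff.1 ⟨x, ?_, ?_⟩)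
  · exact fun h => hi (congrFun h i)
  · ext j
    simpa [Matrix.vecMul, dotProduct, mul_comm] using hx j

end

end FiniteType

/-! ### Local nilpotency of the simple root vectors -/

section Nilpotent

variable {K : Type*} [Field K] {B : Type*} [DecidableEq B] {A : Matrix B B ℤ}

/-- The elements killed by some power of a derivation form a subalgebra, here the Engel subalgebra,
so only generators need a check. -/
theorem exists_ad_e_pow_eq_zero (i : B) (x : A.ToLieAlgebra K) :
    ∃ n, (LieAlgebra.ad K (A.ToLieAlgebra K) (e K A i) ^ n) x = 0 := by
  rw [← LieSubalgebra.mem_engel_iff]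
  refine lieSubalgebra_eq_top (fun j => ?_) (fun j => ?_) x
  · rw [LieSubalgebra.mem_engel_iff]
    exact ⟨_, (pow_succ (LieAlgebra.ad K (A.ToLieAlgebra K) (e K A i)) _ ▸ serre_e i j :
      (LieAlgebra.ad K (A.ToLieAlgebra K) (e K A i) ^ ((-A i j).toNat + 1)) (e K A j) = 0)⟩
  · rw [LieSubalgebra.mem_engel_iff]
    by_cases hij : i = j
    · subst hij
      refine ⟨3, ?_⟩
      simp only [pow_succ, pow_zero, one_mul, Module.End.mul_apply, LieAlgebra.ad_apply,
        e_lie_f_same]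
      rw [← lie_skew (e K A i) (h K A i), h_lie_e]
      simp
    · exact ⟨1, by simp [e_lie_f_ne hij]⟩

theorem exists_ad_f_pow_eq_zero (i : B) (x : A.ToLieAlgebra K) :
    ∃ n, (LieAlgebra.ad K (A.ToLieAlgebra K) (f K A i) ^ n) x = 0 := by
  rw [← LieSubalgebra.mem_engel_iff]
  refine lieSubalgebra_eq_top (fun j => ?_) (fun j => ?_) x
  · rw [LieSubalgebra.mem_engel_iff]
    by_cases hij : i = j
    · subst hij
      refine ⟨3, ?_⟩
      simp only [pow_succ, pow_zero, one_mul, Module.End.mul_apply, LieAlgebra.ad_apply]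
      rw [← lie_skew (f K A i) (e K A i), e_lie_f_same, lie_neg, lie_skew, h_lie_f]
      simp
    · exact ⟨1, by
        rw [pow_one, LieAlgebra.ad_apply, ← lie_skew, e_lie_f_ne (Ne.symm hij), neg_zero]⟩
  · rw [LieSubalgebra.mem_engel_iff]
    exact ⟨_, (pow_succ (LieAlgebra.ad K (A.ToLieAlgebra K) (f K A i)) _ ▸ serre_f i j :
      (LieAlgebra.ad K (A.ToLieAlgebra K) (f K A i) ^ ((-A i j).toNat + 1)) (f K A j) = 0)⟩

theorem exists_toEnd_pow_lie_eq_zero {L M : Type*} [LieRing L] [LieAlgebra K L]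
    [AddCommGroup M] [Module K M] [LieRingModule L M] [LieModule K L M] {y : L}
    (hy : ∀ x, ∃ n, (LieAlgebra.ad K L y ^ n) x = 0) {v : M}
    (hv : ∃ n, (toEnd K L M y ^ n) v = 0) (x : L) : ∃ n, (toEnd K L M y ^ n) ⁅x, v⁆ = 0 := by
  obtain ⟨m, hm⟩ := hy x
  obtain ⟨n, hn⟩ := hv
  have hm' : ∀ k ≥ m, (LieAlgebra.ad K L y ^ k) x = 0 := fun k hk => by
    obtain ⟨l, rfl⟩ := Nat.exists_eq_add_of_le' hk
    rw [pow_add, Module.End.mul_apply, hm, map_zero]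
  have hn' : ∀ k ≥ n, (toEnd K L M y ^ k) v = 0 := fun k hk => by
    obtain ⟨l, rfl⟩ := Nat.exists_eq_add_of_le' hk
    rw [pow_add, Module.End.mul_apply, hn, map_zero]
  refine ⟨m + n, ?_⟩
  rw [toEnd_pow_lie]
  refine Finset.sum_eq_zero fun ij hij => ?_
  rw [Finset.HasAntidiagonal.mem_antidiagonal] at hij
  rcases le_or_gt m ij.1 with h1 | h1
  · rw [hm' _ h1, zero_lie, smul_zero]
  · rw [hn' _ (by omega), lie_zero, smul_zero]

end Nilpotent

/-! ### Separation of weights, and kernels of homomorphisms -/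

section Homogeneous

/-- A subspace that is stable under commuting operators contains the components of its elements in
distinct simultaneous eigenspaces. -/
theorem mem_of_add_sum_mem {K V ι I : Type*} [Field K] [AddCommGroup V] [Module K V]
    {N : Submodule K V} {T : I → Module.End K V} (hN : ∀ i, ∀ x ∈ N, T i x ∈ N)
    {χ : ι → I → K} (s : Finset ι) :
    ∀ (x : V) (ξ : I → K) (y : ι → V), (∀ i, T i x = ξ i • x) →
      (∀ a ∈ s, ∀ i, T i (y a) = χ a i • y a) → (∀ a ∈ s, ξ ≠ χ a) → x + ∑ a ∈ s, y a ∈ N →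
      x ∈ N := by
  classical
  induction s using Finset.induction_on with
  | empty => intro x ξ y _ _ _ h; simpa using h
  | insert a s ha ih =>
    intro x ξ y hx hy hne h
    obtain ⟨i, hi⟩ := Function.ne_iff.1 (hne a (Finset.mem_insert_self a s))
    -- The operator T i - χ a i removes the component y a and rescales all others, that of x by a
    -- nonzero factor.
    have h1 : (ξ i - χ a i) • x + ∑ c ∈ s, (χ c i - χ a i) • y c ∈ N := by
      have h2 := sub_mem (hN i _ h) (N.smul_mem (χ a i) h)
      rw [Finset.sum_insert ha, map_add, map_add, map_sum, hx, hy a (Finset.mem_insert_self a s),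
        Finset.sum_congr rfl fun c hc => hy c (Finset.mem_insert_of_mem hc) i] at h2
      convert h2 using 1
      simp only [sub_smul, Finset.sum_sub_distrib, smul_add, Finset.smul_sum]
      abel
    have h3 := ih ((ξ i - χ a i) • x) ξ (fun c => (χ c i - χ a i) • y c)
      (fun j => by rw [map_smul, hx, smul_comm])
      (fun c hc j => by rw [map_smul, hy c (Finset.mem_insert_of_mem hc), smul_comm])
      (fun c hc => hne c (Finset.mem_insert_of_mem hc)) h1
    exact (N.smul_mem_iff (sub_ne_zero.2 hi)).1 h3

variable {K : Type*} [Field K] {B : Type*} [DecidableEq B] {A : Matrix B B ℤ}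

theorem exists_finsupp_of_mem_grade {b : B} {k : ℤ} {x : A.ToLieAlgebra K}
    (hx : x ∈ grade K A b k) :
    ∃ y : (B → ℤ) →₀ A.ToLieAlgebra K, (∀ μ, y μ ∈ rootSpace K A μ) ∧
      (∀ μ, y μ ≠ 0 → μ b = -k) ∧ y.sum (fun _ z => z) = x := by
  obtain ⟨y, hy, hsum⟩ := (Submodule.mem_iSup_iff_exists_finsupp _ _).1 hx
  have h : ∀ μ, y μ ∈ rootSpace K A μ ∧ (y μ ≠ 0 → μ b = -k) := by
    intro μ
    by_cases hμ : μ b = -k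
    · have := hy μ
      rw [iSup_pos hμ] at this
      exact ⟨this, fun _ => hμ⟩
    · have := hy μ
      rw [iSup_neg hμ, Submodule.mem_bot] at this
      rw [this]
      exact ⟨zero_mem _, fun h => absurd rfl h⟩
  exact ⟨y, fun μ => (h μ).1, fun μ => (h μ).2, hsum⟩

variable [CharZero K] [Fintype B] {d : B → ℚ}

theorem IsFiniteType.weight_injective (hA : IsFiniteType A d) :
    Function.Injective fun (μ : B → ℤ) (i : B) => ((∑ j, A i j * μ j : ℤ) : K) := by
  intro μ ν h
  ext j
  have := hA.eq_zero_of_mulVec (K := K) (x := fun j => (μ j : K) - ν j) (fun i => by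
    have h1 := congrFun h i
    push_cast at h1
    simp only [mul_sub, Finset.sum_sub_distrib, h1, sub_self]) j
  exact_mod_cast sub_eq_zero.1 this

/-- Distinct elements of the root lattice give distinct weights because A is invertible, so a vector
cannot have two degrees unless it is zero. -/
theorem IsFiniteType.eq_zero_of_mem_rootSpace (hA : IsFiniteType A d) {b : B} {k : ℤ} {μ : B → ℤ}
    {x : A.ToLieAlgebra K} (hx : x ∈ grade K A b k) (hxμ : x ∈ rootSpace K A μ) (hμ : μ b ≠ -k) :
    x = 0 := by
  obtain ⟨y, hy, hyk, hsum⟩ := exists_finsupp_of_mem_grade hx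
  have := mem_of_add_sum_mem (N := (⊥ : Submodule K (A.ToLieAlgebra K)))
    (T := fun i => LieAlgebra.ad K (A.ToLieAlgebra K) (h K A i))
    (χ := fun (μ : B → ℤ) (i : B) => ((∑ j, A i j * μ j : ℤ) : K)) (by simp) y.support
    x _ (fun μ => - y μ) (fun i => lie_h_of_mem_rootSpace i hxμ)
    (fun ν _ i => lie_h_of_mem_rootSpace i (neg_mem (hy ν))) (fun ν hν h0 => by
      have h1 : μ = ν := hA.weight_injective (K := K) h0
      exact hμ (h1 ▸ hyk ν (Finsupp.mem_support_iff.1 hν)))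
    (by rw [← hsum, Finset.sum_neg_distrib, Finsupp.sum, add_neg_cancel]; exact zero_mem _)
  simpa using this

variable {M : Type*} [LieRing M] [LieAlgebra K M] (g : A.ToLieAlgebra K →ₗ⁅K⁆ M)

/-- A homomorphism which is injective on the Cartan subalgebra is injective on the root spaces. -/
theorem IsFiniteType.eq_zero_of_map_eq_zero (hA : IsFiniteType A d)
    (hg : ∀ c ∈ cartan K A, g c = 0 → c = 0) (n : ℕ) :
    ∀ μ : B → ℤ, 0 ≤ μ → μ ≠ 0 → ∑ i, μ i = n → ∀ x ∈ rootSpace K A μ, g x = 0 → x = 0 := by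
  induction n with
  | zero =>
    intro μ h0 hne hsum
    refine absurd (funext fun i => ?_) hne
    exact (Finset.sum_eq_zero_iff_of_nonneg fun i _ => h0 i).1 hsum i (Finset.mem_univ i)
  | succ n ih =>
    intro μ h0 hne hsum x hx hgx
    -- The bracket has smaller height and also lies in the kernel. The induction applies unless its
    -- degree is 0, where injectivity on the Cartan subalgebra is used, or has a negative
    -- coefficient.
    have hf : ∀ j, ⁅f K A j, x⁆ = 0 := by
      intro j
      have h1 := lie_mem_rootSpace (f_mem_rootSpace j) hx
      have h2 : g ⁅f K A j, x⁆ = 0 := by rw [LieHom.map_lie, hgx, lie_zero]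
      by_cases hz : -Pi.single j 1 + μ = 0
      · rw [hz] at h1
        exact hg _ (rootSpace_zero_le h1) h2
      · by_cases hnn : 0 ≤ -Pi.single j 1 + μ
        · refine ih _ hnn hz ?_ _ h1 h2
          simp only [Pi.add_apply, Pi.neg_apply, Finset.sum_add_distrib, hsum,
            Finset.sum_neg_distrib, Finset.sum_pi_single', Finset.mem_univ, if_true]
          push_cast
          ring
        -- Here μ - α_j is -1 at j and positive at another node; such root spaces vanish.
        · have hj : μ j = 0 := by
            by_contra hj
            refine hnn fun i => ?_
            have h3 := h0 i
            by_cases hij : i = j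
            · subst hij
              simp only [Pi.zero_apply, Pi.add_apply, Pi.neg_apply, Pi.single_eq_same] at h3 ⊢
              omega
            · simpa [hij] using h3
          obtain ⟨k, hk⟩ := Function.ne_iff.1 hne
          have hkj : k ≠ j := fun h => hk (by rw [h, hj]; rfl)
          have h3 : μ j - 1 < 0 := by omega
          have := rootSpace_le_of_neg (K := K) (A := A) (μ := -Pi.single j 1 + μ) (b := j)
            (N := ⊥) (by simp; omega) (fun w _ hw => by
              have h4 := wt_nonneg w k
              have h5 := h0 k
              rw [hw] at h4
              simp only [Pi.neg_apply, Pi.add_apply, Pi.single_eq_of_ne hkj, Pi.zero_apply]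
                at h4 h5 hk
              omega)
          exact (Submodule.mem_bot K).1 (this h1)
    by_contra hx0
    -- Positive definiteness yields a coroot that is positive on μ, whereas a lowest weight vector
    -- with nilpotent `e j` has weight at most 0.
    obtain ⟨j, hj⟩ : ∃ j, 0 < ∑ i, A j i * μ i := by
      by_contra! hle
      have h1 := hA.posDef (fun i => (μ i : ℚ)) (fun h => hne (funext fun i => by
        have := congrFun h i
        simpa using this))
      have h2 : ∑ i, ∑ j, d i * A i j * (μ i : ℚ) * μ j ≤ 0 := by
        refine Finset.sum_nonpos fun i _ => ?_
        have h3 : ∑ j, d i * A i j * (μ i : ℚ) * μ j = d i * μ i * ((∑ j, A i j * μ j : ℤ) : ℚ) := by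
          push_cast
          rw [Finset.mul_sum]
          exact Finset.sum_congr rfl fun j _ => by ring
        rw [h3]
        refine mul_nonpos_of_nonneg_of_nonpos (mul_nonneg (hA.pos i).le ?_) ?_
        · exact_mod_cast h0 i
        · exact_mod_cast hle i
      linarith
    obtain ⟨N, hN⟩ := exists_ad_e_pow_eq_zero j x
    have hA2 : ((A j j : ℤ) : K) = 2 := by rw [hA.diag]; norm_num
    obtain ⟨k, hk, -⟩ := exists_weight_eq (K := K) (e_lie_f_same j)
      (by rw [h_lie_e, ← Int.cast_smul_eq_zsmul K, hA2]) (lie_h_of_mem_rootSpace j hx) (hf j) hx0 hN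
    have : (∑ i, A j i * μ i : ℤ) = -(k : ℤ) := by exact_mod_cast hk
    omega

/-- The kernel is stable under the coroots, so it contains the weight components of its elements;
each of these has the coefficient 1 at b and thus either vanishes or falls under the induction on
height. -/
theorem IsFiniteType.eq_zero_of_mem_grade (hA : IsFiniteType A d)
    (hg : ∀ c ∈ cartan K A, g c = 0 → c = 0) {b : B} {x : A.ToLieAlgebra K}
    (hx : x ∈ grade K A b (-1)) (hgx : g x = 0) : x = 0 := by
  obtain ⟨y, hy, hyk, rfl⟩ := exists_finsupp_of_mem_grade hx
  refine Finset.sum_eq_zero fun μ hμ => ?_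
  have hker : y μ ∈ (g : A.ToLieAlgebra K →ₗ[K] M).ker := by
    refine mem_of_add_sum_mem (T := fun i => LieAlgebra.ad K (A.ToLieAlgebra K) (h K A i))
      (χ := fun (μ : B → ℤ) (i : B) => ((∑ j, A i j * μ j : ℤ) : K))
      (fun i z hz => ?_) (y.support.erase μ) (y μ) _ y
      (fun i => lie_h_of_mem_rootSpace i (hy μ)) (fun ν _ i => lie_h_of_mem_rootSpace i (hy ν))
      (fun ν hν h0 => ?_) ?_
    · simp only [LinearMap.mem_ker, LieHom.coe_toLinearMap, LieAlgebra.ad_apply,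
        LieHom.map_lie] at hz ⊢
      rw [hz, lie_zero]
    · exact Finset.ne_of_mem_erase hν (hA.weight_injective (K := K) h0).symm
    · rw [Finset.add_sum_erase _ _ hμ]
      exact hgx
  have hb := hyk μ (Finsupp.mem_support_iff.1 hμ)
  have hne : μ ≠ 0 := by rintro rfl; simp at hb
  by_cases h0 : 0 ≤ μ
  · refine hA.eq_zero_of_map_eq_zero g hg (∑ i, μ i).toNat μ h0 hne ?_ _ (hy μ) hker
    rw [Int.toNat_of_nonneg (Finset.sum_nonneg fun i _ => h0 i)]
  · obtain ⟨j, hj⟩ : ∃ j, μ j < 0 := by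
      by_contra! h
      exact h0 h
    have := rootSpace_le_of_pos (K := K) (A := A) (μ := μ) (b := b) (N := ⊥) (by omega)
      (fun w _ hw => by
        have := wt_nonneg w j
        rw [hw] at this
        omega)
    exact (Submodule.mem_bot K).1 (this (hy μ))

end Homogeneous

/-! ### Norm bound for the weights of integrable highest weight modules -/

section HighestWeight

/-- The bilinear form on the rational root lattice. -/
def rootForm {B : Type*} [Fintype B] [DecidableEq B] (A : Matrix B B ℤ) (d : B → ℚ) :
    LinearMap.BilinForm ℚ (B → ℚ) :=
  Matrix.toBilin' (Matrix.of fun i j => d i * A i j)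

section

variable {B : Type*} [Fintype B] [DecidableEq B] {A : Matrix B B ℤ} {d : B → ℚ}

theorem rootForm_apply (u v : B → ℚ) :
    rootForm A d u v = ∑ i, d i * u i * ∑ j, A i j * v j := by
  simp only [rootForm, Matrix.toBilin'_apply, Matrix.of_apply, Finset.mul_sum]
  exact Finset.sum_congr rfl fun i _ => Finset.sum_congr rfl fun j _ => by ring

theorem IsFiniteType.rootForm_comm (hA : IsFiniteType A d) (u v : B → ℚ) :
    rootForm A d u v = rootForm A d v u := by
  simp only [rootForm, Matrix.toBilin'_apply, Matrix.of_apply]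
  rw [Finset.sum_comm]
  exact Finset.sum_congr rfl fun i _ => Finset.sum_congr rfl fun j _ => by rw [hA.symm j i]; ring

theorem IsFiniteType.rootForm_self_nonneg (hA : IsFiniteType A d) (v : B → ℚ) :
    0 ≤ rootForm A d v v := by
  by_cases hv : v = 0
  · simp [hv]
  · have := hA.posDef v hv
    simp only [rootForm, Matrix.toBilin'_apply, Matrix.of_apply]
    refine this.le.trans_eq (Finset.sum_congr rfl fun i _ => Finset.sum_congr rfl fun j _ => ?_)
    ring

theorem IsFiniteType.exists_rootForm_eq (hA : IsFiniteType A d) (l : B → ℚ) :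
    ∃ w : B → ℚ, ∀ v, rootForm A d w v = ∑ i, l i * v i := by
  have hdet : IsUnit (A.map ((↑) : ℤ → ℚ)).det := (hA.det_map_ne_zero (K := ℚ)).isUnit
  refine ⟨(A.map ((↑) : ℤ → ℚ))⁻¹.mulVec fun i => l i / d i, fun v => ?_⟩
  rw [hA.rootForm_comm, rootForm_apply]
  refine Finset.sum_congr rfl fun i _ => ?_
  have h1 : (A.map ((↑) : ℤ → ℚ)).mulVec ((A.map ((↑) : ℤ → ℚ))⁻¹.mulVec fun i => l i / d i) i =
      l i / d i := by
    rw [Matrix.mulVec_mulVec, Matrix.mul_nonsing_inv _ hdet, Matrix.one_mulVec]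
  have h2 := (hA.pos i).ne'
  simp only [Matrix.mulVec, dotProduct, Matrix.map_apply] at h1 ⊢
  rw [h1]
  field_simp

theorem IsFiniteType.sq_rootForm_le (hA : IsFiniteType A d) (u v : B → ℚ) :
    rootForm A d u v ^ 2 ≤ rootForm A d u u * rootForm A d v v :=
  LinearMap.BilinForm.apply_sq_le_of_symm _ hA.rootForm_self_nonneg ⟨hA.rootForm_comm⟩ u v

/-- The vectors of the root lattice with bounded norm after a translation have bounded height. -/
theorem IsFiniteType.exists_height_bound (hA : IsFiniteType A d) (l : B → ℚ) :
    ∃ C : ℚ, ∀ m : B → ℚ, rootForm A d m m ≤ 2 * ∑ i, l i * m i → (∑ i, m i) ^ 2 ≤ C := by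
  obtain ⟨w, hw⟩ := hA.exists_rootForm_eq l
  obtain ⟨t, ht⟩ := hA.exists_rootForm_eq fun _ => 1
  -- Let w represent l and t the height. By Cauchy-Schwarz (m, m) ≤ 2(w, m) gives (m, m) ≤ 4(w, w),
  -- and the squared height (t, m)² is at most (t, t)(m, m).
  refine ⟨rootForm A d t t * (4 * rootForm A d w w), fun m hm => ?_⟩
  rw [← hw] at hm
  have h1 := hA.sq_rootForm_le w m
  have h2 := hA.sq_rootForm_le t m
  rw [ht] at h2
  simp only [one_mul] at h2
  have hmm := hA.rootForm_self_nonneg m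
  have hww := hA.rootForm_self_nonneg w
  refine h2.trans (mul_le_mul_of_nonneg_left ?_ (hA.rootForm_self_nonneg t))
  rcases hmm.eq_or_lt with h0 | h0
  · rw [← h0]
    positivity
  · have h3 : rootForm A d m m ^ 2 ≤ 4 * rootForm A d w w * rootForm A d m m := by nlinarith
    nlinarith

end

variable {K : Type*} [Field K] {B : Type*} [DecidableEq B] {A : Matrix B B ℤ}
  {M : Type*} [AddCommGroup M] [Module K M] [LieRingModule (A.ToLieAlgebra K) M]
  [LieModule K (A.ToLieAlgebra K) M]

/-- `v` is a highest weight vector of weight `l` with a locally nilpotent action of the `f i`. -/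
structure IsIntegrableVector (l : B → ℕ) (v : M) : Prop where
  lie_e : ∀ i, ⁅e K A i, v⁆ = 0
  lie_h : ∀ i, ⁅h K A i, v⁆ = (l i : K) • v
  pow_f : ∀ i, ∃ n, (toEnd K (A.ToLieAlgebra K) M (f K A i) ^ n) v = 0

variable (K A) in
/-- The vector obtained from `v` by applying the lowering operators of a word. -/
def lower (v : M) (w : List B) : M := w.foldr (fun i u => ⁅f K A i, u⁆) v

omit [Module K M] [LieModule K (A.ToLieAlgebra K) M] in
@[simp] theorem lower_nil (v : M) : lower K A v [] = v := rfl

omit [Module K M] [LieModule K (A.ToLieAlgebra K) M] in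
@[simp] theorem lower_cons (v : M) (i : B) (w : List B) :
    lower K A v (i :: w) = ⁅f K A i, lower K A v w⁆ := rfl

variable (K A) in
/-- The span of the vectors `lower v w` of degree `m`. -/
def weightPart (v : M) (m : B → ℤ) : Submodule K M :=
  Submodule.span K {u | ∃ w, wt w = m ∧ u = lower K A v w}

omit [LieModule K (A.ToLieAlgebra K) M] in
theorem lower_mem_weightPart (v : M) (w : List B) : lower K A v w ∈ weightPart K A v (wt w) :=
  Submodule.subset_span ⟨w, rfl, rfl⟩

theorem lie_f_mem_weightPart {v u : M} {m : B → ℤ} (hu : u ∈ weightPart K A v m) (i : B) :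
    ⁅f K A i, u⁆ ∈ weightPart K A v (Pi.single i 1 + m) := by
  have : weightPart K A v m ≤ (weightPart K A v (Pi.single i 1 + m)).comap
      (toEnd K (A.ToLieAlgebra K) M (f K A i)) := by
    refine Submodule.span_le.2 ?_
    rintro _ ⟨w, rfl, rfl⟩
    simpa [wt_cons] using lower_mem_weightPart (K := K) (A := A) v (i :: w)
  exact this hu

variable {l : B → ℕ} {v : M} [Fintype B]

theorem IsIntegrableVector.lie_h_mem (hv : IsIntegrableVector (K := K) (A := A) l v) (i : B)
    {m : B → ℤ} {u : M} (hu : u ∈ weightPart K A v m) :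
    ⁅h K A i, u⁆ = ((l i - ∑ j, A i j * m j : ℤ) : K) • u := by
  have hw : ∀ w, ⁅h K A i, lower K A v w⁆ =
      ((l i - ∑ j, A i j * wt w j : ℤ) : K) • lower K A v w := by
    intro w
    induction w with
    | nil => simp [hv.lie_h]
    | cons k w ih =>
      rw [lower_cons, leibniz_lie, h_lie_f, ih, lie_smul, ← Int.cast_smul_eq_zsmul K, neg_lie,
        smul_lie, ← neg_smul, ← add_smul]
      congr 1
      simp [wt_cons, mul_add, Finset.sum_add_distrib, Pi.single_apply]
      ring
  induction hu using Submodule.span_induction with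
  | mem u hu => obtain ⟨w, rfl, rfl⟩ := hu; exact hw w
  | zero => simp
  | add x y _ _ hx hy => rw [lie_add, hx, hy, smul_add]
  | smul c x _ hx => rw [lie_smul, hx, smul_comm]

theorem IsIntegrableVector.lie_e_mem (hv : IsIntegrableVector (K := K) (A := A) l v) (i : B)
    {m : B → ℤ} {u : M} (hu : u ∈ weightPart K A v m) :
    ⁅e K A i, u⁆ ∈ weightPart K A v (m - Pi.single i 1) := by
  have : weightPart K A v m ≤ (weightPart K A v (m - Pi.single i 1)).comap
      (toEnd K (A.ToLieAlgebra K) M (e K A i)) := by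
    refine Submodule.span_le.2 ?_
    rintro _ ⟨w, rfl, rfl⟩
    simp only [Submodule.comap_coe, Set.mem_preimage, toEnd_apply_apply, SetLike.mem_coe]
    clear hu
    induction w with
    | nil => simp [hv.lie_e]
    | cons k w ih =>
      rw [lower_cons, leibniz_lie]
      refine add_mem ?_ ?_
      · by_cases hik : i = k
        · subst hik
          rw [e_lie_f_same, hv.lie_h_mem i (lower_mem_weightPart v w), wt_cons,
            add_sub_cancel_left]
          exact Submodule.smul_mem _ _ (lower_mem_weightPart v w)
        · rw [e_lie_f_ne hik, zero_lie]
          exact zero_mem _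
      · rw [wt_cons, add_sub_assoc]
        exact lie_f_mem_weightPart ih k
  exact this hu

theorem IsIntegrableVector.pow_lie_e_mem (hv : IsIntegrableVector (K := K) (A := A) l v) (i : B)
    {m : B → ℤ} {u : M} (hu : u ∈ weightPart K A v m) (k : ℕ) :
    (toEnd K (A.ToLieAlgebra K) M (e K A i) ^ k) u ∈ weightPart K A v (m - Pi.single i (k : ℤ)) := by
  induction k with
  | zero => simpa using hu
  | succ k ih =>
    rw [pow_succ', Module.End.mul_apply, toEnd_apply_apply, Nat.cast_succ, Pi.single_add,
      ← sub_sub]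
    exact hv.lie_e_mem i ih

omit [Fintype B] in
theorem IsIntegrableVector.exists_pow_f (hv : IsIntegrableVector (K := K) (A := A) l v) (i : B)
    {m : B → ℤ} {u : M} (hu : u ∈ weightPart K A v m) :
    ∃ n, (toEnd K (A.ToLieAlgebra K) M (f K A i) ^ n) u = 0 := by
  have : weightPart K A v m ≤
      (toEnd K (A.ToLieAlgebra K) M (f K A i)).maxGenEigenspace 0 := by
    refine Submodule.span_le.2 ?_
    rintro _ ⟨w, rfl, rfl⟩
    rw [SetLike.mem_coe, Module.End.mem_maxGenEigenspace, zero_smul, sub_zero]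
    clear hu
    induction w with
    | nil => exact hv.pow_f i
    | cons k w ih => exact exists_toEnd_pow_lie_eq_zero (exists_ad_f_pow_eq_zero i) ih _
  have := this hu
  rwa [Module.End.mem_maxGenEigenspace, zero_smul, sub_zero] at this

variable [CharZero K] {d : B → ℚ}

omit [LieModule K (A.ToLieAlgebra K) M] [Fintype B] [CharZero K] in
theorem weightPart_eq_bot_or {m : B → ℤ} : weightPart K A v m = ⊥ ∨ ∃ w, wt w = m := by
  by_cases hw : ∃ w, wt w = m
  · exact Or.inr hw
  · push Not at hw
    refine Or.inl (Submodule.span_eq_bot.2 ?_)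
    rintro _ ⟨w, h, -⟩
    exact absurd h (hw w)

omit [CharZero K] in
theorem sum_wt (w : List B) : ∑ i, wt w i = w.length := by
  induction w with
  | nil => simp
  | cons i w ih =>
    simp only [wt_cons, Pi.add_apply, Finset.sum_add_distrib, ih, Finset.sum_pi_single',
      Finset.mem_univ, if_true, List.length_cons]
    push_cast
    ring

/-- The weights of an integrable highest weight module are not longer than the highest weight. -/
theorem IsIntegrableVector.rootForm_le (hA : IsFiniteType A d)
    (hv : IsIntegrableVector (K := K) (A := A) l v) (n : ℕ) :
    ∀ m : B → ℤ, ∑ i, m i = n → ∀ u ∈ weightPart K A v m, u ≠ 0 →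
      rootForm A d (fun i => m i) (fun i => m i) ≤ 2 * ∑ i, d i * l i * m i := by
  induction n using Nat.strong_induction_on with
  | _ n ih =>
    intro m hm u hu hu0
    obtain hbot | ⟨w, rfl⟩ := weightPart_eq_bot_or (K := K) (A := A) (v := v) (m := m)
    · rw [hbot, Submodule.mem_bot] at hu
      exact absurd hu hu0
    -- With λ the highest weight, the claim says |λ - m|² ≤ |λ|². If λ - m is dominant, then (m, m)
    -- ≤ (λ, m) and 0 ≤ (λ, m).
    by_cases hdom : ∀ j, 0 ≤ (l j : ℤ) - ∑ i, A j i * wt w i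
    · have h1 : rootForm A d (fun i => wt w i) (fun i => wt w i) ≤ ∑ i, d i * l i * wt w i := by
        rw [rootForm_apply]
        refine Finset.sum_le_sum fun j _ => ?_
        have h2 : (∑ i, (A j i : ℚ) * wt w i) ≤ l j := by
          have := hdom j
          exact_mod_cast sub_nonneg.1 this
        have h3 : (0 : ℚ) ≤ wt w j := by exact_mod_cast wt_nonneg w j
        have h4 := mul_nonneg (hA.pos j).le h3
        nlinarith
      have h5 : 0 ≤ ∑ i, d i * l i * (wt w i : ℚ) :=
        Finset.sum_nonneg fun i _ => mul_nonneg (mul_nonneg (hA.pos i).le (Nat.cast_nonneg _))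
          (by exact_mod_cast wt_nonneg w i)
      linarith
    -- Otherwise λ - m takes a value -k < 0 at some coroot j. Then `e j` to the power k does not
    -- kill u and moves it to the reflected weight, which has the same norm, and the degree m - kα_j
    -- has smaller height.
    · push Not at hdom
      obtain ⟨j, hj⟩ := hdom
      obtain ⟨k, hk⟩ := Int.exists_eq_neg_ofNat hj.le
      have hk0 : 0 < k := by omega
      obtain ⟨N, hN⟩ := hv.exists_pow_f j hu
      have hA2 : ((A j j : ℤ) : K) = 2 := by rw [hA.diag]; norm_num
      have hwu := hv.lie_h_mem j hu
      rw [hk] at hwu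
      push_cast at hwu
      have hne := pow_ne_zero_of_weight (e_lie_f_same j)
        (by rw [h_lie_e, ← Int.cast_smul_eq_zsmul K, hA2])
        (by rw [h_lie_f, ← Int.cast_smul_eq_zsmul K, hA2, neg_smul]) N k u hwu hN hu0
      have hmem := hv.pow_lie_e_mem j hu k
      obtain hbot | ⟨w', hw'⟩ := weightPart_eq_bot_or (K := K) (A := A) (v := v)
        (m := wt w - Pi.single j (k : ℤ))
      · rw [hbot, Submodule.mem_bot] at hmem
        exact absurd hmem hne
      have hsum : ∑ i, (wt w - Pi.single j (k : ℤ) : B → ℤ) i = n - k := by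
        simp only [Pi.sub_apply, Finset.sum_sub_distrib, hm, Finset.sum_pi_single',
          Finset.mem_univ, if_true]
      have hlen := sum_wt w'
      rw [hw', hsum] at hlen
      have h1 := ih w'.length (by omega) _ (by rw [hsum, hlen]) _ hmem hne
      have h2 : (fun i => (((wt w - Pi.single j (k : ℤ) : B → ℤ) i : ℤ) : ℚ)) =
          (fun i => (wt w i : ℚ)) - (k : ℚ) • Pi.single j (1 : ℚ) := by
        ext i
        by_cases hij : i = j
        · subst hij; simp
        · simp [hij]
      have h3 : rootForm A d (Pi.single j (1 : ℚ)) (fun i => (wt w i : ℚ)) = d j * (l j + k) := by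
        rw [rootForm_apply, Finset.sum_eq_single j (fun i _ hij => by simp [hij]) (by simp)]
        have : (∑ i, (A j i : ℚ) * wt w i) = l j + k := by
          have h5 : (∑ i, A j i * wt w i) = (l j : ℤ) + k := by linarith
          exact_mod_cast h5
        rw [this]
        simp
      have h4 : rootForm A d (Pi.single j (1 : ℚ)) (Pi.single j (1 : ℚ)) = 2 * d j := by
        rw [rootForm_apply, Finset.sum_eq_single j (fun i _ hij => by simp [hij]) (by simp)]
        simp [Pi.single_apply, hA.diag, mul_comm]
      have h6 : ∑ i, d i * l i * (((wt w - Pi.single j (k : ℤ) : B → ℤ) i : ℤ) : ℚ) =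
          (∑ i, d i * l i * (wt w i : ℚ)) - d j * l j * k := by
        have : ∀ i, d i * l i * (((wt w - Pi.single j (k : ℤ) : B → ℤ) i : ℤ) : ℚ) =
            d i * l i * (wt w i : ℚ) - if i = j then d j * l j * k else 0 := by
          intro i
          by_cases hij : i = j
          · subst hij; simp; ring
          · simp [hij]
        simp only [this, Finset.sum_sub_distrib, Finset.sum_ite_eq', Finset.mem_univ, if_true]
      rw [h6, h2] at h1
      simp only [map_sub, map_smul, LinearMap.sub_apply, LinearMap.smul_apply, h3, h4,
        hA.rootForm_comm _ (Pi.single j (1 : ℚ)), smul_eq_mul] at h1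
      linarith

/-- Long words kill the highest weight vector. -/
theorem IsIntegrableVector.exists_lower_eq_zero (hA : IsFiniteType A d)
    (hv : IsIntegrableVector (K := K) (A := A) l v) :
    ∃ N : ℕ, ∀ w : List B, N < w.length → lower K A v w = 0 := by
  obtain ⟨C, hC⟩ := hA.exists_height_bound fun i => d i * l i
  -- The maximum with 1 makes the length of the word at most its square.
  obtain ⟨N, hN⟩ := exists_nat_gt (max C 1)
  refine ⟨N, fun w hw => ?_⟩
  by_contra h0
  have h1 := hC _ (hv.rootForm_le hA w.length (wt w) (sum_wt w) _ (lower_mem_weightPart v w) h0)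
  have h2 : ∑ i, (wt w i : ℚ) = w.length := by exact_mod_cast sum_wt w
  rw [h2] at h1
  have h3 : (N : ℚ) < w.length := by exact_mod_cast hw
  have h4 := lt_of_le_of_lt (le_max_left C 1) hN
  have h5 := lt_of_le_of_lt (le_max_right C 1) hN
  nlinarith

end HighestWeight

/-! ### Finite-dimensionality and trace form of the highest weight module -/

section CyclicModule

variable {K : Type*} [Field K] {B : Type*} [DecidableEq B] {A : Matrix B B ℤ}
  {M : Type*} [AddCommGroup M] [Module K M] [LieRingModule (A.ToLieAlgebra K) M]
  [LieModule K (A.ToLieAlgebra K) M]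

variable (K A) in
/-- The span of the vectors `lower v w` for the words `w` of length at least `n`. -/
def lowerSpan (v : M) (n : ℕ) : Submodule K M :=
  Submodule.span K {u | ∃ w : List B, n ≤ w.length ∧ u = lower K A v w}

omit [LieModule K (A.ToLieAlgebra K) M] in
theorem lower_mem_lowerSpan (v : M) {n : ℕ} {w : List B} (hw : n ≤ w.length) :
    lower K A v w ∈ lowerSpan K A v n :=
  Submodule.subset_span ⟨w, hw, rfl⟩

omit [LieModule K (A.ToLieAlgebra K) M] in
theorem lowerSpan_le (v : M) {m n : ℕ} (hmn : m ≤ n) : lowerSpan K A v n ≤ lowerSpan K A v m :=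
  Submodule.span_mono fun _ ⟨w, hw, h⟩ => ⟨w, hmn.trans hw, h⟩

theorem lie_f_mem_lowerSpan {v u : M} {n : ℕ} (hu : u ∈ lowerSpan K A v n) (i : B) :
    ⁅f K A i, u⁆ ∈ lowerSpan K A v (n + 1) := by
  have : lowerSpan K A v n ≤ (lowerSpan K A v (n + 1)).comap
      (toEnd K (A.ToLieAlgebra K) M (f K A i)) := by
    refine Submodule.span_le.2 ?_
    rintro _ ⟨w, hw, rfl⟩
    exact lower_mem_lowerSpan v (w := i :: w) (by simpa using hw)
  exact this hu

/-- Degree 1 elements are combinations of nested brackets of the `f j`, so they lengthen every word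
by at least one letter. Since long words vanish, arbitrary elements of degree 1, not only root
vectors, are nilpotent on the highest weight vector. -/
theorem lie_mem_lowerSpan {b : B} {y : A.ToLieAlgebra K} (hy : y ∈ grade K A b 1) {v u : M} {n : ℕ}
    (hu : u ∈ lowerSpan K A v n) : ⁅y, u⁆ ∈ lowerSpan K A v (n + 1) := by
  let N : Submodule K (A.ToLieAlgebra K) :=
    { carrier := {y | ∀ n, ∀ u ∈ lowerSpan K A v n, ⁅y, u⁆ ∈ lowerSpan K A v (n + 1)}
      zero_mem' := fun n u _ => by rw [zero_lie]; exact zero_mem _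
      add_mem' := fun ha hb n u hu => by rw [add_lie]; exact add_mem (ha n u hu) (hb n u hu)
      smul_mem' := fun c _ ha n u hu => by
        rw [smul_lie]; exact Submodule.smul_mem _ c (ha n u hu) }
  have : grade K A b 1 ≤ N := by
    refine grade_one_le (fun n u hu => lie_f_mem_lowerSpan hu b) fun j _ y hy n u hu => ?_
    rw [lie_lie]
    exact sub_mem (lowerSpan_le v (by omega) (lie_f_mem_lowerSpan (hy n u hu) j))
      (lowerSpan_le v (by omega) (hy _ _ (lie_f_mem_lowerSpan hu j)))
  exact this hy n u hu

variable [Fintype B] [CharZero K] {d : B → ℚ} {l : B → ℕ} {v : M}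

theorem IsIntegrableVector.exists_pow_eq_zero (hA : IsFiniteType A d)
    (hv : IsIntegrableVector (K := K) (A := A) l v) {b : B} {y : A.ToLieAlgebra K}
    (hy : y ∈ grade K A b 1) : ∃ n, (toEnd K (A.ToLieAlgebra K) M y ^ n) v = 0 := by
  obtain ⟨N, hN⟩ := hv.exists_lower_eq_zero hA
  have h1 : ∀ n, (toEnd K (A.ToLieAlgebra K) M y ^ n) v ∈ lowerSpan K A v n := by
    intro n
    induction n with
    | zero => exact lower_mem_lowerSpan v (w := []) le_rfl
    | succ n ih =>
      rw [pow_succ', Module.End.mul_apply]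
      exact lie_mem_lowerSpan hy ih
  have h2 : lowerSpan K A v (N + 1) = ⊥ := by
    refine Submodule.span_eq_bot.2 ?_
    rintro _ ⟨w, hw, rfl⟩
    exact hN w hw
  exact ⟨N + 1, by simpa [h2] using h1 (N + 1)⟩

omit [CharZero K] in
theorem IsIntegrableVector.lie_mem (hv : IsIntegrableVector (K := K) (A := A) l v)
    (x : A.ToLieAlgebra K) {u : M} (hu : u ∈ lowerSpan K A v 0) :
    ⁅x, u⁆ ∈ lowerSpan K A v 0 := by
  let S : LieSubalgebra K (A.ToLieAlgebra K) :=
    { carrier := {x | ∀ u ∈ lowerSpan K A v 0, ⁅x, u⁆ ∈ lowerSpan K A v 0}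
      zero_mem' := fun u _ => by rw [zero_lie]; exact zero_mem _
      add_mem' := fun ha hb u hu => by rw [add_lie]; exact add_mem (ha u hu) (hb u hu)
      smul_mem' := fun c _ ha u hu => by rw [smul_lie]; exact Submodule.smul_mem _ c (ha u hu)
      lie_mem' := fun ha hb u hu => by
        rw [lie_lie]; exact sub_mem (ha _ (hb u hu)) (hb _ (ha u hu)) }
  refine lieSubalgebra_eq_top (S := S) (fun i u hu => ?_) (fun i u hu => ?_) x u hu
  · have : lowerSpan K A v 0 ≤ (lowerSpan K A v 0).comap
        (toEnd K (A.ToLieAlgebra K) M (e K A i)) := by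
      refine Submodule.span_le.2 ?_
      rintro _ ⟨w, hw, rfl⟩
      have h1 := hv.lie_e_mem i (lower_mem_weightPart v w)
      exact (Submodule.span_mono fun _ ⟨w, _, h⟩ => ⟨w, Nat.zero_le _, h⟩ :
        weightPart K A v _ ≤ lowerSpan K A v 0) h1
    exact this hu
  · exact lowerSpan_le v (by omega) (lie_f_mem_lowerSpan hu i)

/-- The submodule generated by a highest weight vector. -/
def IsIntegrableVector.submodule (hv : IsIntegrableVector (K := K) (A := A) l v) :
    LieSubmodule K (A.ToLieAlgebra K) M :=
  { lowerSpan K A v 0 with lie_mem := fun hu => hv.lie_mem _ hu }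

theorem IsIntegrableVector.finiteDimensional (hA : IsFiniteType A d)
    (hv : IsIntegrableVector (K := K) (A := A) l v) : FiniteDimensional K hv.submodule := by
  obtain ⟨N, hN⟩ := hv.exists_lower_eq_zero hA
  have h1 : lowerSpan K A v 0 ≤
      Submodule.span K (lower K A v '' {w : List B | w.length ≤ N}) := by
    refine Submodule.span_le.2 ?_
    rintro _ ⟨w, -, rfl⟩
    rcases le_or_gt w.length N with h | h
    · exact Submodule.subset_span ⟨w, h, rfl⟩
    · rw [SetLike.mem_coe, hN w h]
      exact zero_mem _
  have : FiniteDimensional K (Submodule.span K (lower K A v '' {w : List B | w.length ≤ N})) :=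
    FiniteDimensional.span_of_finite K ((List.finite_length_le B N).image _)
  exact Submodule.finiteDimensional_of_le h1

/-- The generators `h i` have nonzero trace norm on a highest weight module of weight `l` with
`l i ≠ 0`. -/
theorem IsIntegrableVector.traceForm_ne_zero (hA : IsFiniteType A d)
    (hv : IsIntegrableVector (K := K) (A := A) l v) (hv0 : v ≠ 0) {i : B} (hi : l i ≠ 0) :
    traceForm K (A.ToLieAlgebra K) hv.submodule (h K A i) (h K A i) ≠ 0 := by
  classical
  have := hv.finiteDimensional hA
  let s : Set hv.submodule :=
    Set.range fun w : List B => ⟨lower K A v w, lower_mem_lowerSpan v (Nat.zero_le _)⟩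
  have hs : ⊤ ≤ Submodule.span K s := by
    rintro ⟨u, hu⟩ -
    change u ∈ lowerSpan K A v 0 at hu
    induction hu using Submodule.span_induction with
    | mem u hu =>
      obtain ⟨w, -, rfl⟩ := hu
      exact Submodule.subset_span ⟨w, rfl⟩
    | zero => exact zero_mem _
    | add x y hx hy ihx ihy => exact add_mem ihx ihy
    | smul c x hx ih => exact Submodule.smul_mem _ c ih
  -- A basis of lowered vectors makes `h i` diagonal with integer eigenvalues, so the trace of its
  -- square is a sum of squares. If that vanished, `h i` would act by zero, but its eigenvalue on v
  -- is l i ≠ 0.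
  let bs := Module.Basis.ofSpan hs
  have hbs : ∀ a, ∃ n : ℤ, ⁅h K A i, bs a⁆ = (n : K) • bs a := by
    intro a
    obtain ⟨w, hw⟩ := Module.Basis.ofSpan_subset hs ⟨a, rfl⟩
    refine ⟨l i - ∑ j, A i j * wt w j, ?_⟩
    change ⁅h K A i, Module.Basis.ofSpan hs a⁆ = _ • Module.Basis.ofSpan hs a
    rw [← hw]
    exact Subtype.ext (hv.lie_h_mem i (lower_mem_weightPart v w))
  choose n hn using hbs
  have := FiniteDimensional.fintypeBasisIndex bs
  rw [traceForm_apply_apply, LinearMap.trace_eq_matrix_trace K bs]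
  have h1 : Matrix.trace (LinearMap.toMatrix bs bs
      (toEnd K (A.ToLieAlgebra K) hv.submodule (h K A i) ∘ₗ
        toEnd K (A.ToLieAlgebra K) hv.submodule (h K A i))) = ((∑ a, n a ^ 2 : ℤ) : K) := by
    push_cast
    refine Finset.sum_congr rfl fun a _ => ?_
    rw [Matrix.diag_apply, LinearMap.toMatrix_apply, LinearMap.comp_apply, toEnd_apply_apply,
      toEnd_apply_apply, hn, lie_smul, hn]
    simp [sq]
  intro h0
  rw [h1, Int.cast_eq_zero, Finset.sum_eq_zero_iff_of_nonneg fun a _ => sq_nonneg _] at h0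
  have h2 : toEnd K (A.ToLieAlgebra K) hv.submodule (h K A i) = 0 := by
    refine bs.ext fun a => ?_
    have := pow_eq_zero_iff (two_ne_zero) |>.1 (h0 a (Finset.mem_univ a))
    rw [toEnd_apply_apply, hn, this]
    simp
  have h3 := LinearMap.congr_fun h2 ⟨v, lower_mem_lowerSpan v (w := []) le_rfl⟩
  have h4 : ⁅h K A i, v⁆ = 0 := congrArg Subtype.val h3
  rw [hv.lie_h, smul_eq_zero, Nat.cast_eq_zero] at h4
  exact h4.elim hi hv0

end CyclicModule

/-! ### Brackets of opposite root vectors -/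

section Proportional

variable {K : Type*} [Field K] {B : Type*} [DecidableEq B] {A : Matrix B B ℤ}

theorem e_lie_e_eq_zero {i j : B} (hij : A i j = 0) : ⁅e K A i, e K A j⁆ = 0 := by
  have := serre_e (K := K) (A := A) i j
  rw [hij] at this
  simpa using this

theorem f_lie_f_eq_zero {i j : B} (hij : A i j = 0) : ⁅f K A i, f K A j⁆ = 0 := by
  have := serre_f (K := K) (A := A) i j
  rw [hij] at this
  simpa using this

/-- The elements of degree `±1` commute with the generators of the components which do not contain
the node `b`. -/
theorem lie_eq_zero_of_disconnected {S : Set B} {b : B} (hb : b ∈ S)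
    (hS : ∀ i ∈ S, ∀ j ∉ S, A j i = 0) {x : A.ToLieAlgebra K}
    (hx : x ∈ grade K A b (-1) ∨ x ∈ grade K A b 1) {j : B} (hj : j ∉ S) :
    ⁅e K A j, x⁆ = 0 ∧ ⁅f K A j, x⁆ = 0 := by
  let N : Submodule K (A.ToLieAlgebra K) :=
    { carrier := {x | ∀ j ∉ S, ⁅e K A j, x⁆ = 0 ∧ ⁅f K A j, x⁆ = 0}
      zero_mem' := fun j _ => by simp
      add_mem' := fun ha hb j hj => by simp [ha j hj, hb j hj]
      smul_mem' := fun c _ ha j hj => by simp [ha j hj] }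
  have hne : ∀ i ∈ S, ∀ j ∉ S, j ≠ i := fun i hi j hj h => hj (h ▸ hi)
  have hef : ∀ i ∈ S, ∀ j ∉ S, ⁅e K A j, f K A i⁆ = 0 := fun i hi j hj => e_lie_f_ne (hne i hi j hj)
  have hfe : ∀ i ∈ S, ∀ j ∉ S, ⁅f K A j, e K A i⁆ = 0 := fun i hi j hj => by
    rw [← lie_skew, e_lie_f_ne (hne i hi j hj).symm, neg_zero]
  have hee : ∀ i ∈ S, ∀ j ∉ S, ⁅e K A j, e K A i⁆ = 0 := fun i hi j hj =>
    e_lie_e_eq_zero (hS i hi j hj)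
  have hff : ∀ i ∈ S, ∀ j ∉ S, ⁅f K A j, f K A i⁆ = 0 := fun i hi j hj =>
    f_lie_f_eq_zero (hS i hi j hj)
  have h1 : grade K A b (-1) ≤ N := by
    refine grade_neg_one_le (fun j hj => ⟨hee b hb j hj, hfe b hb j hj⟩) fun k _ y hy j hj => ?_
    by_cases hk : k ∈ S
    · rw [leibniz_lie, leibniz_lie (f K A j), hee k hk j hj, hfe k hk j hj, (hy j hj).1,
        (hy j hj).2]
      simp
    · rw [(hy k hk).1]
      simp
  have h2 : grade K A b 1 ≤ N := by
    refine grade_one_le (fun j hj => ⟨hef b hb j hj, hff b hb j hj⟩) fun k _ y hy j hj => ?_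
    by_cases hk : k ∈ S
    · rw [leibniz_lie, leibniz_lie (f K A j), hef k hk j hj, hff k hk j hj, (hy j hj).1,
        (hy j hj).2]
      simp
    · rw [(hy k hk).2]
      simp
  exact hx.elim (fun hx => h1 hx j hj) (fun hx => h2 hx j hj)

variable [Fintype B] [CharZero K] {d : B → ℚ}
  {M : Type*} [AddCommGroup M] [Module K M] [LieRingModule (A.ToLieAlgebra K) M]
  [LieModule K (A.ToLieAlgebra K) M] {l : B → ℕ} {v : M}

/-- The bracket of root vectors of opposite roots is a multiple of the dual element. -/
theorem IsIntegrableVector.exists_lie_eq_smul (hA : IsFiniteType A d)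
    (hv : IsIntegrableVector (K := K) (A := A) l v) (hv0 : v ≠ 0) {b : B} (hlb : l b ≠ 0)
    {μ : B → ℤ} (hμ : μ b = 1) {x y : A.ToLieAlgebra K} (hx : x ∈ rootSpace K A μ)
    (hy : y ∈ rootSpace K A (-μ)) : ∃ c : K, ⁅x, y⁆ = c • dualElement K A d b μ := by
  by_cases hx0 : x = 0
  · exact ⟨0, by simp [hx0]⟩
  set κ := traceForm K (A.ToLieAlgebra K) hv.submodule with hκ
  set k : B → K := fun i => κ (e K A i) (f K A i) with hk
  -- By invariance, the numbers k i = κ(e_i, f_i) determine κ on the Cartan subalgebra, and its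
  -- symmetry makes k symmetrize A.
  have hhh : ∀ i j, κ (h K A i) (h K A j) = A j i * k i := by
    intro i j
    rw [← e_lie_f_same i, hκ, traceForm_apply_lie_apply, ← lie_skew (f K A i), h_lie_f, neg_neg,
      ← Int.cast_smul_eq_zsmul K, map_smul, smul_eq_mul]
  have hsymm : ∀ i j, (A j i : K) * k i = A i j * k j := fun i j => by
    rw [← hhh, ← hhh, hκ, traceForm_comm]
  have hkb : k b ≠ 0 := fun h0 => by
    have h1 := hhh b b
    rw [h0, mul_zero] at h1
    exact hv.traceForm_ne_zero hA hv0 hlb h1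
  have hd : ∀ i, ((d i : ℚ) : K) ≠ 0 := fun i => Rat.cast_ne_zero.2 (hA.pos i).ne'
  have hdsymm : ∀ i j, (d i : K) * A i j = d j * A j i := fun i j => by
    exact_mod_cast congrArg (Rat.cast : ℚ → K) (hA.symm i j)
  -- On S the trace form is a nonzero multiple of the normalized form. As both k and d symmetrize A,
  -- no edge leaves S. Off S the numbers k i may vanish, so there the coefficients are handled by
  -- commutation instead.
  let S : Set B := {i | k i * d i = k b * d b}
  have hbS : b ∈ S := rfl
  have hS' : ∀ i ∈ S, ∀ j ∉ S, A i j = 0 := by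
    intro i hi j hj
    by_contra h0
    refine hj ?_
    have h1 : (A i j : K) ≠ 0 := Int.cast_ne_zero.2 h0
    change k j * d j = k b * d b
    rw [← show k i * d i = k b * d b from hi]
    refine mul_left_cancel₀ h1 ?_
    linear_combination (-(d j : K)) * hsymm i j - k i * hdsymm i j
  have hS : ∀ i ∈ S, ∀ j ∉ S, A j i = 0 := fun i hi j hj => hA.isGCM.zero _ _ (hS' i hi j hj)
  have hxg : x ∈ grade K A b (-1) := mem_grade (by simp [hμ]) hx
  have hyg : y ∈ grade K A b 1 := mem_grade (by simp [hμ]) hy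
  have hxy : ⁅x, y⁆ ∈ cartan K A := rootSpace_zero_le (by simpa using lie_mem_rootSpace hx hy)
  obtain ⟨c, hc⟩ := (Submodule.mem_span_range_iff_exists_fun K).1 hxy
  -- Computing κ([x, y], h_j) by invariance and by expansion in the coroots gives a linear system
  -- with the invertible matrix A.
  have hck : ∀ i, c i * k i = κ x y * μ i := by
    intro i
    refine sub_eq_zero.1 (hA.eq_zero_of_mulVec (x := fun i => c i * k i - κ x y * μ i)
      (fun j => ?_) i)
    have h1 : κ ⁅x, y⁆ (h K A j) = ((∑ i, A j i * μ i : ℤ) : K) * κ x y := by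
      rw [hκ, traceForm_apply_lie_apply, ← lie_skew y, lie_h_of_mem_rootSpace j hy, ← neg_smul,
        map_smul, smul_eq_mul]
      simp
    have h2 : κ ⁅x, y⁆ (h K A j) = ∑ i, c i * (A j i * k i) := by
      rw [← hc, map_sum, LinearMap.sum_apply]
      simp [hhh]
    rw [h2] at h1
    push_cast at h1
    rw [Finset.sum_mul] at h1
    rw [← sub_eq_zero, ← Finset.sum_sub_distrib] at h1
    rw [← h1]
    exact Finset.sum_congr rfl fun i _ => by ring
  classical
  -- The coroots off S annihilate x, so the part of μ off S lies in the kernel of A.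
  have hμS : ∀ i ∉ S, μ i = 0 := by
    intro i hi
    have := hA.eq_zero_of_mulVec (K := K) (x := fun i => if i ∈ S then 0 else (μ i : K))
      (fun j => ?_) i
    · simpa [hi] using this
    by_cases hj : j ∈ S
    · refine Finset.sum_eq_zero fun i _ => ?_
      by_cases hi : i ∈ S
      · simp [hi]
      · simp [hS' j hj i hi]
    · have h1 := lie_eq_zero_of_disconnected hbS hS (Or.inl hxg) hj
      have h2 : ⁅h K A j, x⁆ = 0 := by
        rw [← e_lie_f_same, lie_lie, h1.1, h1.2]
        simp
      rw [lie_h_of_mem_rootSpace j hx, smul_eq_zero, or_iff_left hx0] at h2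
      push_cast at h2
      rw [← h2]
      refine Finset.sum_congr rfl fun i _ => ?_
      by_cases hi : i ∈ S
      · simp [hS i hi j hj]
      · simp [hi]
  -- Likewise [x, y] commutes with the `e j` off S, so the part of c off S lies in the kernel of the
  -- transpose of A.
  have hcS : ∀ i ∉ S, c i = 0 := by
    intro i hi
    have := hA.eq_zero_of_vecMul (K := K) (x := fun i => if i ∈ S then 0 else c i)
      (fun j => ?_) i
    · simpa [hi] using this
    by_cases hj : j ∈ S
    · refine Finset.sum_eq_zero fun i _ => ?_
      by_cases hi : i ∈ S
      · simp [hi]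
      · simp [hS j hj i hi]
    · have h2 : ⁅⁅x, y⁆, e K A j⁆ = 0 := by
        rw [lie_lie, ← lie_skew y (e K A j), ← lie_skew x (e K A j),
          (lie_eq_zero_of_disconnected hbS hS (Or.inl hxg) hj).1,
          (lie_eq_zero_of_disconnected hbS hS (Or.inr hyg) hj).1]
        simp
      have h3 : ⁅⁅x, y⁆, e K A j⁆ = (∑ i, A i j * c i) • e K A j := by
        rw [← hc, sum_lie, Finset.sum_smul]
        refine Finset.sum_congr rfl fun i _ => ?_
        rw [smul_lie, h_lie_e, ← Int.cast_smul_eq_zsmul K, smul_smul, mul_comm]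
      rw [h3, smul_eq_zero, or_iff_left (e_ne_zero hA.isGCM j)] at h2
      rw [← h2]
      refine Finset.sum_congr rfl fun i _ => ?_
      by_cases hi : i ∈ S
      · simp [hS' i hi j hj]
      · simp [hi]
  -- The factor is the coefficient at b, because `dualElement` has coefficient μ b = 1 there.
  refine ⟨c b, ?_⟩
  rw [← hc, dualElement, Finset.smul_sum]
  refine Finset.sum_congr rfl fun i _ => ?_
  rw [smul_smul]
  congr 1
  by_cases hi : i ∈ S
  · have h1 := hck i
    have h2 := hck b
    have h3 : k i * d i = k b * d b := hi
    rw [hμ] at h2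
    push_cast at h2 ⊢
    have h4 := hd b
    field_simp
    refine mul_left_cancel₀ hkb ?_
    linear_combination (d i : K) * h1 - c i * h3 - (μ i : K) * (d i : K) * h2
  · simp [hcS i hi, hμS i hi]

end Proportional

/-! ### The extended Cartan matrix -/

section ExtensionMatrix

variable {B : Type*} [DecidableEq B] {A : Matrix B B ℤ} {b : B} {p : ℕ}

theorem extend_inl_inr (i : Fin (p + 1)) (j : B) :
    extend A b (p + 1) (.inl i) (.inr j) = if i = Fin.last p ∧ j = b then -1 else 0 := by
  simp [extend, Fin.ext_iff]

theorem extend_inr_inl (i : B) (j : Fin (p + 1)) :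
    extend A b (p + 1) (.inr i) (.inl j) = if j = Fin.last p ∧ i = b then -1 else 0 := by
  simp [extend, Fin.ext_iff]

theorem extend_inr_inr (i j : B) : extend A b (p + 1) (.inr i) (.inr j) = A i j := rfl

theorem extend_inl_inl (i j : Fin (p + 1)) :
    extend A b (p + 1) (.inl i) (.inl j) =
      if i = j then 2 else if i.val + 1 = j.val ∨ j.val + 1 = i.val then -1 else 0 := rfl

/-- The extended matrix need not be of finite type. These weaker conditions suffice for the modules
on words, hence for the independence of its coroots. -/
theorem IsGCM.extend (hA : IsGCM A) : IsGCM (extend A b (p + 1)) where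
  diag
    | .inl i => by simp [extend_inl_inl]
    | .inr i => hA.diag i
  offDiag
    | .inl i, .inl j, hij => by
        rw [extend_inl_inl, if_neg fun h => hij (congrArg _ h)]
        split_ifs <;> omega
    | .inl i, .inr j, _ => by rw [extend_inl_inr]; split_ifs <;> omega
    | .inr i, .inl j, _ => by rw [extend_inr_inl]; split_ifs <;> omega
    | .inr i, .inr j, hij => hA.offDiag i j fun h => hij (congrArg _ h)
  zero
    | .inl i, .inl j, h => by
        rw [extend_inl_inl] at h ⊢
        simpa only [eq_comm (a := j), or_comm (a := j.val + 1 = i.val)] using h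
    | .inl i, .inr j, h => by rw [extend_inl_inr] at h; rw [extend_inr_inl]; exact h
    | .inr i, .inl j, h => by rw [extend_inr_inl] at h; rw [extend_inl_inr]; exact h
    | .inr i, .inr j, h => hA.zero i j h

end ExtensionMatrix

/-! ### Graded involutions and the degree 0 part modulo brackets -/

section Involutions

variable {K : Type*} [Field K] {B : Type*} [DecidableEq B] {A : Matrix B B ℤ} {b : B}

theorem chevalleyInvolution_mem_rootSpace {μ : B → ℤ} {x : A.ToLieAlgebra K}
    (hx : x ∈ rootSpace K A μ) : chevalleyInvolution K A x ∈ rootSpace K A (-μ) := by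
  suffices h : rootSpace K A μ ≤
      (rootSpace K A (-μ)).comap (chevalleyInvolution K A : A.ToLieAlgebra K →ₗ[K] _) from h hx
  · clear hx
    refine Submodule.span_le.2 fun x hx => ?_
    change IsMonomial K A μ x at hx
    change chevalleyInvolution K A x ∈ rootSpace K A (-μ)
    induction hx with
    | e i => rw [chevalleyInvolution_e]; exact neg_mem (f_mem_rootSpace i)
    | f i => rw [chevalleyInvolution_f, neg_neg]; exact neg_mem (e_mem_rootSpace i)
    | h i => rw [chevalleyInvolution_h, neg_zero]; exact neg_mem (h_mem_rootSpace i)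
    | lie _ _ hx hy => rw [LieHom.map_lie, neg_add]; exact lie_mem_rootSpace hx hy

theorem chevalleyInvolution_mem_grade {k : ℤ} {x : A.ToLieAlgebra K} (hx : x ∈ grade K A b k) :
    chevalleyInvolution K A x ∈ grade K A b (-k) := by
  have : grade K A b k ≤
      (grade K A b (-k)).comap (chevalleyInvolution K A : A.ToLieAlgebra K →ₗ[K] _) :=
    grade_le fun μ hμ y hy =>
      mem_grade (by rw [Pi.neg_apply, hμ]) (chevalleyInvolution_mem_rootSpace hy)
  exact this hx

/-- The conjugate of a graded involution by the Chevalley involution. -/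
def GradedInvolution.conj (τ : GradedInvolution K A b) : GradedInvolution K A b where
  toHom := (chevalleyInvolution K A).comp (τ.toHom.comp (chevalleyInvolution K A))
  involutive x := by simp [τ.involutive]
  graded k x hx := by
    have := chevalleyInvolution_mem_grade (τ.graded _ _ (chevalleyInvolution_mem_grade hx))
    simpa using this

theorem GradedInvolution.conj_apply (τ : GradedInvolution K A b) (x : A.ToLieAlgebra K) :
    τ.conj.toHom x = chevalleyInvolution K A (τ.toHom (chevalleyInvolution K A x)) := rfl

variable (K A b) in
/-- The span of the brackets of elements of degree `0`. -/
def derivedZero : Submodule K (A.ToLieAlgebra K) :=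
  Submodule.span K {z | ∃ x ∈ grade K A b 0, ∃ y ∈ grade K A b 0, z = ⁅x, y⁆}

theorem lie_mem_derivedZero {x y : A.ToLieAlgebra K} (hx : x ∈ grade K A b 0)
    (hy : y ∈ grade K A b 0) : ⁅x, y⁆ ∈ derivedZero K A b :=
  Submodule.subset_span ⟨x, hx, y, hy, rfl⟩

theorem derivedZero_le : derivedZero K A b ≤ grade K A b 0 := by
  refine Submodule.span_le.2 ?_
  rintro _ ⟨x, hx, y, hy, rfl⟩
  simpa using lie_mem_grade hx hy

theorem map_mem_derivedZero {g : A.ToLieAlgebra K →ₗ⁅K⁆ A.ToLieAlgebra K}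
    (hg : ∀ k, ∀ x ∈ grade K A b k, g x ∈ grade K A b (-k)) {x : A.ToLieAlgebra K}
    (hx : x ∈ derivedZero K A b) : g x ∈ derivedZero K A b := by
  have : derivedZero K A b ≤ (derivedZero K A b).comap (g : A.ToLieAlgebra K →ₗ[K] _) := by
    refine Submodule.span_le.2 ?_
    rintro _ ⟨x, hx, y, hy, rfl⟩
    change g ⁅x, y⁆ ∈ derivedZero K A b
    rw [LieHom.map_lie]
    exact lie_mem_derivedZero (by simpa using hg 0 x hx) (by simpa using hg 0 y hy)
  exact this hx

theorem h_mem_derivedZero {i : B} (hi : i ≠ b) : h K A i ∈ derivedZero K A b := by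
  rw [← e_lie_f_same]
  exact lie_mem_derivedZero (e_mem_grade_zero hi) (f_mem_grade_zero hi)

variable [CharZero K]

theorem e_mem_derivedZero (hA : IsGCM A) {i : B} (hi : i ≠ b) : e K A i ∈ derivedZero K A b := by
  have h1 := lie_mem_derivedZero (h_mem_grade b i) (e_mem_grade_zero (K := K) (A := A) hi)
  rw [h_lie_e, hA.diag, ← Int.cast_smul_eq_zsmul K] at h1
  exact (Submodule.smul_mem_iff _ (by norm_num)).1 h1

theorem f_mem_derivedZero (hA : IsGCM A) {i : B} (hi : i ≠ b) : f K A i ∈ derivedZero K A b := by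
  have h1 := lie_mem_derivedZero (h_mem_grade b i) (f_mem_grade_zero (K := K) (A := A) hi)
  rw [h_lie_f, hA.diag, ← Int.cast_smul_eq_zsmul K, ← neg_smul] at h1
  exact (Submodule.smul_mem_iff _ (by norm_num)).1 h1

theorem rootSpace_le_derivedZero (hA : IsGCM A) {μ : B → ℤ} (hμ : μ b = 0) (h0 : μ ≠ 0) :
    rootSpace K A μ ≤ derivedZero K A b :=
  rootSpace_le_of_eq_zero hμ h0
    (fun w _ hw => nested_mem_of_wt_eq_zero (fun _ hj => e_mem_derivedZero hA hj)
      (fun _ hj _ hy => lie_mem_derivedZero (e_mem_grade_zero hj) (derivedZero_le hy)) w hw)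
    (fun w _ hw => nested_mem_of_wt_eq_zero (fun _ hj => f_mem_derivedZero hA hj)
      (fun _ hj _ hy => lie_mem_derivedZero (f_mem_grade_zero hj) (derivedZero_le hy)) w hw)

/-- Each coroot other than `h b` and each root vector of degree 0 is a sum of brackets in degree 0.
Thus a character of the degree 0 part is determined by its value at `h b`. -/
theorem exists_eq_smul_h_add (hA : IsGCM A) {x : A.ToLieAlgebra K} (hx : x ∈ grade K A b 0) :
    ∃ a : K, ∃ w ∈ derivedZero K A b, x = a • h K A b + w := by
  have : grade K A b 0 ≤ Submodule.span K {h K A b} ⊔ derivedZero K A b := by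
    refine grade_le fun μ hμ => ?_
    by_cases h0 : μ = 0
    · subst h0
      refine rootSpace_zero_le.trans (Submodule.span_le.2 ?_)
      rintro _ ⟨i, rfl⟩
      by_cases hi : i = b
      · subst hi
        exact Submodule.mem_sup_left (Submodule.mem_span_singleton_self _)
      · exact Submodule.mem_sup_right (h_mem_derivedZero hi)
    · exact (rootSpace_le_derivedZero hA (by simpa using hμ) h0).trans le_sup_right
  obtain ⟨y, hy, w, hw, rfl⟩ := Submodule.mem_sup.1 (this hx)
  obtain ⟨a, rfl⟩ := Submodule.mem_span_singleton.1 hy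
  exact ⟨a, w, hw, rfl⟩

end Involutions

/-! ### Brackets of the attached nodes with the image of 𝔥 -/

section Inclusion

variable {K : Type*} [Field K] {B : Type*} [DecidableEq B] {A : Matrix B B ℤ} {b : B} {p : ℕ}

theorem incl_mem_rootSpace {μ : B → ℤ} {x : A.ToLieAlgebra K} (hx : x ∈ rootSpace K A μ) :
    incl K A b p x ∈ rootSpace K (extend A b p) (Sum.elim 0 μ) := by
  suffices h : rootSpace K A μ ≤ (rootSpace K (extend A b p) (Sum.elim 0 μ)).comap
      (incl K A b p : A.ToLieAlgebra K →ₗ[K] _) from h hx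
  · clear hx
    refine Submodule.span_le.2 fun x hx => ?_
    change IsMonomial K A μ x at hx
    change incl K A b p x ∈ rootSpace K (extend A b p) (Sum.elim 0 μ)
    have hs : ∀ i : B, (Sum.elim 0 (Pi.single i 1) : Fin p ⊕ B → ℤ) = Pi.single (.inr i) 1 := by
      intro i
      ext (j | j)
      · simp
      · by_cases hij : j = i
        · subst hij; simp
        · simp [hij]
    have hadd : ∀ μ ν : B → ℤ, (Sum.elim 0 (μ + ν) : Fin p ⊕ B → ℤ) =
        (Sum.elim 0 μ : Fin p ⊕ B → ℤ) + (Sum.elim 0 ν : Fin p ⊕ B → ℤ) := by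
      intro μ ν
      ext (j | j) <;> simp
    have hneg : ∀ μ : B → ℤ, (Sum.elim 0 (-μ) : Fin p ⊕ B → ℤ) = -(Sum.elim 0 μ : Fin p ⊕ B → ℤ) := by
      intro μ
      ext (j | j) <;> simp
    have hzero : (Sum.elim 0 0 : Fin p ⊕ B → ℤ) = 0 := by
      ext (j | j) <;> simp
    induction hx with
    | e i => rw [incl_e, hs]; exact e_mem_rootSpace _
    | f i => rw [incl_f, hneg, hs]; exact f_mem_rootSpace _
    | h i => rw [incl_h, hzero]; exact h_mem_rootSpace _
    | lie _ _ hx hy => rw [LieHom.map_lie, hadd]; exact lie_mem_rootSpace hx hy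

theorem incl_mem_grade {k : ℤ} {x : A.ToLieAlgebra K} (hx : x ∈ grade K A b k) :
    incl K A b p x ∈ grade K (extend A b p) (.inr b) k := by
  have : grade K A b k ≤ (grade K (extend A b p) (.inr b) k).comap
      (incl K A b p : A.ToLieAlgebra K →ₗ[K] _) :=
    grade_le fun μ hμ y hy => mem_grade (b := Sum.inr b) (μ := Sum.elim 0 μ) hμ (incl_mem_rootSpace hy)
  exact this hx

theorem chevalleyInvolution_incl (x : A.ToLieAlgebra K) :
    chevalleyInvolution K (extend A b p) (incl K A b p x) =
      incl K A b p (chevalleyInvolution K A x) := by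
  have : (chevalleyInvolution K (extend A b p)).comp (incl K A b p) =
      (incl K A b p).comp (chevalleyInvolution K A) := hom_ext (by simp) (by simp)
  exact LieHom.congr_fun this x

variable (K A b p) in
/-- The simple root vector `e_i` of the attached node which is adjacent to `b`. -/
abbrev endE : (extend A b (p + 1)).ToLieAlgebra K := e K (extend A b (p + 1)) (.inl (Fin.last p))

variable (K A b p) in
/-- The simple root vector `f_i` of the attached node which is adjacent to `b`. -/
abbrev endF : (extend A b (p + 1)).ToLieAlgebra K := f K (extend A b (p + 1)) (.inl (Fin.last p))

theorem lie_incl_eq_zero {y : (extend A b p).ToLieAlgebra K}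
    (he : ∀ j, ⁅y, e K (extend A b p) (.inr j)⁆ = 0)
    (hf : ∀ j, ⁅y, f K (extend A b p) (.inr j)⁆ = 0) (x : A.ToLieAlgebra K) :
    ⁅y, incl K A b p x⁆ = 0 := by
  let S : LieSubalgebra K (A.ToLieAlgebra K) :=
    { LinearMap.ker (LieAlgebra.ad K ((extend A b p).ToLieAlgebra K) y ∘ₗ
        (incl K A b p : A.ToLieAlgebra K →ₗ[K] (extend A b p).ToLieAlgebra K)) with
      lie_mem' := by
        intro u v (hu : ⁅y, incl K A b p u⁆ = 0) (hv : ⁅y, incl K A b p v⁆ = 0)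
        change ⁅y, incl K A b p ⁅u, v⁆⁆ = 0
        rw [LieHom.map_lie, leibniz_lie, hu, hv, lie_zero, zero_lie, add_zero] }
  refine lieSubalgebra_eq_top (S := S) (fun j => ?_) (fun j => ?_) x
  · change ⁅y, incl K A b p (e K A j)⁆ = 0
    rw [incl_e, he]
  · change ⁅y, incl K A b p (f K A j)⁆ = 0
    rw [incl_f, hf]

theorem inl_e_lie_incl {i : Fin (p + 1)} (hi : i ≠ Fin.last p) (x : A.ToLieAlgebra K) :
    ⁅e K (extend A b (p + 1)) (.inl i), incl K A b (p + 1) x⁆ = 0 :=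
  lie_incl_eq_zero (fun j => e_lie_e_eq_zero (by rw [extend_inl_inr, if_neg (by simp [hi])]))
    (fun j => e_lie_f_ne (by simp)) x

theorem inl_f_lie_incl {i : Fin (p + 1)} (hi : i ≠ Fin.last p) (x : A.ToLieAlgebra K) :
    ⁅f K (extend A b (p + 1)) (.inl i), incl K A b (p + 1) x⁆ = 0 :=
  lie_incl_eq_zero
    (fun j => by rw [← lie_skew, e_lie_f_ne (by simp), neg_zero])
    (fun j => f_lie_f_eq_zero (by rw [extend_inl_inr, if_neg (by simp [hi])])) x

theorem inl_h_lie_incl [Fintype B] (i : Fin (p + 1)) {k : ℤ} {x : A.ToLieAlgebra K}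
    (hx : x ∈ grade K A b k) :
    ⁅h K (extend A b (p + 1)) (.inl i), incl K A b (p + 1) x⁆ =
      (if i = Fin.last p then (k : K) else 0) • incl K A b (p + 1) x := by
  have h2 : ∀ μ : B → ℤ, μ b = -k → ∑ j, extend A b (p + 1) (.inl i) j *
      (Sum.elim 0 μ : Fin (p + 1) ⊕ B → ℤ) j = if i = Fin.last p then k else 0 := by
    intro μ hμ
    rw [Fintype.sum_sum_type]
    by_cases hi : i = Fin.last p <;> simp [extend_inl_inr, hi, hμ]
  have h3 : ((if i = Fin.last p then k else 0 : ℤ) : K) =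
      if i = Fin.last p then (k : K) else 0 := by
    split_ifs <;> simp
  rw [← h3]
  generalize (if i = Fin.last p then k else 0) = a at h2
  let N : Submodule K (A.ToLieAlgebra K) :=
    LinearMap.ker ((LieAlgebra.ad K _ (h K (extend A b (p + 1)) (.inl i)) -
      (a : K) • LinearMap.id) ∘ₗ (incl K A b (p + 1) : A.ToLieAlgebra K →ₗ[K] _))
  have : grade K A b k ≤ N := by
    refine grade_le fun μ hμ x hx => ?_
    have h1 := lie_h_of_mem_rootSpace (.inl i) (incl_mem_rootSpace (b := b) (p := p + 1) hx)
    rw [h2 μ hμ] at h1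
    simp [N, h1]
  have h4 : x ∈ N := this hx
  simpa [N, sub_eq_zero] using h4

theorem endF_lie_incl {x : A.ToLieAlgebra K} (hx : x ∈ grade K A b (-1)) :
    ⁅endF K A b p, incl K A b (p + 1) x⁆ = 0 := by
  let N : Submodule K (A.ToLieAlgebra K) :=
    LinearMap.ker (LieAlgebra.ad K _ (endF K A b p) ∘ₗ
        (incl K A b (p + 1) : A.ToLieAlgebra K →ₗ[K] _))
  have hfe : ∀ j, ⁅endF K A b p, e K (extend A b (p + 1)) (.inr j)⁆ = 0 := fun j => by
    rw [← lie_skew, e_lie_f_ne (by simp), neg_zero]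
  have : grade K A b (-1) ≤ N := by
    refine grade_neg_one_le (by simp [N, hfe]) fun j _ y hy => ?_
    have hy : ⁅endF K A b p, incl K A b (p + 1) y⁆ = 0 := hy
    change ⁅endF K A b p, incl K A b (p + 1) ⁅e K A j, y⁆⁆ = 0
    rw [LieHom.map_lie, leibniz_lie, hy, incl_e, hfe, zero_lie, lie_zero, add_zero]
  exact this hx

/-- The Serre relation between the adjacent node and b gives the case of `f b`; the other `f j`
commute with `endF`. -/
theorem endF_lie_endF_lie_incl {y : A.ToLieAlgebra K} (hy : y ∈ grade K A b 1) :
    ⁅endF K A b p, ⁅endF K A b p, incl K A b (p + 1) y⁆⁆ = 0 := by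
  let N : Submodule K (A.ToLieAlgebra K) :=
    LinearMap.ker (LieAlgebra.ad K _ (endF K A b p) ∘ₗ LieAlgebra.ad K _ (endF K A b p) ∘ₗ
        (incl K A b (p + 1) : A.ToLieAlgebra K →ₗ[K] _))
  have : grade K A b 1 ≤ N := by
    refine grade_one_le ?_ fun j hj y hy => ?_
    · change ⁅endF K A b p, ⁅endF K A b p, incl K A b (p + 1) (f K A b)⁆⁆ = 0
      have := serre_f (K := K) (A := extend A b (p + 1)) (.inl (Fin.last p)) (.inr b)
      rw [extend_inl_inr] at this
      simpa using this
    · have hy : ⁅endF K A b p, ⁅endF K A b p, incl K A b (p + 1) y⁆⁆ = 0 := hy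
      have hff : ⁅endF K A b p, f K (extend A b (p + 1)) (.inr j)⁆ = 0 :=
        f_lie_f_eq_zero (by rw [extend_inl_inr, if_neg (by simp [hj])])
      change ⁅endF K A b p, ⁅endF K A b p, incl K A b (p + 1) ⁅f K A j, y⁆⁆⁆ = 0
      rw [LieHom.map_lie, leibniz_lie (endF K A b p) (incl K A b (p + 1) (f K A j)), incl_f, hff,
        zero_lie, zero_add,
        leibniz_lie (endF K A b p) (f K (extend A b (p + 1)) (.inr j)), hff,
        zero_lie, zero_add, hy, lie_zero]
  exact this hy

theorem endE_lie_endE_lie_incl {x : A.ToLieAlgebra K} (hx : x ∈ grade K A b (-1)) :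
    ⁅endE K A b p, ⁅endE K A b p, incl K A b (p + 1) x⁆⁆ = 0 := by
  have h1 := endF_lie_endF_lie_incl (p := p) (by simpa using chevalleyInvolution_mem_grade hx)
  have h2 := congrArg (chevalleyInvolution K (extend A b (p + 1))) h1
  rw [LieHom.map_lie, LieHom.map_lie, ← chevalleyInvolution_incl, chevalleyInvolution_apply_apply,
    chevalleyInvolution_f, neg_lie, neg_lie, lie_neg, neg_neg, map_zero] at h2
  exact h2

theorem h_lie_endF : ⁅h K (extend A b (p + 1)) (.inr b), endF K A b p⁆ = endF K A b p := by
  rw [h_lie_f, extend_inr_inl]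
  simp

theorem h_lie_endE : ⁅h K (extend A b (p + 1)) (.inr b), endE K A b p⁆ = -endE K A b p := by
  rw [h_lie_e, extend_inr_inl]
  simp

/-- The line of `endF` is preserved in degree 0: the coroots act diagonally, all `e j` kill it as
simple root vectors of a different node, and the `f j` with j ≠ b kill it as b is the only neighbour
in 𝔥. -/
theorem exists_incl_lie_endF {x : A.ToLieAlgebra K} (hx : x ∈ grade K A b 0) :
    ∃ a : K, ⁅incl K A b (p + 1) x, endF K A b p⁆ = a • endF K A b p := by
  let N : Submodule K (A.ToLieAlgebra K) :=
    { carrier := {x | ∃ a : K, ⁅incl K A b (p + 1) x, endF K A b p⁆ = a • endF K A b p}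
      zero_mem' := ⟨0, by simp⟩
      add_mem' := fun ⟨a, ha⟩ ⟨c, hc⟩ => ⟨a + c, by rw [map_add, add_lie, ha, hc, add_smul]⟩
      smul_mem' := fun c _ ⟨a, ha⟩ => ⟨c * a, by rw [map_smul, smul_lie, ha, mul_smul]⟩ }
  have he : ∀ j, ⁅e K (extend A b (p + 1)) (.inr j), endF K A b p⁆ = 0 := fun j =>
    e_lie_f_ne (by simp)
  have hf : ∀ j ≠ b, ⁅f K (extend A b (p + 1)) (.inr j), endF K A b p⁆ = 0 := fun j hj =>
    f_lie_f_eq_zero (by rw [extend_inr_inl, if_neg (by simp [hj])])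
  have : grade K A b 0 ≤ N := by
    refine grade_le fun μ hμ => ?_
    by_cases h0 : μ = 0
    · subst h0
      refine rootSpace_zero_le.trans (Submodule.span_le.2 ?_)
      rintro _ ⟨i, rfl⟩
      exact ⟨-(extend A b (p + 1) (.inr i) (.inl (Fin.last p)) : ℤ), by
        rw [incl_h, h_lie_f, neg_smul, Int.cast_smul_eq_zsmul]⟩
    · refine rootSpace_le_of_eq_zero (by simpa using hμ) h0
        (fun w _ hw => nested_mem_of_wt_eq_zero (N := N) (fun j _ => ⟨0, by simp [he]⟩) ?_ w hw)
        (fun w _ hw => nested_mem_of_wt_eq_zero (N := N) (fun j hj => ⟨0, by simp [hf j hj]⟩) ?_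
          w hw)
      · rintro j - y ⟨a, ha⟩
        exact ⟨0, by rw [LieHom.map_lie, lie_lie, ha, incl_e, lie_smul, he]; simp⟩
      · rintro j hj y ⟨a, ha⟩
        exact ⟨0, by rw [LieHom.map_lie, lie_lie, ha, incl_f, lie_smul, hf j hj]; simp⟩
  exact this hx

theorem incl_lie_endF_eq_zero {x : A.ToLieAlgebra K} (hx : x ∈ derivedZero K A b) :
    ⁅incl K A b (p + 1) x, endF K A b p⁆ = 0 := by
  induction hx using Submodule.span_induction with
  | mem z hz =>
    obtain ⟨x, hx, y, hy, rfl⟩ := hz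
    obtain ⟨a, ha⟩ := exists_incl_lie_endF (p := p) hx
    obtain ⟨c, hc⟩ := exists_incl_lie_endF (p := p) hy
    rw [LieHom.map_lie, lie_lie, ha, hc, lie_smul, lie_smul, ha, hc, smul_comm, sub_self]
  | zero => simp
  | add x y _ _ hx hy => rw [map_add, add_lie, hx, hy, add_zero]
  | smul c x _ hx => rw [map_smul, smul_lie, hx, smul_zero]

theorem incl_lie_endE_eq_zero {x : A.ToLieAlgebra K} (hx : x ∈ derivedZero K A b) :
    ⁅incl K A b (p + 1) x, endE K A b p⁆ = 0 := by
  have h1 := incl_lie_endF_eq_zero (p := p)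
    (map_mem_derivedZero (fun k x hx => chevalleyInvolution_mem_grade hx) hx)
  have h2 := congrArg (chevalleyInvolution K (extend A b (p + 1))) h1
  rw [LieHom.map_lie, ← chevalleyInvolution_incl, chevalleyInvolution_apply_apply,
    chevalleyInvolution_f, lie_neg, map_zero, neg_eq_zero] at h2
  exact h2

end Inclusion

/-! ### The highest weight module generated by the adjacent node -/

section EndNode

variable {K : Type*} [Field K] {B : Type*} [DecidableEq B] {A : Matrix B B ℤ} {b : B} {p : ℕ}

variable (K A b p) in
/-- The action of the Kac-Moody algebra of `A` on that of the extended matrix. -/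
@[reducible]
def inclLieRingModule :
    LieRingModule (A.ToLieAlgebra K) ((extend A b p).ToLieAlgebra K) :=
  LieRingModule.compLieHom _ (incl K A b p)

attribute [local instance] inclLieRingModule

variable (K A b p) in
theorem inclLieModule : LieModule K (A.ToLieAlgebra K) ((extend A b p).ToLieAlgebra K) :=
  LieModule.compLieHom _ (incl K A b p)

attribute [local instance] inclLieModule

theorem module_lie_eq (x : A.ToLieAlgebra K) (y : (extend A b p).ToLieAlgebra K) :
    ⁅x, y⁆ = ⁅incl K A b p x, y⁆ := rfl

/-- This realizes the fundamental module of b inside the extended algebra. It provides both the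
invariant form on 𝔥 and the nilpotency used to extend τ. -/
theorem isIntegrableVector_endF :
    IsIntegrableVector (K := K) (A := A) (Pi.single b 1) (endF K A b p) where
  lie_e i := by rw [module_lie_eq, incl_e, e_lie_f_ne (by simp)]
  lie_h i := by
    rw [module_lie_eq, incl_h, h_lie_f, extend_inr_inl]
    by_cases hi : i = b
    · subst hi; simp
    · simp [hi]
  pow_f i := by
    obtain ⟨n, hn⟩ := exists_ad_f_pow_eq_zero (K := K) (A := extend A b (p + 1)) (.inr i)
      (endF K A b p)
    have h1 : toEnd K (A.ToLieAlgebra K) ((extend A b (p + 1)).ToLieAlgebra K) (f K A i) =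
        LieAlgebra.ad K _ (f K (extend A b (p + 1)) (.inr i)) := by
      refine LinearMap.ext fun y => ?_
      rw [toEnd_apply_apply, module_lie_eq, incl_f, LieAlgebra.ad_apply]
    exact ⟨n, by rw [h1]; exact hn⟩

variable [Fintype B] [CharZero K] {d : B → ℚ}

/-- The bracket of root vectors of opposite roots is a multiple of the dual element. -/
theorem IsFiniteType.exists_lie_eq_smul (hA : IsFiniteType A d)
    {μ : B → ℤ} (hμ : μ b = 1) {x y : A.ToLieAlgebra K} (hx : x ∈ rootSpace K A μ)
    (hy : y ∈ rootSpace K A (-μ)) : ∃ c : K, ⁅x, y⁆ = c • dualElement K A d b μ :=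
  -- The statement concerns 𝔥 alone, so a single attached node is enough.
  (isIntegrableVector_endF (K := K) (A := A) (b := b) (p := 0)).exists_lie_eq_smul hA
    (f_ne_zero hA.isGCM.extend _) (by simp) hμ hx hy

/-- These are the weight and Serre relations that the extension of τ must satisfy between b and the
adjacent node; both come from identifying the weight of `endF` for the image of the 𝔰𝔩₂ of b. -/
theorem GradedInvolution.lie_endF (τ : GradedInvolution K A b) (hA : IsFiniteType A d) :
    ⁅incl K A b (p + 1) (τ.toHom (h K A b)), endF K A b p⁆ = -endF K A b p ∧
      ⁅incl K A b (p + 1) (τ.toHom (e K A b)),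
        ⁅incl K A b (p + 1) (τ.toHom (e K A b)), endF K A b p⁆⁆ = 0 := by
  have h0 : endF K A b p ≠ 0 := f_ne_zero hA.isGCM.extend _
  obtain ⟨a, w, hw, haw⟩ := exists_eq_smul_h_add hA.isGCM
    (by simpa using τ.graded 0 _ (h_mem_grade b b))
  have h1 : ⁅incl K A b (p + 1) (τ.toHom (h K A b)), endF K A b p⁆ = a • endF K A b p := by
    rw [haw, map_add, map_smul, add_lie, smul_lie, incl_lie_endF_eq_zero hw, incl_h, h_lie_endF,
      add_zero]
  -- Modulo brackets, τ multiplies `h b` by a; apply τ twice and compare the actions on `endF`.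
  have h2 : a ^ 2 = 1 := by
    have h3 := τ.involutive (h K A b)
    rw [haw, map_add, map_smul] at h3
    have h4 := congrArg (fun x => ⁅incl K A b (p + 1) x, endF K A b p⁆) h3
    simp only [map_add, map_smul, add_lie, smul_lie, h1, incl_h, h_lie_endF] at h4
    rw [incl_lie_endF_eq_zero (map_mem_derivedZero τ.graded hw), add_zero, smul_smul] at h4
    have h5 : (a * a - 1) • endF K A b p = 0 := by rw [sub_smul, h4, one_smul, sub_self]
    rw [smul_eq_zero, or_iff_left h0] at h5
    linear_combination h5
  obtain ⟨N, hN⟩ := (isIntegrableVector_endF (K := K) (A := A) (b := b)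
    (p := p)).exists_pow_eq_zero hA (by simpa using τ.graded (-1) _ (e_mem_grade b))
  have hA2 : ((A b b : ℤ) : K) = 2 := by rw [hA.diag]; norm_num
  -- τ(f_b) has degree -1 and hence commutes with `endF`, and τ(e_b) has degree 1 and hence is
  -- nilpotent on it. So a = -k with k natural, and a² = 1 leaves k = 1.
  obtain ⟨k, hk, hk2⟩ := exists_weight_eq (K := K) (L := A.ToLieAlgebra K)
    (M := (extend A b (p + 1)).ToLieAlgebra K) (h := τ.toHom (h K A b)) (e := τ.toHom (e K A b))
    (f := τ.toHom (f K A b)) (by rw [← LieHom.map_lie, e_lie_f_same])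
    (by rw [← LieHom.map_lie, h_lie_e, ← Int.cast_smul_eq_zsmul K, hA2, map_smul])
    (v := endF K A b p) (a := a) h1
    (by rw [module_lie_eq, ← lie_skew, endF_lie_incl (τ.graded 1 _ (f_mem_grade b)), neg_zero])
    h0 hN
  have hk1 : k = 1 := by
    rw [hk, neg_sq] at h2
    have : k ^ 2 = 1 := by exact_mod_cast h2
    exact (Nat.pow_eq_one.1 this).resolve_right two_ne_zero
  rw [hk1] at hk hk2
  refine ⟨by rw [h1, hk]; simp, ?_⟩
  simpa [pow_succ, module_lie_eq] using hk2

end EndNode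

/-! ### Existence and uniqueness of the extended involution -/

section ExtendInvolution

variable {K : Type*} [Field K] {B : Type*} [DecidableEq B] {A : Matrix B B ℤ} {b : B} {p : ℕ}

omit [DecidableEq B] in
theorem SerreRel.map {L M : Type*} [LieRing L] [LieAlgebra K L] [LieRing M] [LieAlgebra K M]
    {E : B → L} (hE : SerreRel K A E) (g : L →ₗ⁅K⁆ M) : SerreRel K A fun i => g (E i) := by
  intro i j hij
  rw [← LieHom.map_lie, ← map_ad_pow, hE i j hij, map_zero]

/-- The images of the generators `e i` under the extension of `τ`. -/
def extensionE (τ : GradedInvolution K A b) (p : ℕ) :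
    Fin (p + 1) ⊕ B → (extend A b (p + 1)).ToLieAlgebra K
  | .inl i => -f K (extend A b (p + 1)) (.inl i)
  | .inr j => incl K A b (p + 1) (τ.toHom (e K A j))

/-- The images of the generators `f i` under the extension of `τ`. -/
def extensionF (τ : GradedInvolution K A b) (p : ℕ) :
    Fin (p + 1) ⊕ B → (extend A b (p + 1)).ToLieAlgebra K
  | .inl i => -e K (extend A b (p + 1)) (.inl i)
  | .inr j => incl K A b (p + 1) (τ.toHom (f K A j))

/-- The images of the generators `h i` under the extension of `τ`. -/
def extensionH (τ : GradedInvolution K A b) (p : ℕ) :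
    Fin (p + 1) ⊕ B → (extend A b (p + 1)).ToLieAlgebra K
  | .inl i => -h K (extend A b (p + 1)) (.inl i)
  | .inr j => incl K A b (p + 1) (τ.toHom (h K A j))

/-- Conjugation by the Chevalley involution exchanges the roles of the two halves, so each relation
for the images of the `f i` follows from the one for the `e i` applied to `τ.conj`. -/
theorem extensionF_eq (τ : GradedInvolution K A b) (i : Fin (p + 1) ⊕ B) :
    extensionF τ p i = -chevalleyInvolution K _ (extensionE τ.conj p i) := by
  rcases i with i | j
  · simp [extensionF, extensionE]
  · simp [extensionF, extensionE, chevalleyInvolution_incl, τ.conj_apply]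

theorem extensionH_eq (τ : GradedInvolution K A b) (i : Fin (p + 1) ⊕ B) :
    extensionH τ p i = -chevalleyInvolution K _ (extensionH τ.conj p i) := by
  rcases i with i | j
  · simp [extensionH]
  · simp [extensionH, chevalleyInvolution_incl, τ.conj_apply]

variable [CharZero K]

theorem GradedInvolution.map_e_mem (τ : GradedInvolution K A b) (hA : IsGCM A) {j : B}
    (hj : j ≠ b) : τ.toHom (e K A j) ∈ derivedZero K A b :=
  map_mem_derivedZero τ.graded (e_mem_derivedZero hA hj)

theorem GradedInvolution.map_f_mem (τ : GradedInvolution K A b) (hA : IsGCM A) {j : B}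
    (hj : j ≠ b) : τ.toHom (f K A j) ∈ derivedZero K A b :=
  map_mem_derivedZero τ.graded (f_mem_derivedZero hA hj)

omit [CharZero K] in
theorem inl_f_lie_incl_eq_zero (i : Fin (p + 1)) {x : A.ToLieAlgebra K}
    (hx : x ∈ derivedZero K A b) :
    ⁅f K (extend A b (p + 1)) (.inl i), incl K A b (p + 1) x⁆ = 0 := by
  by_cases hi : i = Fin.last p
  · subst hi
    rw [← lie_skew, incl_lie_endF_eq_zero hx, neg_zero]
  · exact inl_f_lie_incl hi x

theorem inl_f_lie_map_f (τ : GradedInvolution K A b) (hA : IsGCM A) (i : Fin (p + 1)) (j : B) :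
    ⁅f K (extend A b (p + 1)) (.inl i), incl K A b (p + 1) (τ.toHom (f K A j))⁆ = 0 := by
  by_cases hj : j = b
  · subst hj
    by_cases hi : i = Fin.last p
    · subst hi
      exact endF_lie_incl (τ.graded 1 _ (f_mem_grade j))
    · exact inl_f_lie_incl hi _
  · exact inl_f_lie_incl_eq_zero i (τ.map_f_mem hA hj)

variable [Fintype B] {d : B → ℚ}

theorem extension_lie_h_e (τ : GradedInvolution K A b) (hA : IsFiniteType A d)
    (i j : Fin (p + 1) ⊕ B) :
    ⁅extensionH τ p i, extensionE τ p j⁆ = extend A b (p + 1) i j • extensionE τ p j := by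
  rcases i with i | i <;> rcases j with j | j
  · simp [extensionH, extensionE, h_lie_f]
  · simp only [extensionH, extensionE, neg_lie, extend_inl_inr]
    by_cases hj : j = b
    · subst hj
      rw [inl_h_lie_incl i (τ.graded (-1) _ (e_mem_grade j))]
      by_cases hi : i = Fin.last p <;> simp [hi]
    · rw [inl_h_lie_incl i (τ.graded 0 _ (e_mem_grade_zero hj))]
      simp [hj]
  · simp only [extensionH, extensionE, lie_neg, extend_inr_inl]
    by_cases hj : j = Fin.last p
    · subst hj
      by_cases hi : i = b
      · subst hi
        rw [(τ.lie_endF hA).1]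
        simp
      · rw [incl_lie_endF_eq_zero (map_mem_derivedZero τ.graded (h_mem_derivedZero hi))]
        simp [hi]
    · rw [← lie_skew, inl_f_lie_incl hj]
      simp [hj]
  · rw [extensionH, extensionE, ← LieHom.map_lie, ← LieHom.map_lie, h_lie_e, extend_inr_inr,
      map_zsmul, map_zsmul]

/-- The mixed relations are trivial because the elements commute, except between b and the adjacent
node, where they are the statements on `endF` proved above. -/
theorem serreRel_extensionE (τ : GradedInvolution K A b) (hA : IsFiniteType A d) :
    SerreRel K (extend A b (p + 1)) (extensionE τ p) := by
  rintro (i | i) (j | j) hij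
  · exact (serreRel_f K (extend A b (p + 1))).neg _ _ hij
  · rw [extend_inl_inr]
    simp only [extensionE]
    by_cases hj : j = b
    · subst hj
      by_cases hi : i = Fin.last p
      · subst hi
        rw [if_pos ⟨rfl, rfl⟩, neg_neg, Int.toNat_one, pow_one, LieAlgebra.ad_apply, neg_lie, neg_lie,
          lie_neg, neg_neg]
        exact endF_lie_endF_lie_incl (by simpa using τ.graded (-1) _ (e_mem_grade j))
      · simp [inl_f_lie_incl hi]
    · simp [inl_f_lie_incl_eq_zero i (τ.map_e_mem hA.isGCM hj)]
  · rw [extend_inr_inl]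
    simp only [extensionE]
    by_cases hj : j = Fin.last p
    · subst hj
      by_cases hi : i = b
      · subst hi
        rw [if_pos ⟨rfl, rfl⟩, neg_neg, Int.toNat_one, pow_one, LieAlgebra.ad_apply, lie_neg, lie_neg,
          (τ.lie_endF hA).2, neg_zero]
      · rw [lie_neg, lie_skew]
        simp [inl_f_lie_incl_eq_zero _ (τ.map_e_mem hA.isGCM hi)]
    · rw [lie_neg, lie_skew]
      simp [inl_f_lie_incl hj]
  · exact ((serreRel_e K A).map ((incl K A b (p + 1)).comp τ.toHom)) i j
      (fun h => hij (congrArg _ h))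

theorem serreRel_extensionF (τ : GradedInvolution K A b) (hA : IsFiniteType A d) :
    SerreRel K (extend A b (p + 1)) (extensionF τ p) := by
  have := ((serreRel_extensionE (p := p) τ.conj hA).map (chevalleyInvolution K _)).neg
  rwa [← funext (extensionF_eq (p := p) τ)] at this

theorem isChevalley_extension (τ : GradedInvolution K A b) (hA : IsFiniteType A d) :
    IsChevalley (extend A b (p + 1)) (extensionH τ p) (extensionE τ p) (extensionF τ p) where
  hh := by
    have h1 : ∀ i j, ⁅h K (extend A b (p + 1)) (.inl i),
        incl K A b (p + 1) (τ.toHom (h K A j))⁆ = 0 := fun i j => by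
      rw [inl_h_lie_incl i (τ.graded 0 _ (h_mem_grade b j))]
      simp
    rintro (i | i) (j | j)
    · simp [extensionH, h_lie_h]
    · simp [extensionH, h1]
    · rw [← lie_skew]
      simp [extensionH, h1]
    · rw [extensionH, extensionH, ← LieHom.map_lie, ← LieHom.map_lie, h_lie_h, map_zero, map_zero]
  ef_same := by
    rintro (i | i)
    · simp only [extensionH, extensionE, extensionF, neg_lie, lie_neg, neg_neg]
      rw [← lie_skew, e_lie_f_same]
    · rw [extensionH, extensionE, extensionF, ← LieHom.map_lie, ← LieHom.map_lie, e_lie_f_same]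
  ef_ne := by
    rintro (i | i) (j | j) hij
    · simp only [extensionE, extensionF, neg_lie, lie_neg, neg_neg]
      rw [← lie_skew, e_lie_f_ne hij.symm, neg_zero]
    · simp only [extensionE, extensionF, neg_lie]
      rw [inl_f_lie_map_f τ hA.isGCM, neg_zero]
    -- The brackets of the τ(e_i) with the `e j` of the chain are the Chevalley images of brackets
    -- of `τ.conj` with the `f j`.
    · have h1 := inl_f_lie_map_f τ.conj hA.isGCM j i (p := p)
      have h2 := congrArg (chevalleyInvolution K (extend A b (p + 1))) h1
      simp only [LieHom.map_lie, chevalleyInvolution_f, τ.conj_apply, map_neg,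
        ← chevalleyInvolution_incl, chevalleyInvolution_apply_apply, neg_lie, lie_neg, neg_neg,
        map_zero] at h2
      simp only [extensionE, extensionF, lie_neg]
      rw [lie_skew, h2]
    · rw [extensionE, extensionF, ← LieHom.map_lie, ← LieHom.map_lie,
        e_lie_f_ne (fun h => hij (congrArg _ h)), map_zero, map_zero]
  he := extension_lie_h_e τ hA
  hf i j := by
    rw [extensionH_eq, extensionF_eq, neg_lie, lie_neg, neg_neg, ← LieHom.map_lie,
      extension_lie_h_e τ.conj hA, map_zsmul, smul_neg, neg_neg]

/-- The extension of a graded involution. -/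
def GradedInvolution.extension (τ : GradedInvolution K A b) (hA : IsFiniteType A d) (p : ℕ) :
    GradedInvolution K (extend A b (p + 1)) (.inr b) where
  toHom := liftChevalley (isChevalley_extension τ hA) (serreRel_extensionE τ hA)
    (serreRel_extensionF τ hA)
  involutive := by
    set σ := liftChevalley (isChevalley_extension (p := p) τ hA) (serreRel_extensionE τ hA)
      (serreRel_extensionF τ hA) with hσ
    have hincl : σ.comp (incl K A b (p + 1)) = (incl K A b (p + 1)).comp τ.toHom :=
      hom_ext (fun i => by simp [hσ, extensionE]) (fun i => by simp [hσ, extensionF])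
    have hincl' : ∀ x, σ (incl K A b (p + 1) x) = incl K A b (p + 1) (τ.toHom x) :=
      fun x => LieHom.congr_fun hincl x
    have : σ.comp σ = LieHom.id := by
      refine hom_ext ?_ ?_
      · rintro (i | i)
        · simp [hσ, extensionE, extensionF]
        · change σ (σ _) = e K _ _
          rw [← incl_e, hincl', hincl', τ.involutive]
      · rintro (i | i)
        · simp [hσ, extensionE, extensionF]
        · change σ (σ _) = f K _ _
          rw [← incl_f, hincl', hincl', τ.involutive]
    exact fun x => LieHom.congr_fun this x
  graded := by
    set σ := liftChevalley (isChevalley_extension (p := p) τ hA) (serreRel_extensionE τ hA)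
      (serreRel_extensionF τ hA) with hσ
    have key : ∀ μ x, IsMonomial K (extend A b (p + 1)) μ x →
        σ x ∈ grade K (extend A b (p + 1)) (.inr b) (μ (.inr b)) := by
      intro μ x hx
      have hz : ∀ (k : ℤ) (i : B), k = (Pi.single (Sum.inr i) 1 : Fin (p + 1) ⊕ B → ℤ) (.inr b) →
          k = if i = b then 1 else 0 := by
        rintro k i rfl
        by_cases hi : i = b
        · subst hi; simp
        · simp [hi, Ne.symm hi]
      induction hx with
      | e i =>
        rw [hσ, liftChevalley_e]
        rcases i with i | i
        · simpa [extensionE] using f_mem_grade_zero (K := K) (A := extend A b (p + 1))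
            (b := .inr b) (i := .inl i) (by simp)
        · rw [hz _ i rfl]
          refine incl_mem_grade ?_
          split_ifs with hi
          · subst hi; simpa using τ.graded _ _ (e_mem_grade i)
          · simpa using τ.graded _ _ (e_mem_grade_zero hi)
      | f i =>
        rw [hσ, liftChevalley_f, Pi.neg_apply]
        rcases i with i | i
        · simpa [extensionF] using e_mem_grade_zero (K := K) (A := extend A b (p + 1))
            (b := .inr b) (i := .inl i) (by simp)
        · rw [hz _ i rfl]
          refine incl_mem_grade ?_
          split_ifs with hi
          · subst hi; simpa using τ.graded _ _ (f_mem_grade i)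
          · simpa using τ.graded _ _ (f_mem_grade_zero hi)
      | h i =>
        rw [hσ, liftChevalley_h, Pi.zero_apply]
        rcases i with i | i
        · exact neg_mem (h_mem_grade _ _)
        · exact incl_mem_grade (by simpa using τ.graded _ _ (h_mem_grade b i))
      | lie _ _ hx hy => rw [LieHom.map_lie, Pi.add_apply]; exact lie_mem_grade hx hy
    intro k x hx
    have : grade K (extend A b (p + 1)) (.inr b) k ≤
        (grade K (extend A b (p + 1)) (.inr b) (-k)).comap
          (σ : (extend A b (p + 1)).ToLieAlgebra K →ₗ[K] _) :=
      grade_le fun μ hμ => Submodule.span_le.2 fun y hy => by rw [← hμ]; exact key μ y hy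
    exact this hx

theorem GradedInvolution.extension_e (τ : GradedInvolution K A b) (hA : IsFiniteType A d)
    (i : Fin (p + 1) ⊕ B) :
    (τ.extension hA p).toHom (e K _ i) = extensionE τ p i := 
  liftChevalley_e (isChevalley_extension τ hA) (serreRel_extensionE τ hA) (serreRel_extensionF τ hA) i

theorem GradedInvolution.extension_f (τ : GradedInvolution K A b) (hA : IsFiniteType A d)
    (i : Fin (p + 1) ⊕ B) :
    (τ.extension hA p).toHom (f K _ i) = extensionF τ p i := 
  liftChevalley_f (isChevalley_extension τ hA) (serreRel_extensionE τ hA) (serreRel_extensionF τ hA) i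

theorem GradedInvolution.isExtension (τ : GradedInvolution K A b) (hA : IsFiniteType A d) (p : ℕ) :
    IsExtension τ (τ.extension hA p) := by
  refine ⟨?_, fun i => τ.extension_e hA (.inl i)⟩
  have : (τ.extension hA p).toHom.comp (incl K A b (p + 1)) =
      (incl K A b (p + 1)).comp τ.toHom :=
    hom_ext (fun i => by simp [τ.extension_e hA, extensionE])
      (fun i => by simp [τ.extension_f hA, extensionF])
  exact fun x => LieHom.congr_fun this x

omit [CharZero K] [Fintype B] in
theorem GradedInvolution.ext {τ₁ τ₂ : GradedInvolution K A b} (h : τ₁.toHom = τ₂.toHom) :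
    τ₁ = τ₂ := by
  cases τ₁
  cases τ₂
  cases h
  rfl

omit [CharZero K] [Fintype B] in
theorem IsExtension.map_f {τ : GradedInvolution K A b}
    {σ : GradedInvolution K (extend A b p) (.inr b)} (hσ : IsExtension τ σ) (i : Fin p) :
    σ.toHom (f K (extend A b p) (.inl i)) = -e K (extend A b p) (.inl i) := by
  have := congrArg σ.toHom (hσ.2 i)
  rw [σ.involutive, map_neg] at this
  rw [this, neg_neg]

omit [CharZero K] [Fintype B] in
theorem IsExtension.unique {τ : GradedInvolution K A b}
    {σ₁ σ₂ : GradedInvolution K (extend A b p) (.inr b)} (h₁ : IsExtension τ σ₁)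
    (h₂ : IsExtension τ σ₂) : σ₁ = σ₂ := by
  refine GradedInvolution.ext (hom_ext ?_ ?_)
  · rintro (i | i)
    · rw [h₁.2, h₂.2]
    · rw [← incl_e, h₁.1, h₂.1]
  · rintro (i | i)
    · rw [h₁.map_f, h₂.map_f]
    · rw [← incl_f, h₁.1, h₂.1]

theorem existsUnique_isExtension (τ : GradedInvolution K A b) (hA : IsFiniteType A d) (p : ℕ) :
    ∃! σ : GradedInvolution K (extend A b (p + 1)) (.inr b), IsExtension τ σ :=
  ⟨τ.extension hA p, τ.isExtension hA p, fun _ hσ => hσ.unique (τ.isExtension hA p)⟩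

end ExtendInvolution

/-! ### The associated bilinear form -/

section AssociatedForm

variable {K : Type*} [Field K] {B : Type*} [DecidableEq B] {A : Matrix B B ℤ} {b : B}

/-- `χ` restricts to the character of the subalgebra of degree `0` by which this acts on the
simple root vector `f_i` of an attached node. -/
structure IsCharacter (b : B) (χ : A.ToLieAlgebra K →ₗ[K] K) : Prop where
  map_h : χ (h K A b) = 1
  map_derivedZero : ∀ x ∈ derivedZero K A b, χ x = 0

variable {χ : A.ToLieAlgebra K →ₗ[K] K}

/-- The bilinear form `(x, z) = χ([x, τ(z)])` on the subspace of degree `-1`. -/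
def characterForm (τ : GradedInvolution K A b) (χ : A.ToLieAlgebra K →ₗ[K] K) :
    LinearMap.BilinForm K (grade K A b (-1)) :=
  LinearMap.mk₂ K (fun x z => χ ⁅(x : A.ToLieAlgebra K), τ.toHom z⁆)
    (fun x y z => by simp) (fun c x z => by simp) (fun x y z => by simp) (fun c x z => by simp)

theorem characterForm_apply (τ : GradedInvolution K A b) (x z : grade K A b (-1)) :
    characterForm τ χ x z = χ ⁅(x : A.ToLieAlgebra K), τ.toHom z⁆ := rfl

variable [CharZero K]

theorem IsCharacter.incl_lie_endE (hχ : IsCharacter b χ) (hA : IsGCM A) (p : ℕ)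
    {u : A.ToLieAlgebra K} (hu : u ∈ grade K A b 0) :
    ⁅incl K A b (p + 1) u, endE K A b p⁆ = -(χ u • endE K A b p) := by
  obtain ⟨a, w, hw, rfl⟩ := exists_eq_smul_h_add hA hu
  rw [map_add, map_smul, map_add, map_smul, hχ.map_h, hχ.map_derivedZero w hw, add_lie, smul_lie,
    incl_lie_endE_eq_zero hw, incl_h, h_lie_endE]
  simp

variable [Fintype B]

omit [CharZero K] in
-- The scalar by which x acts on `endF` is read off with a linear functional that is 1 on `endF`.
-- The functional is arbitrary otherwise, which is harmless as χ matters only in degree 0.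
theorem exists_isCharacter (hA : IsGCM A) (b : B) :
    ∃ χ : A.ToLieAlgebra K →ₗ[K] K, IsCharacter b χ := by
  obtain ⟨l, hl⟩ := LinearMap.exists_leftInverse_of_injective
    (LinearMap.toSpanSingleton K _ (endF K A b 0))
    (LinearMap.ker_toSpanSingleton K (f_ne_zero hA.extend _))
  have hl1 : l (endF K A b 0) = 1 := by simpa using LinearMap.congr_fun hl 1
  refine ⟨-(l ∘ₗ LieAlgebra.ad K _ (endF K A b 0) ∘ₗ
    (incl K A b 1 : A.ToLieAlgebra K →ₗ[K] _)), ?_, fun x hx => ?_⟩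
  · change -l ⁅endF K A b 0, incl K A b 1 (h K A b)⁆ = 1
    rw [← map_neg, lie_skew, incl_h, h_lie_endF, hl1]
  · change -l ⁅endF K A b 0, incl K A b 1 x⁆ = 0
    rw [← map_neg, lie_skew, incl_lie_endF_eq_zero hx, map_zero]

variable {d : B → ℚ}

theorem IsCharacter.map_dualElement (hχ : IsCharacter b χ) (hA : IsFiniteType A d) {μ : B → ℤ}
    (hμ : μ b = 1) : χ (dualElement K A d b μ) = 1 := by
  rw [dualElement, map_sum, Finset.sum_eq_single b]
  · rw [map_smul, hχ.map_h, hμ, div_self (hA.pos b).ne']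
    simp
  · intro i _ hi
    rw [map_smul, hχ.map_derivedZero _ (h_mem_derivedZero hi), smul_zero]
  · simp

/-- For opposite roots the bracket is a multiple of `dualElement`, where χ is 1 because only its
component at b counts. For other pairs it has nonzero weight in degree 0 and is a sum of brackets,
or one factor is zero because its root has the wrong degree. -/
theorem IsCharacter.isAssociatedForm (hχ : IsCharacter b χ) (hA : IsFiniteType A d)
    (τ : GradedInvolution K A b) : IsAssociatedForm d τ (characterForm τ χ) := by
  intro μ ν x y hx hy
  have hform : characterForm τ χ x (τ.oneToNegOne y) =
      χ ⁅(x : A.ToLieAlgebra K), (y : A.ToLieAlgebra K)⁆ := by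
    rw [characterForm_apply]
    exact congrArg (fun t => χ ⁅(x : A.ToLieAlgebra K), t⁆) (τ.involutive y)
  rw [hform]
  by_cases hμ : μ b = 1
  · refine ⟨?_, fun hne => ?_⟩
    · rintro rfl
      obtain ⟨c, hc⟩ := hA.exists_lie_eq_smul hμ hx hy
      rw [hc, map_smul, hχ.map_dualElement hA hμ, smul_eq_mul, mul_one]
    · by_cases hν : ν b = 1
      · refine hχ.map_derivedZero _ (rootSpace_le_derivedZero hA.isGCM ?_ ?_
          (lie_mem_rootSpace hx hy))
        · simp [hμ, hν]
        · rwa [← sub_eq_add_neg, sub_ne_zero]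
      · rw [hA.eq_zero_of_mem_rootSpace y.2 hy (by simpa using hν), lie_zero, map_zero]
  · rw [hA.eq_zero_of_mem_rootSpace x.2 hx (by simpa using hμ)]
    simp

/-- The conditions fix the form on pairs of root vectors, `dualElement` being nonzero since χ is 1
on it. Root vectors span degrees 1 and -1, and τ maps degree 1 onto degree -1. -/
theorem IsAssociatedForm.eq_characterForm (hχ : IsCharacter b χ) (hA : IsFiniteType A d)
    {τ : GradedInvolution K A b} {β : LinearMap.BilinForm K (grade K A b (-1))}
    (hβ : IsAssociatedForm d τ β) : β = characterForm τ χ := by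
  suffices h : ∀ μ (x : grade K A b (-1)), (x : A.ToLieAlgebra K) ∈ rootSpace K A μ →
      ∀ ν (y : grade K A b 1), (y : A.ToLieAlgebra K) ∈ rootSpace K A (-ν) →
      (β - characterForm τ χ) x (τ.oneToNegOne y) = 0 from by
    rw [← sub_eq_zero]
    generalize β - characterForm τ χ = γ at h
    let T : grade K A b 1 →ₗ[K] grade K A b (-1) :=
      (τ.toHom : A.ToLieAlgebra K →ₗ[K] A.ToLieAlgebra K).restrict fun y hy => τ.graded 1 y hy
    have h1 : grade K A b (-1) ≤ (LinearMap.ker γ).map (grade K A b (-1)).subtype := by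
      refine grade_le fun μ hμ x hx => ⟨⟨x, mem_grade hμ hx⟩, ?_, rfl⟩
      have h2 : grade K A b 1 ≤ (LinearMap.ker (γ ⟨x, mem_grade hμ hx⟩ ∘ₗ T)).map
          (grade K A b 1).subtype :=
        grade_le fun ν hν y hy => ⟨⟨y, mem_grade hν hy⟩,
          h μ ⟨x, mem_grade hμ hx⟩ hx (-ν) ⟨y, mem_grade hν hy⟩ (by simpa using hy), rfl⟩
      refine LinearMap.mem_ker.2 (LinearMap.ext fun z => ?_)
      obtain ⟨y, hy, hyz⟩ := h2 (by simpa using τ.graded (-1) z z.2 : τ.toHom z ∈ grade K A b 1)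
      have h3 : T y = z := Subtype.ext (by
        change τ.toHom (y : A.ToLieAlgebra K) = z
        rw [show (y : A.ToLieAlgebra K) = τ.toHom z from hyz, τ.involutive])
      rw [← h3]
      exact hy
    refine LinearMap.ext fun x => ?_
    obtain ⟨x', hx', hxx⟩ := h1 x.2
    rw [← show x' = x from Subtype.ext hxx]
    exact hx'
  intro μ x hx ν y hy
  obtain ⟨h1, h2⟩ := hβ μ ν x y hx hy
  obtain ⟨h3, h4⟩ := hχ.isAssociatedForm hA τ μ ν x y hx hy
  rw [LinearMap.sub_apply, LinearMap.sub_apply, sub_eq_zero]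
  by_cases hμν : μ = ν
  · by_cases hμ : μ b = 1
    · have h5 := congrArg χ ((h1 hμν).symm.trans (h3 hμν))
      simpa [hχ.map_dualElement hA hμ] using h5
    · have h6 : x = 0 := Subtype.ext (hA.eq_zero_of_mem_rootSpace x.2 hx (by simpa using hμ))
      rw [h6]
      simp
  · rw [h2 hμν, h4 hμν]

theorem existsUnique_isAssociatedForm (hA : IsFiniteType A d) (τ : GradedInvolution K A b) :
    ∃! β : LinearMap.BilinForm K (grade K A b (-1)), IsAssociatedForm d τ β := by
  obtain ⟨χ, hχ⟩ := exists_isCharacter (K := K) hA.isGCM b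
  exact ⟨characterForm τ χ, hχ.isAssociatedForm hA τ, fun _ hβ => hβ.eq_characterForm hχ hA⟩

end AssociatedForm

/-! ### The copies of degree -1 along the chain and their brackets -/

section Chain

variable {K : Type*} [Field K] {B : Type*} [DecidableEq B] {A : Matrix B B ℤ} {b : B} {p : ℕ}

/-- The attached nodes, numbered by their distance from the node which is adjacent to `b`. -/
def chainNode (B : Type*) (p k : ℕ) : Fin (p + 1) ⊕ B := .inl ⟨p - k, by omega⟩

omit [DecidableEq B] in
theorem chainNode_inj {i j : ℕ} (hi : i ≤ p) (hj : j ≤ p) :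
    chainNode B p i = chainNode B p j ↔ i = j := by
  simp only [chainNode, Sum.inl.injEq, Fin.mk.injEq]
  omega

theorem extend_chainNode {i j : ℕ} (hi : i ≤ p) (hj : j ≤ p) :
    extend A b (p + 1) (chainNode B p i) (chainNode B p j) =
      if i = j then 2 else if i + 1 = j ∨ j + 1 = i then -1 else 0 := by
  rw [chainNode, chainNode, extend_inl_inl]
  simp only [Fin.mk.injEq]
  split_ifs <;> omega

variable (K A b p) in
/-- The simple root vector `e` of the `k`-th attached node. -/
def chainE (k : ℕ) : (extend A b (p + 1)).ToLieAlgebra K :=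
  e K (extend A b (p + 1)) (chainNode B p k)

variable (K A b p) in
/-- The simple root vector `f` of the `k`-th attached node. -/
def chainF (k : ℕ) : (extend A b (p + 1)).ToLieAlgebra K :=
  f K (extend A b (p + 1)) (chainNode B p k)

variable (K A b p) in
/-- The `a`-th copy of the subspace of degree `-1` in the extended algebra. -/
def copy : ℕ → A.ToLieAlgebra K →ₗ[K] (extend A b (p + 1)).ToLieAlgebra K
  | 0 => (incl K A b (p + 1) : A.ToLieAlgebra K →ₗ[K] _)
  | a + 1 => LieAlgebra.ad K _ (chainE K A b p a) ∘ₗ copy a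

theorem copy_zero (x : A.ToLieAlgebra K) : copy K A b p 0 x = incl K A b (p + 1) x := rfl

theorem copy_succ (a : ℕ) (x : A.ToLieAlgebra K) :
    copy K A b p (a + 1) x = ⁅chainE K A b p a, copy K A b p a x⁆ := rfl

theorem chainE_zero : chainE K A b p 0 = endE K A b p := rfl

theorem chainE_lie_incl {k : ℕ} (hk : k ≤ p) (h0 : k ≠ 0) (x : A.ToLieAlgebra K) :
    ⁅chainE K A b p k, incl K A b (p + 1) x⁆ = 0 :=
  inl_e_lie_incl (fun h => by simp [Fin.ext_iff] at h; omega) x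

theorem chainF_lie_incl {k : ℕ} (hk : k ≤ p) (h0 : k ≠ 0) (x : A.ToLieAlgebra K) :
    ⁅chainF K A b p k, incl K A b (p + 1) x⁆ = 0 :=
  inl_f_lie_incl (fun h => by simp [Fin.ext_iff] at h; omega) x

theorem chainF_lie_incl_of_mem {k : ℕ} (hk : k ≤ p) {x : A.ToLieAlgebra K}
    (hx : x ∈ grade K A b (-1)) : ⁅chainF K A b p k, incl K A b (p + 1) x⁆ = 0 := by
  by_cases h0 : k = 0
  · subst h0; exact endF_lie_incl hx
  · exact chainF_lie_incl hk h0 x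

theorem chainE_lie_chainE {i j : ℕ} (hi : i ≤ p) (hj : j ≤ p) (hij : i + 1 < j ∨ j + 1 < i) :
    ⁅chainE K A b p i, chainE K A b p j⁆ = 0 :=
  e_lie_e_eq_zero (by rw [extend_chainNode hi hj, if_neg (by omega), if_neg (by omega)])

theorem chainE_lie_chainE_lie_chainE {i j : ℕ} (hi : i ≤ p) (hj : j ≤ p)
    (hij : i + 1 = j ∨ j + 1 = i) :
    ⁅chainE K A b p i, ⁅chainE K A b p i, chainE K A b p j⁆⁆ = 0 := by
  have := serre_e (K := K) (A := extend A b (p + 1)) (chainNode B p i) (chainNode B p j)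
  rwa [extend_chainNode hi hj, if_neg (by omega), if_pos hij, neg_neg, Int.toNat_one, pow_one,
    LieAlgebra.ad_apply] at this

theorem chainE_lie_copy_of_lt {i a : ℕ} (hi : i ≤ p) (ha : a < i) (x : A.ToLieAlgebra K) :
    ⁅chainE K A b p i, copy K A b p a x⁆ = 0 := by
  induction a with
  | zero => exact chainE_lie_incl hi ha.ne' x
  | succ a ih =>
    rw [copy_succ, leibniz_lie, chainE_lie_chainE hi (by omega) (by omega), ih (by omega),
      zero_lie, lie_zero, add_zero]

theorem chainE_lie_chainE_lie_copy {i : ℕ} (hi : i ≤ p) {x : A.ToLieAlgebra K}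
    (hx : x ∈ grade K A b (-1)) :
    ⁅chainE K A b p i, ⁅chainE K A b p i, copy K A b p i x⁆⁆ = 0 := by
  cases i with
  | zero => exact endE_lie_endE_lie_incl hx
  | succ i =>
    have h1 : ⁅chainE K A b p (i + 1), copy K A b p i x⁆ = 0 :=
      chainE_lie_copy_of_lt hi (by omega) x
    have h2 := chainE_lie_chainE_lie_chainE (K := K) (A := A) (b := b) hi
      (show i ≤ p by omega) (by omega)
    rw [copy_succ, leibniz_lie _ (chainE K A b p i), h1, lie_zero, add_zero,
      leibniz_lie, h1, h2, zero_lie, lie_zero, add_zero]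

section CharZero

variable [CharZero K]

/-- Together with `chainF_lie_copy` this is the action of 𝔰𝔩_n on K^n. Only a = i + 1 and a = i + 2
need Serre relations; in higher copies the i-th vector commutes with the last factor. -/
theorem chainE_lie_copy {i a : ℕ} (hi : i ≤ p) (ha : a ≤ p + 1) {x : A.ToLieAlgebra K}
    (hx : x ∈ grade K A b (-1)) :
    ⁅chainE K A b p i, copy K A b p a x⁆ = if i = a then copy K A b p (a + 1) x else 0 := by
  rcases lt_trichotomy a i with h | rfl | h
  · rw [chainE_lie_copy_of_lt hi h, if_neg h.ne']
  · rw [if_pos rfl, copy_succ]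
  rw [if_neg h.ne]
  obtain ⟨k, rfl⟩ := Nat.exists_eq_add_of_le h
  induction k with
  | zero => exact chainE_lie_chainE_lie_copy hi hx
  | succ k ih =>
    rw [show i.succ + (k + 1) = i.succ + k + 1 from rfl, copy_succ]
    cases k with
    | zero =>
      have h1 : ⁅chainE K A b p (i + 1), copy K A b p i x⁆ = 0 :=
        chainE_lie_copy_of_lt (by omega) (by omega) x
      have h2 := chainE_lie_chainE_lie_copy (K := K) (A := A) (b := b) hi hx
      have h3 := chainE_lie_chainE_lie_chainE (K := K) (A := A) (b := b) hi
        (show i + 1 ≤ p by omega) (by omega)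
      change ⁅chainE K A b p i, ⁅chainE K A b p (i + 1), ⁅chainE K A b p i, copy K A b p i x⁆⁆⁆ = 0
      -- Write e and e' for the i-th and (i + 1)-st vectors. Of eee' - 2ee'e + e'ee applied to `copy
      -- i`, the outer terms vanish because e' and e² kill it, so the middle one does, the
      -- characteristic being 0.
      have h4 := congrArg (fun t => ⁅t, copy K A b p i x⁆) h3
      simp only [lie_lie, h1, h2, lie_zero, zero_lie, zero_sub, sub_zero, lie_neg] at h4
      have h5 : (2 : K) • ⁅chainE K A b p i,
          ⁅chainE K A b p (i + 1), ⁅chainE K A b p i, copy K A b p i x⁆⁆⁆ = 0 := by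
        rw [two_smul, ← neg_eq_zero, neg_add, ← sub_eq_add_neg, h4]
      exact (smul_eq_zero.1 h5).resolve_left two_ne_zero
    | succ k =>
      rw [leibniz_lie, chainE_lie_chainE hi (by omega) (by omega), ih (by omega) (by omega),
        zero_lie, lie_zero, add_zero]

variable [Fintype B]

omit [CharZero K] in
theorem chain_h_lie_copy {k a : ℕ} (hk : k ≤ p) (ha : a ≤ k) {x : A.ToLieAlgebra K}
    (hx : x ∈ grade K A b (-1)) :
    ⁅h K (extend A b (p + 1)) (chainNode B p k), copy K A b p a x⁆ =
      if a = k then -copy K A b p a x else 0 := by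
  induction a with
  | zero =>
    rw [copy_zero, chainNode, inl_h_lie_incl _ hx]
    by_cases h0 : k = 0
    · subst h0; simp [Fin.ext_iff]
    · rw [if_neg (by simp [Fin.ext_iff]; omega), if_neg (Ne.symm h0), zero_smul]
  | succ a ih =>
    rw [copy_succ, leibniz_lie, ih (by omega), if_neg (by omega), lie_zero, add_zero, chainE,
      h_lie_e, extend_chainNode hk (by omega), if_neg (by omega)]
    by_cases h1 : a + 1 = k
    · rw [if_pos (by omega), if_pos h1, neg_one_smul, neg_lie]
    · rw [if_neg (by omega), if_neg h1, zero_smul, zero_lie]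

omit [CharZero K] in
-- Moving `f` past the last factor yields minus the coroot, which acts by -1 on the preceding copy.
theorem chainF_lie_copy {i a : ℕ} (hi : i ≤ p) (ha : a ≤ p + 1) {x : A.ToLieAlgebra K}
    (hx : x ∈ grade K A b (-1)) :
    ⁅chainF K A b p i, copy K A b p a x⁆ = if a = i + 1 then copy K A b p i x else 0 := by
  induction a with
  | zero => rw [copy_zero, chainF_lie_incl_of_mem hi hx, if_neg (by omega)]
  | succ a ih =>
    rw [copy_succ, leibniz_lie, ih (by omega)]
    have h1 : ⁅chainE K A b p a, if a = i + 1 then copy K A b p i x else 0⁆ = 0 := by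
      split_ifs with h
      · rw [chainE_lie_copy_of_lt (by omega) (by omega)]
      · rw [lie_zero]
    rw [h1, add_zero, ← lie_skew (chainF K A b p i)]
    by_cases h : a = i
    · subst h
      rw [chainE, chainF, e_lie_f_same, neg_lie, chain_h_lie_copy hi le_rfl hx, if_pos rfl,
        if_pos rfl, neg_neg]
    · rw [chainE, chainF, e_lie_f_ne (by rw [Ne, chainNode_inj (by omega) hi]; exact h), neg_zero,
        zero_lie, if_neg (by omega)]

omit [Fintype B] in
-- Every copy but the zeroth contains the factor `endE` exactly once, on which u acts by -χ(u); the
-- further chain vectors commute with 𝔥.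
theorem IsCharacter.incl_lie_copy {χ : A.ToLieAlgebra K →ₗ[K] K} (hχ : IsCharacter b χ)
    (hA : IsGCM A) {u : A.ToLieAlgebra K} (hu : u ∈ grade K A b 0) {g : ℕ} (hg : g ≤ p + 1)
    (z : A.ToLieAlgebra K) :
    ⁅incl K A b (p + 1) u, copy K A b p g z⁆ =
      copy K A b p g ⁅u, z⁆ - if g = 0 then 0 else χ u • copy K A b p g z := by
  induction g with
  | zero => simp [copy_zero]
  | succ g ih =>
    rw [copy_succ, leibniz_lie, ih (by omega), if_neg (Nat.succ_ne_zero g), copy_succ]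
    cases g with
    | zero =>
      rw [chainE_zero, hχ.incl_lie_endE hA p hu, if_pos rfl, sub_zero, neg_lie, smul_lie]
      abel
    | succ g =>
      rw [← lie_skew (incl K A b (p + 1) u), chainE_lie_incl (by omega) (by omega), neg_zero,
        zero_lie, zero_add, if_neg (by omega), lie_sub, lie_smul]

variable (K A b p) in
/-- The `c`-th copy of the subspace of degree `1` in the extended algebra. -/
def dualCopy (c : ℕ) : A.ToLieAlgebra K →ₗ[K] (extend A b (p + 1)).ToLieAlgebra K :=
  (chevalleyInvolution K (extend A b (p + 1)) : _ →ₗ[K] _) ∘ₗ copy K A b p c ∘ₗ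
    (chevalleyInvolution K A : _ →ₗ[K] _)

omit [CharZero K] [Fintype B] in
theorem dualCopy_apply (c : ℕ) (y : A.ToLieAlgebra K) : dualCopy K A b p c y =
    chevalleyInvolution K (extend A b (p + 1)) (copy K A b p c (chevalleyInvolution K A y)) := rfl

omit [CharZero K] [Fintype B] in
theorem dualCopy_zero (y : A.ToLieAlgebra K) : dualCopy K A b p 0 y = incl K A b (p + 1) y := by
  rw [dualCopy_apply, copy_zero, chevalleyInvolution_incl, chevalleyInvolution_apply_apply]

omit [CharZero K] [Fintype B] in
theorem dualCopy_succ (c : ℕ) (y : A.ToLieAlgebra K) :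
    dualCopy K A b p (c + 1) y = -⁅chainF K A b p c, dualCopy K A b p c y⁆ := by
  rw [dualCopy_apply, copy_succ, LieHom.map_lie, chainE, chevalleyInvolution_e, neg_lie]
  rfl

omit [CharZero K] in
theorem chainE_lie_dualCopy {i c : ℕ} (hi : i ≤ p) (hc : c ≤ p + 1) {y : A.ToLieAlgebra K}
    (hy : y ∈ grade K A b 1) :
    ⁅chainE K A b p i, dualCopy K A b p c y⁆ =
      if c = i + 1 then -dualCopy K A b p i y else 0 := by
  have h1 := congrArg (chevalleyInvolution K (extend A b (p + 1)))
    (chainF_lie_copy hi hc (chevalleyInvolution_mem_grade hy))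
  rw [LieHom.map_lie, chainF, chevalleyInvolution_f, neg_lie,
    apply_ite (chevalleyInvolution K (extend A b (p + 1))), map_zero, neg_eq_iff_eq_neg] at h1
  rw [dualCopy_apply, chainE, h1]
  split_ifs
  · rfl
  · exact neg_zero

omit [CharZero K] [Fintype B] in
-- On the attached nodes σ agrees with the Chevalley involution, through which `dualCopy` is
-- defined.
theorem IsExtension.map_copy {τ : GradedInvolution K A b}
    {σ : GradedInvolution K (extend A b (p + 1)) (.inr b)} (hσ : IsExtension τ σ) (a : ℕ)
    (x : A.ToLieAlgebra K) : σ.toHom (copy K A b p a x) = dualCopy K A b p a (τ.toHom x) := by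
  induction a with
  | zero => rw [copy_zero, hσ.1, dualCopy_zero]
  | succ a ih =>
    rw [copy_succ, LieHom.map_lie, ih, chainE, chainNode, hσ.2, neg_lie, dualCopy_succ]
    rfl

/-- The case a = c = 0 is the action of degree 0 on the copies. Then c is raised with the `f` of the
chain and a with the `e`, while g is left free because the chain vectors also move the third factor.
-/
theorem IsCharacter.lie_lie_copy {χ : A.ToLieAlgebra K →ₗ[K] K} (hχ : IsCharacter b χ)
    (hA : IsGCM A) {x y : A.ToLieAlgebra K} (hx : x ∈ grade K A b (-1)) (hy : y ∈ grade K A b 1)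
    {a c g : ℕ} (ha : a ≤ p + 1) (hc : c ≤ p + 1) (hg : g ≤ p + 1) {z : A.ToLieAlgebra K}
    (hz : z ∈ grade K A b (-1)) :
    ⁅⁅copy K A b p a x, dualCopy K A b p c y⁆, copy K A b p g z⁆ =
      (if a = c then copy K A b p g (⁅⁅x, y⁆, z⁆ - χ ⁅x, y⁆ • z) else 0) +
      (if c = g then χ ⁅x, y⁆ • copy K A b p a z else 0) := by
  have hu : ⁅x, y⁆ ∈ grade K A b 0 := by simpa using lie_mem_grade hx hy
  have hζ : ⁅⁅x, y⁆, z⁆ - χ ⁅x, y⁆ • z ∈ grade K A b (-1) :=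
    sub_mem (by simpa using lie_mem_grade hu hz) (Submodule.smul_mem _ _ hz)
  induction a generalizing c g with
  | zero =>
    induction c generalizing g with
    | zero =>
      rw [copy_zero, dualCopy_zero, ← LieHom.map_lie, hχ.incl_lie_copy hA hu hg, if_pos rfl,
        map_sub, map_smul]
      by_cases h0 : g = 0
      · subst h0; simp [copy_zero]
      · simp [h0, Ne.symm h0]
    | succ c ih =>
      have h1 : ⁅copy K A b p 0 x, dualCopy K A b p (c + 1) y⁆ =
          -⁅chainF K A b p c, ⁅copy K A b p 0 x, dualCopy K A b p c y⁆⁆ := by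
        rw [dualCopy_succ, leibniz_lie (chainF K A b p c), copy_zero,
          chainF_lie_incl_of_mem (by omega) hx, zero_lie, zero_add, lie_neg]
      rw [h1, neg_lie, lie_lie, ih (by omega) hg, chainF_lie_copy (by omega) hg hz]
      simp only [lie_add, apply_ite (fun t => ⁅chainF K A b p c, t⁆), lie_zero, lie_smul,
        chainF_lie_copy (show c ≤ p by omega) hg hζ,
        chainF_lie_copy (show c ≤ p by omega) (Nat.zero_le _) hz]
      by_cases h2 : g = c + 1
      · subst h2
        simp [ih (g := c) (by omega) (by omega), -lie_lie]
      · simp [h2, Ne.symm h2]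
  | succ a ih =>
    -- The e-vector commutes past the dual copy except when c = a + 1, which it lowers to a; the
    -- diagonal case a + 1 = c thus comes from the diagonal case one step below.
    have h1 : ⁅copy K A b p (a + 1) x, dualCopy K A b p c y⁆ =
        ⁅chainE K A b p a, ⁅copy K A b p a x, dualCopy K A b p c y⁆⁆ +
          if c = a + 1 then ⁅copy K A b p a x, dualCopy K A b p a y⁆ else 0 := by
      rw [copy_succ, lie_lie, chainE_lie_dualCopy (by omega) hc hy]
      split_ifs
      · rw [lie_neg, sub_neg_eq_add]
      · rw [lie_zero, sub_zero, add_zero]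
    rw [h1, add_lie, lie_lie, ih (by omega) hc hg, chainE_lie_copy (by omega) hg hz]
    simp only [lie_add, apply_ite (fun t => ⁅chainE K A b p a, t⁆), lie_zero, lie_smul,
        chainE_lie_copy (show a ≤ p by omega) hg hζ,
        chainE_lie_copy (show a ≤ p by omega) (show a ≤ p + 1 by omega) hz,
        apply_ite (fun t => ⁅t, copy K A b p g z⁆), zero_lie, ih (c := a) (by omega) (by omega) hg]
    by_cases h2 : a = g
    · subst h2
      simp only [if_true, ih (c := c) (g := a + 1) (by omega) hc (by omega)]
      by_cases h3 : a = c
      · subst h3; simp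
      · by_cases h4 : c = a + 1
        · subst h4; simp; abel
        · simp [h3, h4, Ne.symm h3, Ne.symm h4]
    · by_cases h3 : c = a + 1
      · subst h3; simp [h2]; abel
      · simp [h2, h3, Ne.symm h3]

end CharZero

end Chain

/-! ### The isomorphism of triple systems -/

section TripleSystem

variable {K : Type*} [Field K] {B : Type*} [DecidableEq B] {A : Matrix B B ℤ} {b : B} {p : ℕ}

theorem copy_mem {a : ℕ} {x : A.ToLieAlgebra K} (hx : x ∈ grade K A b (-1)) :
    copy K A b p a x ∈ grade K (extend A b (p + 1)) (.inr b) (-1) := by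
  induction a with
  | zero => exact incl_mem_grade hx
  | succ a ih =>
    rw [copy_succ, chainE]
    simpa using lie_mem_grade (e_mem_grade_zero (i := chainNode B p a) (by simp [chainNode])) ih

variable (K A b p) in
/-- The sum of the maps `copy a`. -/
def sumCopy : (Fin (p + 2) → grade K A b (-1)) →ₗ[K]
    grade K (extend A b (p + 1)) (.inr b) (-1) :=
  LinearMap.codRestrict _
    (∑ a : Fin (p + 2), copy K A b p a ∘ₗ (grade K A b (-1)).subtype ∘ₗ LinearMap.proj a)
    fun u => by
      rw [LinearMap.sum_apply]
      exact sum_mem fun a _ => copy_mem (u a).2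

theorem coe_sumCopy (u : Fin (p + 2) → grade K A b (-1)) :
    (sumCopy K A b p u : (extend A b (p + 1)).ToLieAlgebra K) =
      ∑ a : Fin (p + 2), copy K A b p a (u a : A.ToLieAlgebra K) := by
  simp [sumCopy]

theorem coe_sumCopy_single (g : Fin (p + 2)) (z : grade K A b (-1)) :
    (sumCopy K A b p (Pi.single g z) : (extend A b (p + 1)).ToLieAlgebra K) =
      copy K A b p g (z : A.ToLieAlgebra K) := by
  rw [coe_sumCopy, Finset.sum_eq_single g]
  · simp
  · intro a _ ha
    simp [ha]
  · simp

theorem coe_sumCopy_ite_single (P : Prop) [Decidable P] (g : Fin (p + 2))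
    (z : grade K A b (-1)) :
    (sumCopy K A b p (if P then Pi.single g z else 0) : (extend A b (p + 1)).ToLieAlgebra K) =
      if P then copy K A b p g (z : A.ToLieAlgebra K) else 0 := by
  split_ifs
  · exact coe_sumCopy_single g z
  · simp

variable [Fintype B]

theorem eq_zero_of_copy_eq_zero {a : ℕ} (ha : a ≤ p + 1) {x : A.ToLieAlgebra K}
    (hx : x ∈ grade K A b (-1)) (h0 : copy K A b p a x = 0) : incl K A b (p + 1) x = 0 := by
  induction a with
  | zero => exact h0
  | succ a ih =>
    have h1 := chainF_lie_copy (show a ≤ p by omega) ha hx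
    rw [h0, lie_zero, if_pos rfl] at h1
    exact ih (by omega) h1.symm

variable [CharZero K] {d : B → ℚ}

/-- The coroots of 𝔥 stay independent in the extended algebra, so the inclusion is injective on the
Cartan subalgebra and therefore in degree -1. -/
theorem IsFiniteType.eq_zero_of_incl_eq_zero (hA : IsFiniteType A d) {x : A.ToLieAlgebra K}
    (hx : x ∈ grade K A b (-1)) (h0 : incl K A b (p + 1) x = 0) : x = 0 := by
  refine hA.eq_zero_of_mem_grade (incl K A b (p + 1)) (fun c hc hc0 => ?_) hx h0
  obtain ⟨k, rfl⟩ := (Submodule.mem_span_range_iff_exists_fun K).1 hc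
  have h1 : ∑ i, (Sum.elim 0 k : Fin (p + 1) ⊕ B → K) i • h K (extend A b (p + 1)) i = 0 := by
    rw [Fintype.sum_sum_type]
    simpa using hc0
  have h2 := h_linearIndependent hA.isGCM.extend h1
  exact Finset.sum_eq_zero fun i _ => by
    rw [show k i = 0 from h2 (.inr i), zero_smul]

/-- The a-th `f` of the chain isolates the component a + 1, and further ones bring it down to 𝔥;
component 0 is what remains. -/
theorem sumCopy_injective (hA : IsFiniteType A d) : Function.Injective (sumCopy K A b p) := by
  rw [← LinearMap.ker_eq_bot, LinearMap.ker_eq_bot']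
  intro u hu
  have h0 : ∑ a : Fin (p + 2), copy K A b p a (u a : A.ToLieAlgebra K) = 0 := by
    rw [← coe_sumCopy, hu]; rfl
  have h1 : ∀ a : Fin (p + 1), u a.succ = 0 := fun a => by
    have h2 := congrArg (fun t => ⁅chainF K A b p a, t⁆) h0
    simp only [lie_sum, lie_zero] at h2
    rw [Finset.sum_eq_single a.succ] at h2
    · rw [chainF_lie_copy (by omega) (by omega) (u a.succ).2, if_pos (by simp)] at h2
      exact Subtype.ext (hA.eq_zero_of_incl_eq_zero (u a.succ).2
        (eq_zero_of_copy_eq_zero (by omega) (u a.succ).2 h2))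
    · intro g _ hg
      rw [chainF_lie_copy (by omega) (by omega) (u g).2, if_neg]
      intro h
      exact hg (Fin.ext (by simpa using h))
    · simp
  rw [Fin.sum_univ_succ] at h0
  simp only [h1, ZeroMemClass.coe_zero, map_zero, Finset.sum_const_zero, add_zero] at h0
  refine funext (Fin.cases (Subtype.ext ?_) h1)
  exact hA.eq_zero_of_incl_eq_zero (u 0).2 h0

/-- The sum of the copies contains `e b` and is stable under all other `e j`: those of the chain
permute or kill the copies, those of 𝔥 act within each copy. -/
theorem sumCopy_surjective (hA : IsFiniteType A d) : Function.Surjective (sumCopy K A b p) := by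
  obtain ⟨χ, hχ⟩ := exists_isCharacter (K := K) hA.isGCM b
  let N : Submodule K ((extend A b (p + 1)).ToLieAlgebra K) :=
    (LinearMap.range (sumCopy K A b p)).map (Submodule.subtype _)
  have hN : ∀ a ≤ p + 1, ∀ z ∈ grade K A b (-1), copy K A b p a z ∈ N := fun a ha z hz =>
    ⟨_, ⟨Pi.single ⟨a, by omega⟩ ⟨z, hz⟩, rfl⟩, coe_sumCopy_single _ _⟩
  have hle : grade K (extend A b (p + 1)) (.inr b) (-1) ≤ N := by
    refine grade_neg_one_le (by simpa [copy_zero] using hN 0 (by omega) _ (e_mem_grade b)) ?_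
    rintro j hj _ ⟨_, ⟨u, rfl⟩, rfl⟩
    rw [Submodule.subtype_apply, coe_sumCopy, lie_sum]
    refine sum_mem fun a _ => ?_
    rcases j with j | j
    · have hj : e K (extend A b (p + 1)) (.inl j) = chainE K A b p (p - j) := by
        rw [chainE, chainNode]
        congr 2
        exact Fin.ext (by simp; omega)
      rw [hj, chainE_lie_copy (by omega) (by omega) (u a).2]
      split_ifs
      · exact hN _ (by omega) _ (u a).2
      · exact zero_mem _
    · have hj : j ≠ b := fun h => hj (congrArg _ h)
      rw [← incl_e, hχ.incl_lie_copy hA.isGCM (e_mem_grade_zero hj) (by omega)]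
      refine sub_mem (hN _ (by omega) _ ?_) ?_
      · simpa using lie_mem_grade (e_mem_grade_zero hj) (u a).2
      · split_ifs
        · exact zero_mem _
        · exact Submodule.smul_mem _ _ (hN _ (by omega) _ (u a).2)
  intro y
  obtain ⟨z, ⟨u, rfl⟩, hz⟩ := hle y.2
  exact ⟨u, Subtype.ext hz⟩

/-- Both sides are sums over the positions a, c, g, and agree term by term once the form is written
through χ. -/
theorem sumCopy_powTriple (hA : IsFiniteType A d) {τ : GradedInvolution K A b}
    {β : LinearMap.BilinForm K (grade K A b (-1))}
    {σ : GradedInvolution K (extend A b (p + 1)) (.inr b)} (hβ : IsAssociatedForm d τ β)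
    (hσ : IsExtension τ σ) (u v w : Fin (p + 2) → grade K A b (-1)) :
    sumCopy K A b p (powTriple τ β u v w) =
      σ.triple (sumCopy K A b p u) (sumCopy K A b p v) (sumCopy K A b p w) := by
  obtain ⟨χ, hχ⟩ := exists_isCharacter (K := K) hA.isGCM b
  refine Subtype.ext ?_
  change _ = ⁅⁅_, _⁆, _⁆
  simp only [powTriple, map_sum, map_add, map_sub, coe_sumCopy u, coe_sumCopy v, coe_sumCopy w,
    Submodule.coe_add, Submodule.coe_sub, AddSubmonoidClass.coe_finsetSum, coe_sumCopy_ite_single,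
    hσ.map_copy]
  rw [sum_lie, sum_lie]
  refine Finset.sum_congr rfl fun a _ => ?_
  rw [lie_sum _ _ (copy K A b p a _), sum_lie]
  refine Finset.sum_congr rfl fun c _ => ?_
  rw [lie_sum]
  refine Finset.sum_congr rfl fun g _ => ?_
  have hy : τ.toHom (v c) ∈ grade K A b 1 := by simpa using τ.graded (-1) _ (v c).2
  rw [hχ.lie_lie_copy hA.isGCM (u a).2 hy (by omega) (by omega) (by omega) (w g).2,
    hβ.eq_characterForm hχ hA]
  simp only [characterForm_apply, GradedInvolution.triple, Submodule.coe_smul, map_sub, map_smul,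
    Fin.ext_iff]
  by_cases h1 : (a : ℕ) = c <;> simp [h1]

end TripleSystem

end

end KacMoody

theorem theorem1 {K : Type*} [Field K] [CharZero K] {B : Type*} [Fintype B] [DecidableEq B]
    (A : Matrix B B ℤ) (d : B → ℚ) (hA : KacMoody.IsFiniteType A d) (b : B)
    (n : ℕ) (hn : 2 ≤ n) (τ : KacMoody.GradedInvolution K A b) :
    (∃! β : LinearMap.BilinForm K (KacMoody.grade K A b (-1)),
      KacMoody.IsAssociatedForm d τ β) ∧
    (∃! σ : KacMoody.GradedInvolution K (KacMoody.extend A b (n - 1)) (.inr b),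
      KacMoody.IsExtension τ σ) ∧
    ∀ (β : LinearMap.BilinForm K (KacMoody.grade K A b (-1)))
      (σ : KacMoody.GradedInvolution K (KacMoody.extend A b (n - 1)) (.inr b)),
      KacMoody.IsAssociatedForm d τ β → KacMoody.IsExtension τ σ →
      ∃ φ : (Fin n → KacMoody.grade K A b (-1)) ≃ₗ[K]
          KacMoody.grade K (KacMoody.extend A b (n - 1)) (.inr b) (-1),
        ∀ u v w : Fin n → KacMoody.grade K A b (-1),
          φ (KacMoody.powTriple τ β u v w) = σ.triple (φ u) (φ v) (φ w) := by
  -- With n = p + 2 the chain has p + 1 nodes, so an adjacent node exists, and the copies are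
  -- numbered from 0 to p + 1.
  obtain ⟨p, rfl⟩ := Nat.exists_eq_add_of_le' hn
  exact ⟨KacMoody.existsUnique_isAssociatedForm hA τ, KacMoody.existsUnique_isExtension τ hA p,
    fun β σ hβ hσ => ⟨LinearEquiv.ofBijective (KacMoody.sumCopy K A b p)
      ⟨KacMoody.sumCopy_injective hA, KacMoody.sumCopy_surjective hA⟩,
      fun u v w => KacMoody.sumCopy_powTriple hA hβ hσ u v w⟩⟩
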